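/- Let $k_p,k_s>0$. Use spherical coordinates $x=(r\sin\theta\cos\varphi,r\sin\theta\sin\varphi,r\cos\theta)$ on $\mathbb{R}^3$ with unit frame $\hat r,\hat\theta,\hat\varphi$. For integers $\ell\ge 0$, $|m|\le \ell$ and $k>0$ put $F_{\ell,k}^m(x)=j_\ell(kr)\,Y_\ell^m(\theta,\varphi)$, where $j_\ell$ is the spherical Bessel function of the first kind and $$Y_\ell^m(\theta,\varphi)=\Omega_{\ell m}^{-1/2}P_\ell^{|m|}(\cos\theta)e^{im\varphi},\qquad \Omega_{\ell m}=\frac{4\pi}{2\ell+1}\,\frac{(\ell+|m|)!}{(\ell-|m|)!},$$ with the associated Legendre functions $P_\ell^{m}(t)=(-1)^m(1-t^2)^{m/2}\frac{d^m}{dt^m}P_\ell(t)$, $m\ge 0$. Define the Navier eigenvectors (Hansen vectors) $$\mathbf L_\ell^m=\nabla F_{\ell,k_p}^m,\qquad \mathbf M_\ell^m=\nabla\times(x\,F_{\ell,k_s}^m),\qquad \mathbf N_\ell^m=\nabla\times(\nabla\times(x\,F_{\ell,k_s}^m)).$$ For a vector field $\mathbf u=u^r\hat r+u^\theta\hat\theta+u^\varphi\hat\varphi$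 with values in $\mathbb{C}^3$ let $$\begin{aligned}\nabla_S\mathbf u={}&(\partial_\theta u^r-u^\theta)\,\hat\theta\otimes\hat r+(\partial_\theta u^\theta+u^r)\,\hat\theta\otimes\hat\theta+\partial_\theta u^\varphi\,\hat\theta\otimes\hat\varphi+\Big(\tfrac{\partial_\varphi u^r}{\sin\theta}-u^\varphi\Big)\hat\varphi\otimes\hat r\\&+\Big(\tfrac{\partial_\varphi u^\theta}{\sin\theta}-u^\varphi\cot\theta\Big)\hat\varphi\otimes\hat\theta+\Big(\tfrac{\partial_\varphi u^\varphi}{\sin\theta}+u^r+u^\theta\cot\theta\Big)\hat\varphi\otimes\hat\varphi,\end{aligned}$$ and let $$\langle\mathbf u,\mathbf v\rangle_{\mathcal H}=\int_{\mathbb{R}^3}\Big(\mathbf u\cdot\overline{\mathbf v}+\nabla_S\mathbf u:\overline{\nabla_S\mathbf v}\Big)\frac{dx}{(1+|x|^2)^{3/2}},$$ where $A:B=\sum_{i,j}A_{ij}B_{ij}$. Then, for all integers $\ell,\ell'\ge 0$, $|m|\le\ell$, $|m'|\le\ell'$, the integrals defining the inner products below converge absolutely, and $$\begin{aligned} \langle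 \mathbf L_\ell^m,\mathbf L_{\ell'}^{m'}\rangle_{\mathcal H}&=O(1)\,\delta_{\ell\ell'}\delta_{mm'},& \langle \mathbf M_\ell^m,\mathbf M_{\ell'}^{m'}\rangle_{\mathcal H}&=O(\ell^2)\,\delta_{\ell\ell'}\delta_{mm'},\\ \langle \mathbf N_\ell^m,\mathbf N_{\ell'}^{m'}\rangle_{\mathcal H}&=O(\ell^2)\,\delta_{\ell\ell'}\delta_{mm'},& \langle \mathbf L_\ell^m,\mathbf N_{\ell'}^{m'}\rangle_{\mathcal H}&=o(1)\,\delta_{\ell\ell'}\delta_{mm'}, \end{aligned}$$ as $\ell\to\infty$, and $$\langle \mathbf L_\ell^m,\mathbf M_{\ell'}^{m'}\rangle_{\mathcal H}=\langle \mathbf M_\ell^m,\mathbf N_{\ell'}^{m'}\rangle_{\mathcal H}=0.$$ That is, all these inner products are equal to zero whenever $(\ell,m)\ne(\ell',m')$, the last two vanish for all indices, and the $O$ and $o$ bounds for $(\ell,m)=(\ell',m')$ are uniform in $|m|\le\ell$ (with constants depending on $k_p,k_s$ only). -/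

import Mathlib

open Filter MeasureTheory

namespace NavierHansen

noncomputable section

/-- Euclidean three-space. -/
abbrev E3 : Type := EuclideanSpace ℝ (Fin 3)

/-- Complex vector fields on Euclidean three-space, in Cartesian components. -/
abbrev VField : Type := E3 → Fin 3 → ℂ

/-! ### Cartesian vector calculus -/

/-- The Cartesian partial derivative `∂f/∂xᵢ` at `x`. -/
def pderiv (i : Fin 3) (f : E3 → ℂ) (x : E3) : ℂ :=
  fderiv ℝ f x (EuclideanSpace.single i (1 : ℝ))

/-- The gradient of a complex-valued function. -/
def grad (f : E3 → ℂ) : VField := fun x i => pderiv i f x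

/-- The curl of a complex vector field. -/
def curl (u : VField) : VField := fun x =>
  ![pderiv 1 (fun y => u y 2) x - pderiv 2 (fun y => u y 1) x,
    pderiv 2 (fun y => u y 0) x - pderiv 0 (fun y => u y 2) x,
    pderiv 0 (fun y => u y 1) x - pderiv 1 (fun y => u y 0) x]

/-- The vector field `x ↦ x f(x)`. -/
def posMul (f : E3 → ℂ) : VField := fun x i => (x i : ℂ) * f x

/-! ### Spherical coordinates -/

/-- The radial unit vector. -/
def rHat (θ φ : ℝ) : Fin 3 → ℝ :=
  ![Real.sin θ * Real.cos φ, Real.sin θ * Real.sin φ, Real.cos θ]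

/-- The polar unit vector. -/
def thetaHat (θ φ : ℝ) : Fin 3 → ℝ :=
  ![Real.cos θ * Real.cos φ, Real.cos θ * Real.sin φ, -Real.sin θ]

/-- The azimuthal unit vector. -/
def phiHat (_θ φ : ℝ) : Fin 3 → ℝ :=
  ![-Real.sin φ, Real.cos φ, 0]

/-- The point with spherical coordinates `(r, θ, φ)`. -/
def sphPoint (r θ φ : ℝ) : E3 := WithLp.toLp 2 (fun i => r * rHat θ φ i)

/-- The polar angle of `x`, in `[0, π]`. -/
def polar (x : E3) : ℝ := Real.arccos (x 2 / ‖x‖)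

/-- The azimuth of `x`, in `(-π, π]`; only `exp (i m φ)` and derivatives in `φ` are ever used,
so the choice of the interval of length `2π` is immaterial. -/
def azimuth (x : E3) : ℝ := Complex.arg ((x 0 : ℂ) + (x 1 : ℂ) * Complex.I)

/-- The component of `u` along the frame vector `e`, as a function of `(r, θ, φ)`. -/
def sphComp (e : ℝ → ℝ → Fin 3 → ℝ) (u : VField) (r θ φ : ℝ) : ℂ :=
  ∑ i, u (sphPoint r θ φ) i * (e θ φ i : ℂ)

/-- The spherical gradient `∇_S u` at the point with spherical coordinates `(r, θ, φ)`: the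
second-order tensor `(θ̂ ∂_θ + (sin θ)⁻¹ φ̂ ∂_φ) ⊗ u`, as its matrix in the orthonormal frame
`(r̂, θ̂, φ̂)`; the row is the first tensor factor, the column is the second one. -/
def sphGradAt (u : VField) (r θ φ : ℝ) : Matrix (Fin 3) (Fin 3) ℂ :=
  let ur := sphComp rHat u
  let ut := sphComp thetaHat u
  let up := sphComp phiHat u
  let s : ℂ := (Real.sin θ : ℂ)
  let ct : ℂ := (Real.cos θ / Real.sin θ : ℝ)
  !![0, 0, 0;
     deriv (fun t => ur r t φ) θ - ut r θ φ,
     deriv (fun t => ut r t φ) θ + ur r θ φ,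
     deriv (fun t => up r t φ) θ;
     deriv (fun p => ur r θ p) φ / s - up r θ φ,
     deriv (fun p => ut r θ p) φ / s - up r θ φ * ct,
     deriv (fun p => up r θ p) φ / s + ur r θ φ + ut r θ φ * ct]

/-- The spherical gradient as a tensor field on space (meaningful off the axis `x₀ = x₁ = 0`,
a null set). -/
def sphGrad (u : VField) (x : E3) : Matrix (Fin 3) (Fin 3) ℂ :=
  sphGradAt u ‖x‖ (polar x) (azimuth x)

/-! ### The inner product -/

/-- The integrand `(u · v̄ + ∇_S u : conj (∇_S v)) ⟨x⟩⁻³`, where `⟨x⟩ = (1 + |x|²)^(1/2)`. -/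
def hDensity (u v : VField) (x : E3) : ℂ :=
  ((∑ i, u x i * starRingEnd ℂ (v x i)) +
      ∑ i, ∑ j, sphGrad u x i j * starRingEnd ℂ (sphGrad v x i j)) /
    ((Real.sqrt (1 + ‖x‖ ^ 2) ^ 3 : ℝ) : ℂ)

/-- The integral that defines `⟨u, v⟩_H` converges absolutely. -/
def HIntegrable (u v : VField) : Prop := Integrable (hDensity u v) volume

/-- The inner product `⟨u, v⟩_H`. -/
def hInner (u v : VField) : ℂ := ∫ x, hDensity u v x

/-! ### Special functions -/

/-- The spherical Bessel function of the first kind of order `ℓ`, by its power series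
`j_ℓ(z) = z^ℓ ∑ₖ (-z²/2)^k / (k! (2ℓ+2k+1)!!)`; for `z > 0` this is
`√(π/(2z)) J_{ℓ+1/2}(z)`. -/
def sphBessel (ℓ : ℕ) (z : ℝ) : ℝ :=
  z ^ ℓ * ∑' k : ℕ, (-(z ^ 2) / 2) ^ k /
    ((Nat.factorial k : ℝ) * (Nat.doubleFactorial (2 * ℓ + 2 * k + 1) : ℝ))

/-- The Legendre polynomial of degree `ℓ` (Rodrigues' formula). -/
def legendrePoly (ℓ : ℕ) : Polynomial ℝ :=
  Polynomial.C (1 / (2 ^ ℓ * (Nat.factorial ℓ : ℝ))) *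
    Polynomial.derivative^[ℓ] ((Polynomial.X ^ 2 - 1) ^ ℓ)

/-- The associated Legendre function `P_ℓ^m(t) = (-1)^m (1-t²)^(m/2) P_ℓ^{(m)}(t)`, `m ≥ 0`. -/
def assocLegendre (ℓ m : ℕ) (t : ℝ) : ℝ :=
  (-1) ^ m * Real.sqrt (1 - t ^ 2) ^ m * (Polynomial.derivative^[m] (legendrePoly ℓ)).eval t

/-- The normalizing constant `Ω_{ℓm} = 4π/(2ℓ+1) · (ℓ+|m|)!/(ℓ-|m|)!` (used for `|m| ≤ ℓ`). -/
def normConst (ℓ : ℕ) (m : ℤ) : ℝ :=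
  4 * Real.pi / (2 * (ℓ : ℝ) + 1) *
    ((Nat.factorial (ℓ + m.natAbs) : ℝ) / (Nat.factorial (ℓ - m.natAbs) : ℝ))

/-- The spherical harmonic `Y_ℓ^m(θ, φ) = Ω_{ℓm}^(-1/2) P_ℓ^{|m|}(cos θ) e^{imφ}`. -/
def sphHarmonic (ℓ : ℕ) (m : ℤ) (θ φ : ℝ) : ℂ :=
  ((assocLegendre ℓ m.natAbs (Real.cos θ) / Real.sqrt (normConst ℓ m) : ℝ) : ℂ) *
    Complex.exp (Complex.I * (m : ℂ) * (φ : ℂ))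

/-- The entire solution `F_{ℓ,k}^m(x) = j_ℓ(k r) Y_ℓ^m(θ, φ)` of the Helmholtz equation
`Δ F + k² F = 0`. -/
def waveF (k : ℝ) (ℓ : ℕ) (m : ℤ) (x : E3) : ℂ :=
  (sphBessel ℓ (k * ‖x‖) : ℂ) * sphHarmonic ℓ m (polar x) (azimuth x)

/-! ### The Navier eigenvectors (Hansen vectors) -/

/-- `L_ℓ^m = ∇ F_{ℓ,k}^m`. -/
def hansenL (k : ℝ) (ℓ : ℕ) (m : ℤ) : VField := grad (waveF k ℓ m)

/-- `M_ℓ^m = ∇ × (x F_{ℓ,k}^m)`. -/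
def hansenM (k : ℝ) (ℓ : ℕ) (m : ℤ) : VField := curl (posMul (waveF k ℓ m))

/-- `N_ℓ^m = ∇ × (∇ × (x F_{ℓ,k}^m))`. -/
def hansenN (k : ℝ) (ℓ : ℕ) (m : ℤ) : VField := curl (curl (posMul (waveF k ℓ m)))

end

end NavierHansen

open NavierHansen

/-!
The three families are radial functions times vector fields with polynomial components. If
`H = r ^ ℓ Y_ℓ^m` is the solid harmonic of degree `ℓ`, then the recurrences of the Bessel
functions turn `L_ℓ^m` and `N_ℓ^m` into combinations of `j_{ℓ-1}(kr) r ^ (1-ℓ) ∇H` and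
`j_{ℓ+1}(kr) r ^ (-ℓ-1) (x H - r² ∇H / (2ℓ + 1))`, and `M_ℓ^m` into `j_ℓ(kr) r ^ (-ℓ) (∇H × x)`
(`hansenL_eq`, `hansenN_eq`, `hansenM_eq`). The Cartesian components of the three polynomial
fields are harmonic and homogeneous, of degrees `ℓ - 1`, `ℓ + 1` and `ℓ`.

The spherical gradient is the angular part `r∇ - x ∂_r` of the gradient, applied to the Cartesian
components. Its contraction is `∑ (x × ∇) uᵢ · conj ((x × ∇) vᵢ)` (`sphGrad_contract`), and
`x × ∇` does not see radial factors. On harmonic components of degree `p` it contributes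
`p (p + 1)` times the `L²` product (`sphInt_sum_ang`), so each inner product is a sum of terms
`1 + p (p + 1)` times a sphere integral times `∫ j_p(kr) j_p(k'r) r² (1 + r²) ^ (-3/2) dr`
(`hasHInner_besField`). The sphere integrals of the vector solid harmonics follow from the
divergence theorem on the sphere (`sphInt_dd`, deduced from integrating by parts against a
Gaussian). They reduce to `∫ H conj H'`, which gives all the orthogonality relations
(`sphInt_harmP_of_ne`, `sphInt_grad_pos`, `sphInt_grad_tor`, `sphInt_pos_tor`) and, with
`sphInt_harmP_self`, explicit values on the diagonal (`hasHInner_spheroidal`,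
`hasHInner_tor_tor`).

The weight `r² (1 + r²) ^ (-3/2)` is at most `1 / r`, and `∫ j_p(kr)² dr / r = 1 / (2 p (p + 1))`
(`integral_sphBessel_sq_div`). Hence `(1 + p (p + 1))` times the radial integral is at most `1`;
this is the bound for `L`, `M` and `N`. In `⟨L, N⟩` the terms of orders `ℓ - 1` and `ℓ + 1` enter
with the same factor, of size `ℓ`, and with opposite signs, so it suffices that their difference
is `O(ℓ⁻²)`. The weight differs from `1 / r` by at most `2 / r³`, and third moments of `j_p²` are
`O(p⁻⁴)`; therefore only `∫ j_p(ar) j_p(br) dr / r` matters. For `a = b` it is known exactly, and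
for `a ≠ b` it is `O(p⁻⁴)`, by two integrations by parts with the Wronskian of the two radial
functions (`besInt_wronskian`, `besInt_one_le`). Both cases are in `weightInt_asymptotics`.
-/

namespace NavierHansen

noncomputable section

open scoped Topology

/-! ### Polynomials on Euclidean space and integration in polar coordinates -/

/-- Complex polynomials in the three Cartesian coordinates. -/
abbrev Poly : Type := MvPolynomial (Fin 3) ℂ

/-- The value of a polynomial at a point of Euclidean space. -/
def ev (Q : Poly) (x : E3) : ℂ := MvPolynomial.eval (fun i => (x i : ℂ)) Q

/-- The formal partial derivative of a polynomial. -/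
abbrev dd (i : Fin 3) : Derivation ℂ Poly Poly := MvPolynomial.pderiv i

/-- The `i`-th coordinate, as a complex-valued real-linear form. -/
def coordC (i : Fin 3) : E3 →L[ℝ] ℂ := Complex.ofRealCLM.comp (EuclideanSpace.proj i)

@[simp] lemma coordC_apply (i : Fin 3) (x : E3) : coordC i x = (x i : ℂ) := rfl

@[simp] lemma ev_add (P Q : Poly) (x : E3) : ev (P + Q) x = ev P x + ev Q x := by simp [ev]
@[simp] lemma ev_sub (P Q : Poly) (x : E3) : ev (P - Q) x = ev P x - ev Q x := by simp [ev]
@[simp] lemma ev_neg (P : Poly) (x : E3) : ev (-P) x = -ev P x := by simp [ev]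
@[simp] lemma ev_mul (P Q : Poly) (x : E3) : ev (P * Q) x = ev P x * ev Q x := by simp [ev]
@[simp] lemma ev_pow (P : Poly) (n : ℕ) (x : E3) : ev (P ^ n) x = ev P x ^ n := by simp [ev]
@[simp] lemma ev_C (c : ℂ) (x : E3) : ev (MvPolynomial.C c) x = c := by simp [ev]
@[simp] lemma ev_X (i : Fin 3) (x : E3) : ev (MvPolynomial.X i) x = (x i : ℂ) := by simp [ev]
@[simp] lemma ev_zero (x : E3) : ev 0 x = 0 := by simp [ev]
@[simp] lemma ev_one (x : E3) : ev 1 x = 1 := by simp [ev]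
@[simp] lemma ev_natCast (n : ℕ) (x : E3) : ev (n : Poly) x = n := by simp [ev]
@[simp] lemma ev_sum {ι : Type*} (s : Finset ι) (f : ι → Poly) (x : E3) :
    ev (∑ i ∈ s, f i) x = ∑ i ∈ s, ev (f i) x := by simp [ev]

lemma hasFDerivAt_ev (Q : Poly) (x : E3) :
    HasFDerivAt (ev Q) (∑ i, ev (dd i Q) x • coordC i) x := by
  induction Q using MvPolynomial.induction_on with
  | C a =>
    have : ev (MvPolynomial.C a) = fun _ => a := by ext; simp
    rw [this]
    refine (hasFDerivAt_const (𝕜 := ℝ) a x).congr_fderiv ?_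
    ext v
    simp [Fin.sum_univ_three]
  | add p q hp hq =>
    have : ev (p + q) = fun y => ev p y + ev q y := by ext; simp
    rw [this]
    refine (hp.fun_add hq).congr_fderiv ?_
    ext v
    simp [Fin.sum_univ_three]
    ring
  | mul_X p n hp =>
    have : ev (p * MvPolynomial.X n) = fun y => ev p y * coordC n y := by ext; simp
    rw [this]
    refine (hp.fun_mul (coordC n).hasFDerivAt).congr_fderiv ?_
    ext v
    fin_cases n <;>
      simp [Derivation.leibniz, MvPolynomial.pderiv_X, Fin.sum_univ_three] <;> ring

lemma differentiable_ev (Q : Poly) : Differentiable ℝ (ev Q) := fun x =>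
  (hasFDerivAt_ev Q x).differentiableAt

lemma continuous_ev (Q : Poly) : Continuous (ev Q) := (differentiable_ev Q).continuous

lemma fderiv_ev_single (Q : Poly) (x : E3) (i : Fin 3) :
    fderiv ℝ (ev Q) x (EuclideanSpace.single i (1 : ℝ)) = ev (dd i Q) x := by
  rw [(hasFDerivAt_ev Q x).fderiv]
  fin_cases i <;> simp [Fin.sum_univ_three]

lemma ev_real_smul {Q : Poly} {n : ℕ} (h : Q.IsHomogeneous n) (t : ℝ) (x : E3) :
    ev Q (t • x) = (t : ℂ) ^ n * ev Q x := by
  simp only [ev, MvPolynomial.eval_eq', Finset.mul_sum]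
  refine Finset.sum_congr rfl fun s hs => ?_
  have hd : s 0 + s 1 + s 2 = n := by
    have := h.degree_eq_sum_deg_support hs
    rw [this, ← Finsupp.degree_apply, Finsupp.degree_eq_sum, Fin.sum_univ_three]
  simp only [Fin.prod_univ_three, PiLp.smul_apply, smul_eq_mul, Complex.ofReal_mul, mul_pow]
  rw [← hd]
  ring

/-- The integral of a polynomial over the unit sphere. -/
def sphInt (Q : Poly) : ℂ := ∫ ω : Metric.sphere (0 : E3) 1, ev Q ω ∂(volume : Measure E3).toSphere

lemma integrable_ev_sphere (Q : Poly) :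
    Integrable (fun ω : Metric.sphere (0 : E3) 1 => ev Q ω) (volume : Measure E3).toSphere :=
  ((continuous_ev Q).comp continuous_subtype_val).integrable_of_hasCompactSupport
    (HasCompactSupport.of_compactSpace _)

lemma finrank_E3 : Module.finrank ℝ E3 = 3 := by simp

/-- Integration in polar coordinates: the angular and the radial part of `ρ(|x|) Q(x)` separate,
because `Q(rω) = r ^ d Q(ω)`. -/
lemma integrable_radial_mul_ev {Q : Poly} {d : ℕ} (h : Q.IsHomogeneous d) {ρ : ℝ → ℂ}
    (hρ : IntegrableOn (fun r => ρ r * (r : ℂ) ^ (d + 2)) (Set.Ioi 0)) :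
    Integrable (fun x : E3 => ρ ‖x‖ * ev Q x) := by
  have hr : Integrable (fun r : Set.Ioi (0 : ℝ) => ρ r * ((r : ℝ) : ℂ) ^ d)
      (Measure.volumeIoiPow 2) := by
    rw [Measure.volumeIoiPow, integrable_withDensity_iff_integrable_smul' (by fun_prop) (by simp)]
    rw [integrableOn_iff_comap_subtypeVal measurableSet_Ioi] at hρ
    refine hρ.congr (Eventually.of_forall fun r => ?_)
    have hr0 : (0 : ℝ) ≤ r.1 := le_of_lt r.2
    simp only [Function.comp, ENNReal.toReal_ofReal (pow_nonneg hr0 2), Complex.real_smul]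
    push_cast
    ring
  have hp : Integrable (fun p : Metric.sphere (0 : E3) 1 × Set.Ioi (0 : ℝ) =>
      ev Q p.1 * (ρ p.2 * ((p.2 : ℝ) : ℂ) ^ d))
      ((volume : Measure E3).toSphere.prod (.volumeIoiPow (Module.finrank ℝ E3 - 1))) := by
    rw [finrank_E3]
    exact (integrable_ev_sphere Q).mul_prod hr
  rw [← (volume : Measure E3).measurePreserving_homeomorphUnitSphereProd.integrable_comp_emb
    (Homeomorph.measurableEmbedding _)] at hp
  rw [← restrict_compl_singleton (μ := (volume : Measure E3)) 0, ← IntegrableOn,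
    integrableOn_iff_comap_subtypeVal (measurableSet_singleton _).compl]
  refine hp.congr (Eventually.of_forall fun x => ?_)
  have hx : x.1 ≠ 0 := x.2
  have hn : ‖x.1‖ ≠ 0 := norm_ne_zero_iff.2 hx
  have h1 : ev Q x.1 = (‖x.1‖ : ℂ) ^ d * ev Q ((‖x.1‖)⁻¹ • x.1) := by
    rw [← ev_real_smul h, smul_smul, mul_inv_cancel₀ hn, one_smul]
  simp only [Function.comp, homeomorphUnitSphereProd_apply_snd_coe,
    homeomorphUnitSphereProd_apply_fst_coe]
  rw [h1]
  ring

lemma integral_radial_mul_ev {Q : Poly} {d : ℕ} (h : Q.IsHomogeneous d) (ρ : ℝ → ℂ) :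
    ∫ x : E3, ρ ‖x‖ * ev Q x = sphInt Q * ∫ r in Set.Ioi (0 : ℝ), ρ r * (r : ℂ) ^ (d + 2) := by
  calc
    ∫ x : E3, ρ ‖x‖ * ev Q x
      = ∫ x : ({(0)}ᶜ : Set E3), ρ ‖x.1‖ * ev Q x.1 ∂((volume : Measure E3).comap (↑)) := by
      rw [integral_subtype_comap (measurableSet_singleton _).compl
        fun x : E3 ↦ ρ ‖x‖ * ev Q x, restrict_compl_singleton]
    _ = ∫ p : Metric.sphere (0 : E3) 1 × Set.Ioi (0 : ℝ), ev Q p.1 * (ρ p.2 * ((p.2 : ℝ) : ℂ) ^ d)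
          ∂(volume : Measure E3).toSphere.prod (.volumeIoiPow (Module.finrank ℝ E3 - 1)) := by
      rw [← (volume : Measure E3).measurePreserving_homeomorphUnitSphereProd.integral_comp
        (Homeomorph.measurableEmbedding _)]
      refine integral_congr_ae (Eventually.of_forall fun x => ?_)
      have hx : x.1 ≠ 0 := x.2
      have hn : ‖x.1‖ ≠ 0 := norm_ne_zero_iff.2 hx
      have h1 : ev Q x.1 = (‖x.1‖ : ℂ) ^ d * ev Q ((‖x.1‖)⁻¹ • x.1) := by
        rw [← ev_real_smul h, smul_smul, mul_inv_cancel₀ hn, one_smul]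
      simp only [homeomorphUnitSphereProd_apply_snd_coe, homeomorphUnitSphereProd_apply_fst_coe]
      rw [h1]
      ring
    _ = sphInt Q * ∫ r : Set.Ioi (0 : ℝ), ρ r * ((r : ℝ) : ℂ) ^ d ∂.volumeIoiPow 2 := by
      rw [finrank_E3]
      exact integral_prod_mul (fun ω : Metric.sphere (0 : E3) 1 => ev Q ω)
        (fun r : Set.Ioi (0 : ℝ) => ρ r * ((r : ℝ) : ℂ) ^ d)
    _ = _ := by
      congr 1
      simp only [Measure.volumeIoiPow, ENNReal.ofReal]
      rw [integral_withDensity_eq_integral_smul,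
        integral_subtype_comap measurableSet_Ioi
          fun a : ℝ ↦ Real.toNNReal (a ^ 2) • (ρ a * (a : ℂ) ^ d)]
      · refine setIntegral_congr_fun measurableSet_Ioi fun x hx ↦ ?_
        simp only [NNReal.smul_def, Real.coe_toNNReal _ (pow_nonneg (le_of_lt hx) _)]
        rw [Complex.real_smul]
        push_cast
        ring
      · exact (measurable_subtype_coe.pow_const _).real_toNNReal

/-! ### Integration by parts on the unit sphere -/

lemma integrableOn_gauss_mul_pow (n : ℕ) :
    IntegrableOn (fun r : ℝ => (Real.exp (-r ^ 2) : ℂ) * (r : ℂ) ^ n) (Set.Ioi 0) := by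
  have hn : (-1 : ℝ) < n := by have : (0 : ℝ) ≤ n := n.cast_nonneg; linarith
  have h := integrableOn_rpow_mul_exp_neg_mul_sq (b := 1) one_pos hn
  refine (h.ofReal (𝕜 := ℂ)).congr (Eventually.of_forall fun r => ?_)
  simp [mul_comm]

/-- The moments of the Gaussian on the half-line. -/
def gaussMoment (n : ℕ) : ℂ := ∫ r in Set.Ioi (0 : ℝ), (Real.exp (-r ^ 2) : ℂ) * (r : ℂ) ^ n

lemma gaussMoment_eq (n : ℕ) :
    gaussMoment n = (((1 / 2) * Real.Gamma (((n : ℝ) + 1) / 2) : ℝ) : ℂ) := by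
  have hn : (-1 : ℝ) < n := by have : (0 : ℝ) ≤ n := n.cast_nonneg; linarith
  rw [← integral_rpow_mul_exp_neg_rpow two_pos hn, ← integral_complex_ofReal, gaussMoment]
  refine integral_congr_ae (Eventually.of_forall fun r => ?_)
  simp [mul_comm]

lemma gaussMoment_add_two (n : ℕ) : 2 * gaussMoment (n + 2) = (n + 1) * gaussMoment n := by
  have h : ((n + 2 : ℕ) + 1 : ℝ) / 2 = ((n : ℝ) + 1) / 2 + 1 := by push_cast; ring
  rw [gaussMoment_eq, gaussMoment_eq, h, Real.Gamma_add_one (by positivity)]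
  push_cast
  ring

lemma gaussMoment_ne_zero (n : ℕ) : gaussMoment n ≠ 0 := by
  rw [gaussMoment_eq, Complex.ofReal_ne_zero]
  have := Real.Gamma_pos_of_pos (s := ((n : ℝ) + 1) / 2) (by positivity)
  positivity

lemma integral_gauss_mul_ev {Q : Poly} {d : ℕ} (h : Q.IsHomogeneous d) :
    ∫ x : E3, (Real.exp (-‖x‖ ^ 2) : ℂ) * ev Q x = sphInt Q * gaussMoment (d + 2) :=
  integral_radial_mul_ev h fun r => (Real.exp (-r ^ 2) : ℂ)

lemma integrable_gauss_mul_ev {Q : Poly} {d : ℕ} (h : Q.IsHomogeneous d) :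
    Integrable fun x : E3 => (Real.exp (-‖x‖ ^ 2) : ℂ) * ev Q x :=
  integrable_radial_mul_ev h (ρ := fun r => (Real.exp (-r ^ 2) : ℂ))
    (integrableOn_gauss_mul_pow _)

lemma hasFDerivAt_gauss (x : E3) :
    HasFDerivAt (fun x : E3 => (Real.exp (-‖x‖ ^ 2) : ℂ))
      (Complex.ofRealCLM.comp (Real.exp (-‖x‖ ^ 2) • -(2 • (innerSL ℝ x)))) x :=
  Complex.ofRealCLM.hasFDerivAt.comp x ((hasStrictFDerivAt_norm_sq x).hasFDerivAt.neg.exp)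

lemma integral_gauss_dd {Q : Poly} {d : ℕ} (h : Q.IsHomogeneous d) (i : Fin 3) :
    ∫ x : E3, (Real.exp (-‖x‖ ^ 2) : ℂ) * ev (dd i Q) x =
      2 * ∫ x : E3, (Real.exp (-‖x‖ ^ 2) : ℂ) * ev (MvPolynomial.X i * Q) x := by
  have hd : (dd i Q).IsHomogeneous (d - 1) := h.pderiv
  have hX : (MvPolynomial.X i * Q).IsHomogeneous (1 + d) :=
    (MvPolynomial.isHomogeneous_X _ i).mul h
  have hg : ∀ x : E3, fderiv ℝ (fun x : E3 => (Real.exp (-‖x‖ ^ 2) : ℂ)) x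
      (EuclideanSpace.single i (1 : ℝ)) * ev Q x =
      -(2 * ((Real.exp (-‖x‖ ^ 2) : ℂ) * ev (MvPolynomial.X i * Q) x)) := by
    intro x
    rw [(hasFDerivAt_gauss x).fderiv]
    simp [EuclideanSpace.inner_single_right]
    ring
  have key := integral_mul_fderiv_eq_neg_fderiv_mul_of_integrable (μ := (volume : Measure E3))
    (f := fun x : E3 => (Real.exp (-‖x‖ ^ 2) : ℂ)) (g := ev Q)
    (v := EuclideanSpace.single i (1 : ℝ)) ?_ ?_ (integrable_gauss_mul_ev h)
    (fun x _ => (hasFDerivAt_gauss x).differentiableAt) (fun x _ => differentiable_ev Q x)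
  · simp only [fderiv_ev_single, hg, integral_neg, neg_neg, integral_const_mul] at key
    exact key
  · simp only [hg]
    exact ((integrable_gauss_mul_ev hX).const_mul 2).neg
  · simp only [fderiv_ev_single]
    exact integrable_gauss_mul_ev hd

lemma dd_eq_zero_of_hom {A : Poly} (h : A.IsHomogeneous 0) (i : Fin 3) : dd i A = 0 := by
  rw [← MvPolynomial.totalDegree_zero_iff_isHomogeneous,
    MvPolynomial.totalDegree_eq_zero_iff_eq_C] at h
  rw [h]
  exact MvPolynomial.pderiv_C

lemma sphInt_zero : sphInt 0 = 0 := by simp [sphInt]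

/-- The divergence theorem on the sphere, in polynomial form: it is obtained by integrating
`∂ᵢ (exp(-|x|²) Q)` over the whole space and passing to polar coordinates. -/
lemma sphInt_dd {Q : Poly} {d : ℕ} (h : Q.IsHomogeneous d) (i : Fin 3) :
    sphInt (dd i Q) = (d + 2) * sphInt (MvPolynomial.X i * Q) := by
  have h1 := integral_gauss_dd h i
  have hX : (MvPolynomial.X i * Q).IsHomogeneous (1 + d) :=
    (MvPolynomial.isHomogeneous_X _ i).mul h
  have hd : (dd i Q).IsHomogeneous (d - 1) := h.pderiv
  rw [integral_gauss_mul_ev hd, integral_gauss_mul_ev hX] at h1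
  obtain _ | d := d
  · have h0 : dd i Q = 0 := dd_eq_zero_of_hom h i
    rw [h0, sphInt_zero, zero_mul] at h1
    have h2 : sphInt (MvPolynomial.X i * Q) = 0 :=
      (mul_eq_zero.1 ((mul_eq_zero.1 h1.symm).resolve_left two_ne_zero)).resolve_right
        (gaussMoment_ne_zero _)
    rw [h0, h2, sphInt_zero, mul_zero]
  · have h2 := gaussMoment_add_two (d + 2)
    have e : 1 + (d + 1) + 2 = d + 2 + 2 := by ring
    rw [e, Nat.add_sub_cancel] at h1
    apply mul_right_cancel₀ (gaussMoment_ne_zero (d + 2))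
    rw [h1]
    push_cast at h2 ⊢
    linear_combination sphInt (MvPolynomial.X i * Q) * h2

lemma sphInt_add (P Q : Poly) : sphInt (P + Q) = sphInt P + sphInt Q := by
  simp only [sphInt, ev_add]
  exact integral_add (integrable_ev_sphere P) (integrable_ev_sphere Q)

lemma sphInt_sub (P Q : Poly) : sphInt (P - Q) = sphInt P - sphInt Q := by
  simp only [sphInt, ev_sub]
  exact integral_sub (integrable_ev_sphere P) (integrable_ev_sphere Q)

lemma sphInt_neg (P : Poly) : sphInt (-P) = -sphInt P := by
  simp only [sphInt, ev_neg]
  exact integral_neg _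

lemma sphInt_C_mul (c : ℂ) (P : Poly) : sphInt (MvPolynomial.C c * P) = c * sphInt P := by
  simp only [sphInt, ev_mul, ev_C]
  exact integral_const_mul _ _

lemma sphInt_sum {ι : Type*} (s : Finset ι) (f : ι → Poly) :
    sphInt (∑ i ∈ s, f i) = ∑ i ∈ s, sphInt (f i) := by
  simp only [sphInt, ev_sum]
  exact integral_finsetSum s fun i _ => integrable_ev_sphere (f i)

/-- The polynomial `|x|²`. -/
def radSq : Poly := MvPolynomial.X 0 ^ 2 + MvPolynomial.X 1 ^ 2 + MvPolynomial.X 2 ^ 2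

lemma ev_radSq (x : E3) : ev radSq x = (‖x‖ : ℂ) ^ 2 := by
  rw [← Complex.ofReal_pow, EuclideanSpace.norm_sq_eq, Fin.sum_univ_three]
  simp [radSq]

lemma sphInt_radSq_mul (P : Poly) : sphInt (radSq * P) = sphInt P := by
  refine integral_congr_ae (Eventually.of_forall fun ω => ?_)
  have : ‖(ω : E3)‖ = 1 := by simp
  simp only [ev_mul, ev_radSq, this]
  simp

lemma sphInt_one : sphInt 1 = 4 * Real.pi := by
  have : (0 : ℝ) ≤ Real.pi * 4 / 3 := by positivity
  simp only [sphInt, ev_one, integral_const, Measure.toSphere_real_apply_univ, finrank_E3]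
  rw [measureReal_def, EuclideanSpace.volume_ball_fin_three, ENNReal.toReal_mul,
    ENNReal.toReal_ofReal this]
  simp
  ring

/-! ### Solid harmonics and infinitesimal rotations -/

/-- The `i`-th coordinate as a polynomial. -/
abbrev xx (i : Fin 3) : Poly := MvPolynomial.X i

lemma dd_comm (i j : Fin 3) (Q : Poly) : dd i (dd j Q) = dd j (dd i Q) := by
  have h : ⁅dd i, dd j⁆ = 0 := by
    refine MvPolynomial.derivation_ext fun k => ?_
    rw [Derivation.commutator_apply]
    simp only [MvPolynomial.pderiv_X, Derivation.zero_apply]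
    by_cases hi : i = k <;> by_cases hj : j = k <;> simp [hi, hj]
  have := congrArg (fun D => D Q) h
  simpa [Derivation.commutator_apply, sub_eq_zero] using this

/-- The Laplacian of a polynomial. -/
def lap (Q : Poly) : Poly := dd 0 (dd 0 Q) + dd 1 (dd 1 Q) + dd 2 (dd 2 Q)

/-- A solid harmonic of degree `p`: a homogeneous harmonic polynomial of degree `p`. -/
structure IsSolid (p : ℕ) (A : Poly) : Prop where
  hom : A.IsHomogeneous p
  harm : lap A = 0

/-- The components of the derivation `x × ∇`, the infinitesimal rotations. -/
def ang (a : Fin 3) : Derivation ℂ Poly Poly := xx (a + 1) • dd (a + 2) - xx (a + 2) • dd (a + 1)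

lemma ang_zero (Q : Poly) : ang 0 Q = xx 1 * dd 2 Q - xx 2 * dd 1 Q := rfl
lemma ang_one (Q : Poly) : ang 1 Q = xx 2 * dd 0 Q - xx 0 * dd 2 Q := rfl
lemma ang_two (Q : Poly) : ang 2 Q = xx 0 * dd 1 Q - xx 1 * dd 0 Q := rfl

lemma dd_xx_self (i : Fin 3) : dd i (xx i) = 1 := MvPolynomial.pderiv_X_self i
lemma dd_xx_ne {i j : Fin 3} (h : j ≠ i) : dd i (xx j) = 0 := MvPolynomial.pderiv_X_of_ne h

lemma isHomogeneous_ang {p : ℕ} {A : Poly} (h : A.IsHomogeneous p) (a : Fin 3) :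
    (ang a A).IsHomogeneous p := by
  obtain _ | p := p
  · have : ang a A = 0 := by simp [ang, dd_eq_zero_of_hom h]
    rw [this]
    exact MvPolynomial.isHomogeneous_zero _ _ _
  · have hp : ∀ i, (dd i A).IsHomogeneous p := fun i => h.pderiv
    rw [add_comm]
    exact ((MvPolynomial.isHomogeneous_X _ _).mul (hp _)).sub
      ((MvPolynomial.isHomogeneous_X _ _).mul (hp _))

lemma euler {p : ℕ} {A : Poly} (h : A.IsHomogeneous p) :
    xx 0 * dd 0 A + xx 1 * dd 1 A + xx 2 * dd 2 A = p * A := by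
  have := h.sum_X_mul_pderiv
  rwa [Fin.sum_univ_three, nsmul_eq_mul] at this

lemma sphInt_natCast_mul (n : ℕ) (P : Poly) : sphInt (n * P) = n * sphInt P := by
  rw [← sphInt_C_mul, map_natCast]

lemma sphInt_ang {p : ℕ} {A : Poly} (h : A.IsHomogeneous p) (a : Fin 3) :
    sphInt (ang a A) = 0 := by
  have key : ∀ j k : Fin 3, j ≠ k →
      sphInt (xx j * dd k A) = (p + 3) * sphInt (xx k * (xx j * A)) := by
    intro j k hjk
    have h1 := sphInt_dd ((MvPolynomial.isHomogeneous_X ℂ j).mul h) k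
    rw [MvPolynomial.pderiv_mul, dd_xx_ne hjk, zero_mul, zero_add] at h1
    rw [h1]
    push_cast
    ring
  have hne : a + 1 ≠ a + 2 := by decide +revert
  change sphInt (xx (a + 1) * dd (a + 2) A - xx (a + 2) * dd (a + 1) A) = 0
  rw [sphInt_sub, key _ _ hne, key _ _ hne.symm, mul_left_comm (xx (a + 2)), sub_self]

/-- Infinitesimal rotations are antisymmetric on the sphere. -/
lemma sphInt_ang_mul {p q : ℕ} {A B : Poly} (hA : A.IsHomogeneous p) (hB : B.IsHomogeneous q)
    (a : Fin 3) : sphInt (ang a A * B) = -sphInt (A * ang a B) := by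
  have h := sphInt_ang (hA.mul hB) a
  rw [Derivation.leibniz, sphInt_add, smul_eq_mul, smul_eq_mul, mul_comm B] at h
  linear_combination h

/-- The bilinear dot product of polynomial vector fields. -/
def dotP (A B : Fin 3 → Poly) : Poly := ∑ i, A i * B i

lemma dotP_comm (A B : Fin 3 → Poly) : dotP A B = dotP B A := by
  simp [dotP, mul_comm]

/-- The gradient of a polynomial. -/
def gradP (H : Poly) : Fin 3 → Poly := fun i => dd i H

lemma sum_ang_mul_ang {p q : ℕ} {A B : Poly} (hA : A.IsHomogeneous p) (hB : B.IsHomogeneous q) :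
    ∑ a, ang a A * ang a B = radSq * dotP (gradP A) (gradP B) - (p * q : ℕ) * (A * B) := by
  have h1 := euler hA
  have h2 := euler hB
  simp only [Fin.sum_univ_three, ang_zero, ang_one, ang_two, dotP, gradP, radSq]
  push_cast
  linear_combination (-(p : Poly) * A) * h2 -
    (xx 0 * dd 0 B + xx 1 * dd 1 B + xx 2 * dd 2 B) * h1

/-- The dot product of two gradients is a divergence `∑ ∂ᵢ (A ∂ᵢB)` when `B` is harmonic; Euler's
identity evaluates its integral over the sphere. -/
lemma sphInt_dot_grad {p q : ℕ} {A B : Poly} (hA : A.IsHomogeneous p) (hB : IsSolid q B) :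
    sphInt (dotP (gradP A) (gradP B)) = q * (p + q + 1) * sphInt (A * B) := by
  have h1 : dotP (gradP A) (gradP B) = ∑ i, dd i (A * dd i B) := by
    have := hB.harm
    simp only [lap] at this
    simp only [dotP, gradP, Fin.sum_univ_three, MvPolynomial.pderiv_mul]
    linear_combination -A * this
  have h2 : ∀ i, sphInt (dd i (A * dd i B)) =
      ((p + (q - 1) : ℕ) + 2) * sphInt (xx i * (A * dd i B)) := fun i =>
    sphInt_dd (hA.mul hB.hom.pderiv) i
  have h3 : ∑ i, xx i * (A * dd i B) = (q : Poly) * (A * B) := by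
    simp only [Fin.sum_univ_three]
    linear_combination A * euler hB.hom
  rw [h1, sphInt_sum, Finset.sum_congr rfl fun i _ => h2 i, ← Finset.mul_sum, ← sphInt_sum, h3,
    sphInt_natCast_mul]
  obtain _ | q := q
  · simp
  · push_cast [Nat.add_sub_cancel]
    ring

/-- Solid harmonics of different degrees are orthogonal on the sphere. -/
lemma sphInt_mul_eq_zero {p q : ℕ} {A B : Poly} (hA : IsSolid p A) (hB : IsSolid q B)
    (h : p ≠ q) : sphInt (A * B) = 0 := by
  have h1 := sphInt_dot_grad hA.hom hB
  have h2 := sphInt_dot_grad hB.hom hA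
  rw [dotP_comm, h1, mul_comm B A] at h2
  have h3 : ((q : ℂ) - p) * (p + q + 1) * sphInt (A * B) = 0 := by linear_combination h2
  have h4 : ((q : ℂ) - p) ≠ 0 := sub_ne_zero.2 (by exact_mod_cast h.symm)
  have h5 : (p + q + 1 : ℂ) ≠ 0 := by exact_mod_cast (Nat.succ_ne_zero (p + q))
  simpa [h4, h5] using h3

/-- The angular energy of a solid harmonic of degree `q` is `q (q + 1)` times its `L²` pairing: the
spherical Laplacian acts by `-q (q + 1)`. -/
lemma sphInt_sum_ang {p q : ℕ} {A B : Poly} (hA : A.IsHomogeneous p) (hB : IsSolid q B) :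
    sphInt (∑ a, ang a A * ang a B) = q * (q + 1) * sphInt (A * B) := by
  rw [sum_ang_mul_ang hA hB.hom, sphInt_sub, sphInt_radSq_mul, sphInt_dot_grad hA hB,
    sphInt_natCast_mul]
  push_cast
  ring

/-! ### Vector solid harmonics -/

/-- The second vector solid harmonic attached to a solid harmonic `H` of degree `ℓ`: the harmonic
part `xᵢ H - |x|² ∂ᵢH / (2ℓ + 1)` of `x H`, of degree `ℓ + 1`. -/
def posP (l : ℕ) (H : Poly) : Fin 3 → Poly := fun i =>
  xx i * H - MvPolynomial.C (1 / (2 * l + 1) : ℂ) * (radSq * dd i H)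

/-- The toroidal vector solid harmonic `∇H × x`. -/
def torP (H : Poly) : Fin 3 → Poly := fun i => -ang i H

lemma isSolid_dd {l : ℕ} {H : Poly} (h : IsSolid l H) (i : Fin 3) : IsSolid (l - 1) (dd i H) := by
  refine ⟨h.hom.pderiv, ?_⟩
  have := congrArg (dd i) h.harm
  simpa only [lap, map_add, map_zero, dd_comm _ i] using this

lemma isHomogeneous_radSq : radSq.IsHomogeneous 2 :=
  (((MvPolynomial.isHomogeneous_X_pow _ _).add (MvPolynomial.isHomogeneous_X_pow _ _))).add
    (MvPolynomial.isHomogeneous_X_pow _ _)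

lemma dd_xx (i j : Fin 3) : dd i (xx j) = if i = j then 1 else 0 := by
  by_cases h : i = j
  · subst h; simp
  · simp [h, MvPolynomial.pderiv_X_of_ne (Ne.symm h)]

lemma dd_radSq (i : Fin 3) : dd i radSq = xx i + xx i := by
  fin_cases i <;>
    simp [radSq, Derivation.leibniz_pow, MvPolynomial.pderiv_X, two_mul]

lemma lap_xx_mul (i : Fin 3) (Q : Poly) : lap (xx i * Q) = xx i * lap Q + 2 * dd i Q := by
  fin_cases i <;>
  · simp [lap]
    ring

lemma lap_radSq_mul {d : ℕ} {Q : Poly} (h : Q.IsHomogeneous d) :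
    lap (radSq * Q) = radSq * lap Q + ((4 * d + 6 : ℕ) : Poly) * Q := by
  have e := euler h
  simp only [lap, MvPolynomial.pderiv_mul, dd_radSq, map_add, dd_xx_self]
  simp
  linear_combination 4 * e

lemma lap_sub (P Q : Poly) : lap (P - Q) = lap P - lap Q := by
  simp only [lap, map_sub]; ring

lemma lap_C_mul (c : ℂ) (Q : Poly) : lap (MvPolynomial.C c * Q) = MvPolynomial.C c * lap Q := by
  simp only [lap, MvPolynomial.pderiv_C_mul]; ring

lemma isSolid_posP {l : ℕ} {H : Poly} (h : IsSolid l H) (i : Fin 3) :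
    IsSolid (l + 1) (posP l H i) := by
  constructor
  · refine MvPolynomial.IsHomogeneous.sub ?_ ?_
    · rw [add_comm]; exact (MvPolynomial.isHomogeneous_X _ _).mul h.hom
    · obtain _ | l := l
      · rw [dd_eq_zero_of_hom h.hom, mul_zero, mul_zero]
        exact MvPolynomial.isHomogeneous_zero _ _ _
      · have e : l + 1 + 1 = 2 + (l + 1 - 1) := by omega
        rw [e]
        exact (isHomogeneous_radSq.mul h.hom.pderiv).C_mul _
  · rw [posP, lap_sub, lap_C_mul, lap_xx_mul, lap_radSq_mul (isSolid_dd h i).hom, h.harm,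
      (isSolid_dd h i).harm, mul_zero, mul_zero, zero_add, zero_add, ← map_natCast MvPolynomial.C,
      ← mul_assoc, ← map_mul]
    obtain _ | l := l
    · rw [dd_eq_zero_of_hom h.hom]; simp
    · have : (1 / (2 * ((l + 1 : ℕ) : ℂ) + 1)) * ((4 * (l + 1 - 1) + 6 : ℕ) : ℂ) = 2 := by
        have h2 : (2 * ((l : ℂ) + 1) + 1) ≠ 0 := by exact_mod_cast Nat.succ_ne_zero (2 * (l + 1))
        push_cast [Nat.add_sub_cancel]
        field_simp
        ring
      rw [this, map_ofNat, sub_self]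

lemma isSolid_ang {l : ℕ} {H : Poly} (h : IsSolid l H) (a : Fin 3) : IsSolid l (ang a H) := by
  refine ⟨isHomogeneous_ang h.hom a, ?_⟩
  change lap (xx (a + 1) * dd (a + 2) H - xx (a + 2) * dd (a + 1) H) = 0
  rw [lap_sub, lap_xx_mul, lap_xx_mul, (isSolid_dd h _).harm, (isSolid_dd h _).harm,
    dd_comm (a + 1)]
  ring

lemma isSolid_torP {l : ℕ} {H : Poly} (h : IsSolid l H) (i : Fin 3) : IsSolid l (torP H i) := by
  refine ⟨(isSolid_ang h i).hom.neg, ?_⟩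
  have := (isSolid_ang h i).harm
  simp only [lap, torP, map_neg] at this ⊢
  linear_combination -this

section dot
variable {l l' : ℕ} {H H' : Poly} (h : IsSolid l H) (h' : IsSolid l' H')
include h h'

lemma sphInt_grad_grad :
    sphInt (dotP (gradP H) (gradP H')) = l * (2 * l + 1) * sphInt (H * H') := by
  rw [sphInt_dot_grad h.hom h']
  by_cases e : l = l'
  · subst e; ring
  · rw [sphInt_mul_eq_zero h h' e]; ring

lemma sphInt_grad_pos : sphInt (dotP (gradP H) (posP l' H')) = 0 := by
  have e1 : dotP (gradP H) (posP l' H') = (l : Poly) * (H * H') -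
      MvPolynomial.C (1 / (2 * l' + 1) : ℂ) * (radSq * dotP (gradP H) (gradP H')) := by
    simp only [dotP, gradP, posP, Fin.sum_univ_three]
    linear_combination H' * euler h.hom
  rw [e1, sphInt_sub, sphInt_natCast_mul, sphInt_C_mul, sphInt_radSq_mul, sphInt_grad_grad h h']
  by_cases e : l = l'
  · subst e
    have h2 : (2 * (l : ℂ) + 1) ≠ 0 := by exact_mod_cast Nat.succ_ne_zero (2 * l)
    have h3 : 1 / (2 * (l : ℂ) + 1) * (2 * l + 1) = 1 := by field_simp
    linear_combination -(l * sphInt (H * H')) * h3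
  · rw [sphInt_mul_eq_zero h h' e]; ring

lemma sphInt_pos_pos : sphInt (dotP (posP l H) (posP l' H')) =
    (l + 1) / (2 * l + 1) * sphInt (H * H') := by
  have e1 : dotP (posP l H) (posP l' H') = radSq * (H * H') -
      MvPolynomial.C (1 / (2 * l + 1) : ℂ) * (radSq * ((l : Poly) * (H * H'))) -
      MvPolynomial.C (1 / (2 * l' + 1) : ℂ) * (radSq * dotP (posP l H) (gradP H')) := by
    simp only [dotP, gradP, posP, Fin.sum_univ_three]
    simp only [radSq]
    linear_combination (-MvPolynomial.C (1 / (2 * l + 1) : ℂ) *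
      (xx 0 ^ 2 + xx 1 ^ 2 + xx 2 ^ 2) * H') * euler h.hom
  rw [e1, sphInt_sub, sphInt_sub, sphInt_C_mul, sphInt_C_mul, sphInt_radSq_mul, sphInt_radSq_mul,
    sphInt_radSq_mul, sphInt_natCast_mul, dotP_comm, sphInt_grad_pos h' h]
  have h2 : (2 * (l : ℂ) + 1) ≠ 0 := by exact_mod_cast Nat.succ_ne_zero (2 * l)
  field_simp
  ring

lemma sphInt_tor_tor : sphInt (dotP (torP H) (torP H')) = l * (l + 1) * sphInt (H * H') := by
  have e1 : dotP (torP H) (torP H') = ∑ a, ang a H * ang a H' := by simp [dotP, torP]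
  rw [e1, sphInt_sum_ang h.hom h']
  by_cases e : l = l'
  · subst e; ring
  · rw [sphInt_mul_eq_zero h h' e]; ring

lemma sphInt_grad_tor : sphInt (dotP (gradP H) (torP H')) = 0 := by
  have e1 : sphInt (dotP (gradP H) (torP H')) = sphInt (∑ i, ang i (dd i H) * H') := by
    rw [dotP, sphInt_sum, sphInt_sum]
    refine Finset.sum_congr rfl fun i _ => ?_
    rw [sphInt_ang_mul (isSolid_dd h i).hom h'.hom, torP, mul_neg, sphInt_neg]
    rfl
  have e2 : ∑ i, ang i (dd i H) * H' = 0 := by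
    simp only [Fin.sum_univ_three, ang_zero, ang_one, ang_two, dd_comm 1 0, dd_comm 2 0,
      dd_comm 2 1]
    ring
  rw [e1, e2, sphInt_zero]

lemma sphInt_pos_tor : sphInt (dotP (posP l H) (torP H')) = 0 := by
  have e1 : dotP (posP l H) (torP H') =
      -(MvPolynomial.C (1 / (2 * l + 1) : ℂ) * (radSq * dotP (gradP H) (torP H'))) := by
    simp only [dotP, gradP, posP, torP, Fin.sum_univ_three, ang_zero, ang_one, ang_two]
    ring
  rw [e1, sphInt_neg, sphInt_C_mul, sphInt_radSq_mul, sphInt_grad_tor h h', mul_zero, neg_zero]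

end dot

/-! ### Complex conjugation of polynomials -/

/-- The complex conjugate of a polynomial, taken on the coefficients. -/
def conjP (Q : Poly) : Poly := MvPolynomial.map (starRingEnd ℂ) Q

lemma ev_conjP (Q : Poly) (x : E3) : ev (conjP Q) x = starRingEnd ℂ (ev Q x) := by
  simp only [ev, conjP, MvPolynomial.eval_map]
  rw [MvPolynomial.eval, MvPolynomial.coe_eval₂Hom, MvPolynomial.eval₂_comp_left]
  congr 1
  ext i
  simp

lemma dd_conjP (i : Fin 3) (Q : Poly) : dd i (conjP Q) = conjP (dd i Q) :=
  MvPolynomial.pderiv_map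

lemma ang_conjP (a : Fin 3) (Q : Poly) : ang a (conjP Q) = conjP (ang a Q) := by
  change xx _ * dd _ _ - xx _ * dd _ _ = conjP (xx _ * dd _ _ - xx _ * dd _ _)
  rw [dd_conjP, dd_conjP]
  simp [conjP]

lemma lap_conjP (Q : Poly) : lap (conjP Q) = conjP (lap Q) := by
  simp only [lap, dd_conjP]
  simp [conjP]

lemma IsSolid.conj {p : ℕ} {A : Poly} (h : IsSolid p A) : IsSolid p (conjP A) :=
  ⟨h.hom.map _, by rw [lap_conjP, h.harm]; simp [conjP]⟩

lemma IsSolid.C_mul {p : ℕ} {A : Poly} (h : IsSolid p A) (c : ℂ) :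
    IsSolid p (MvPolynomial.C c * A) :=
  ⟨h.hom.C_mul c, by rw [lap_C_mul, h.harm, mul_zero]⟩

/-! ### Explicit solid harmonics -/

/-- The polynomial `x₀ + c x₁`; for `c = ±i` it is `r sin θ exp(± i φ)`. -/
def zeta (c : ℂ) : Poly := xx 0 + MvPolynomial.C c * xx 1

lemma C_mul_self {c : ℂ} (hc : c ^ 2 = -1) : (MvPolynomial.C c : Poly) * MvPolynomial.C c = -1 := by
  rw [← map_mul, ← sq, hc]; simp

lemma lap_add (P Q : Poly) : lap (P + Q) = lap P + lap Q := by
  simp only [lap, map_add]; ring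

lemma lap_sum {ι : Type*} (s : Finset ι) (f : ι → Poly) :
    lap (∑ i ∈ s, f i) = ∑ i ∈ s, lap (f i) := by
  induction s using Finset.cons_induction with
  | empty => simp [lap]
  | cons a s ha ih => rw [Finset.sum_cons, Finset.sum_cons, lap_add, ih]

lemma isHomogeneous_zeta (c : ℂ) : (zeta c).IsHomogeneous 1 :=
  (MvPolynomial.isHomogeneous_X _ _).add (MvPolynomial.isHomogeneous_C_mul_X _ _)

lemma lap_radSq_pow_mul {d : ℕ} {Q : Poly} (h : Q.IsHomogeneous d) (j : ℕ) :
    lap (radSq ^ j * Q) =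
      radSq ^ j * lap Q + ((2 * j * (2 * j + 1 + 2 * d) : ℕ) : Poly) * (radSq ^ (j - 1) * Q) := by
  induction j with
  | zero => simp
  | succ j ih =>
    have hd : (radSq ^ j * Q).IsHomogeneous (2 * j + d) := (isHomogeneous_radSq.pow j).mul h
    rw [pow_succ', mul_assoc, lap_radSq_mul hd, ih]
    obtain _ | j := j
    · push_cast
      simp only [pow_zero]
      ring
    · simp only [Nat.add_sub_cancel]
      push_cast
      ring

lemma lap_zeta_pow_mul {c : ℂ} (hc : c ^ 2 = -1) (m e : ℕ) :
    lap (zeta c ^ m * xx 2 ^ e) = ((e * (e - 1) : ℕ) : Poly) * (zeta c ^ m * xx 2 ^ (e - 2)) := by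
  have h0 : dd 0 (zeta c) = 1 := by simp [zeta]
  have h1 : dd 1 (zeta c) = MvPolynomial.C c := by simp [zeta]
  have h2 : dd 2 (zeta c) = 0 := by simp [zeta]
  have h3 : dd 0 (xx 2) = 0 := by simp
  have h4 : dd 1 (xx 2) = 0 := by simp
  have h5 : dd 2 (xx 2) = 1 := by simp
  simp only [lap, MvPolynomial.pderiv_mul, MvPolynomial.pderiv_pow, h0, h1, h2, h3, h4, h5,
    mul_zero, zero_mul, add_zero, zero_add, mul_one, MvPolynomial.pderiv_C,
    Derivation.map_natCast]
  rw [show e - 1 - 1 = e - 2 from rfl]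
  push_cast
  linear_combination (m : Poly) * ((m - 1 : ℕ) : Poly) * zeta c ^ (m - 1 - 1) * xx 2 ^ e *
    C_mul_self hc

/-- The coefficient of `t ^ (2k - ℓ - m)` in the `m`-th derivative of the Legendre polynomial. -/
def legCoef (l m k : ℕ) : ℝ :=
  (l.choose k : ℝ) * (-1) ^ (l - k) * ((2 * k).descFactorial (l + m) : ℝ) / (2 ^ l * l.factorial)

lemma legCoef_eq_zero {l m k : ℕ} (h : 2 * k < l + m) : legCoef l m k = 0 := by
  simp [legCoef, Nat.descFactorial_eq_zero_iff_lt.2 h]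

lemma legCoef_succ_right (l m k : ℕ) :
    legCoef l (m + 1) k = legCoef l m k * ((2 * k - l - m : ℕ) : ℝ) := by
  simp only [legCoef]
  rw [← add_assoc, Nat.descFactorial_succ, Nat.sub_sub]
  push_cast
  ring

/-- The Legendre equation, on coefficients. -/
lemma legCoef_rec {l k : ℕ} (m : ℕ) (hk : k < l) :
    legCoef l m (k + 1) * (((2 * (k + 1) - l - m) * (2 * (k + 1) - l - m - 1) : ℕ) : ℝ) =
      -(legCoef l m k * ((2 * (l - k) * (2 * k + 1) : ℕ) : ℝ)) := by
  have h1 : ((2 * (k + 1)).descFactorial (l + m) : ℝ) *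
      (((2 * (k + 1) - l - m) * (2 * (k + 1) - l - m - 1) : ℕ) : ℝ) =
      (2 * k + 2) * (2 * k + 1) * ((2 * k).descFactorial (l + m) : ℝ) := by
    have : (2 * (k + 1)).descFactorial (l + m + 1 + 1) =
        (2 * k + 1 + 1) * ((2 * k + 1) * (2 * k).descFactorial (l + m)) := by
      rw [← Nat.succ_descFactorial_succ, ← Nat.succ_descFactorial_succ]
      rfl
    rw [Nat.descFactorial_succ, Nat.descFactorial_succ] at this
    have h2 : 2 * (k + 1) - (l + m + 1) = 2 * (k + 1) - l - m - 1 := by omega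
    have h3 : 2 * (k + 1) - (l + m) = 2 * (k + 1) - l - m := by omega
    rw [h2, h3] at this
    have := congrArg (Nat.cast : ℕ → ℝ) this
    push_cast at this ⊢
    linear_combination this
  have h2 : (l.choose (k + 1) : ℝ) * (k + 1) = l.choose k * ((l - k : ℕ) : ℝ) := by
    exact_mod_cast Nat.choose_succ_right_eq l k
  have h3 : (-1 : ℝ) ^ (l - k) = -(-1) ^ (l - (k + 1)) := by
    rw [show l - k = l - (k + 1) + 1 by omega, pow_succ]; ring
  have h4 : (2 ^ l * (l.factorial : ℝ)) ≠ 0 := by positivity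
  simp only [legCoef, h3]
  push_cast at h1 ⊢
  field_simp
  linear_combination (l.choose (k + 1) : ℝ) * h1 +
    2 * (2 * k + 1) * ((2 * k).descFactorial (l + m) : ℝ) * h2

/-- The monomials in `ζ`, `x₂`, `|x|²` of which solid harmonics are built. -/
def solidTerm (c : ℂ) (l m k : ℕ) : Poly :=
  zeta c ^ m * xx 2 ^ (2 * k - l - m) * radSq ^ (l - k)

/-- The solid harmonic `ζ ^ m r ^ (ℓ - m) P_ℓ^{(m)}(x₂ / r)`. -/
def solidH (c : ℂ) (l m : ℕ) : Poly :=
  ∑ k ∈ Finset.range (l + 1), MvPolynomial.C (legCoef l m k : ℂ) * solidTerm c l m k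

lemma isHomogeneous_solidH (c : ℂ) (l m : ℕ) : (solidH c l m).IsHomogeneous l := by
  refine MvPolynomial.IsHomogeneous.sum _ _ _ fun k hk => ?_
  by_cases h : 2 * k < l + m
  · rw [legCoef_eq_zero h]
    simpa using MvPolynomial.isHomogeneous_zero _ _ _
  · have hk' := Finset.mem_range.1 hk
    have e : l = 1 * m + (2 * k - l - m) + 2 * (l - k) := by omega
    have := (((isHomogeneous_zeta c).pow m).mul
      (MvPolynomial.isHomogeneous_X_pow (R := ℂ) (2 : Fin 3) (2 * k - l - m))).mul
      (isHomogeneous_radSq.pow (l - k))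
    rw [← e] at this
    exact this.C_mul _

lemma lap_solidTerm {c : ℂ} (hc : c ^ 2 = -1) (l m k : ℕ) :
    lap (solidTerm c l m k) =
      (((2 * k - l - m) * (2 * k - l - m - 1) : ℕ) : Poly) *
        (zeta c ^ m * xx 2 ^ (2 * k - l - m - 2) * radSq ^ (l - k)) +
      ((2 * (l - k) * (2 * (l - k) + 1 + 2 * (m + (2 * k - l - m))) : ℕ) : Poly) *
        (zeta c ^ m * xx 2 ^ (2 * k - l - m) * radSq ^ (l - k - 1)) := by
  have hd : (zeta c ^ m * xx 2 ^ (2 * k - l - m)).IsHomogeneous (m + (2 * k - l - m)) := by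
    have := ((isHomogeneous_zeta c).pow m).mul
      (MvPolynomial.isHomogeneous_X_pow (R := ℂ) (2 : Fin 3) (2 * k - l - m))
    rwa [one_mul] at this
  rw [solidTerm, mul_comm, lap_radSq_pow_mul hd, lap_zeta_pow_mul hc]
  ring

lemma lap_solidH {c : ℂ} (hc : c ^ 2 = -1) (l m : ℕ) : lap (solidH c l m) = 0 := by
  rw [solidH, lap_sum]
  let f : ℕ → Poly := fun k => MvPolynomial.C
    ((legCoef l m k * (((2 * k - l - m) * (2 * k - l - m - 1) : ℕ) : ℝ) : ℝ) : ℂ) *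
      (zeta c ^ m * xx 2 ^ (2 * k - l - m - 2) * radSq ^ (l - k))
  let g : ℕ → Poly := fun k => MvPolynomial.C
    ((legCoef l m k * ((2 * (l - k) * (2 * k + 1) : ℕ) : ℝ) : ℝ) : ℂ) *
      (zeta c ^ m * xx 2 ^ (2 * k - l - m) * radSq ^ (l - k - 1))
  have h1 : ∀ k ∈ Finset.range (l + 1),
      lap (MvPolynomial.C (legCoef l m k : ℂ) * solidTerm c l m k) = f k + g k := by
    intro k hk
    have hk' := Finset.mem_range.1 hk
    rw [lap_C_mul, lap_solidTerm hc]
    by_cases h : 2 * k < l + m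
    · simp [f, g, legCoef_eq_zero h]
    · have e : 2 * (l - k) + 1 + 2 * (m + (2 * k - l - m)) = 2 * k + 1 := by omega
      rw [e]
      simp only [f, g, Complex.ofReal_mul, map_mul, Complex.ofReal_natCast, map_natCast]
      ring
  rw [Finset.sum_congr rfl h1, Finset.sum_add_distrib, Finset.sum_range_succ' f,
    Finset.sum_range_succ g]
  have hf0 : f 0 = 0 := by simp [f]
  have hgl : g l = 0 := by simp [g]
  rw [hf0, hgl, add_zero, add_zero, ← Finset.sum_add_distrib]
  refine Finset.sum_eq_zero fun k hk => ?_
  have hk' := Finset.mem_range.1 hk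
  simp only [f, g]
  rw [legCoef_rec m hk']
  by_cases h : 2 * k < l + m
  · simp [legCoef_eq_zero h]
  · rw [show 2 * (k + 1) - l - m - 2 = 2 * k - l - m by omega,
      show l - (k + 1) = l - k - 1 by omega]
    simp

lemma isSolid_solidH {c : ℂ} (hc : c ^ 2 = -1) (l m : ℕ) : IsSolid l (solidH c l m) :=
  ⟨isHomogeneous_solidH c l m, lap_solidH hc l m⟩

lemma ang_radSq (a : Fin 3) : ang a radSq = 0 := by
  change xx _ * dd _ radSq - xx _ * dd _ radSq = 0
  rw [dd_radSq, dd_radSq]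
  ring

lemma ang_C (a : Fin 3) (c : ℂ) : ang a (MvPolynomial.C c) = 0 :=
  (ang a).map_algebraMap c

lemma ang_C_mul (a : Fin 3) (c : ℂ) (P : Poly) :
    ang a (MvPolynomial.C c * P) = MvPolynomial.C c * ang a P := by
  rw [Derivation.leibniz, ang_C]; simp

lemma ang_zeta (c : ℂ) : ang 0 (zeta c) = -(MvPolynomial.C c * xx 2) ∧ ang 1 (zeta c) = xx 2 ∧
    ang 2 (zeta c) = MvPolynomial.C c * xx 0 - xx 1 := by
  simp only [ang_zero, ang_one, ang_two, zeta, map_add, MvPolynomial.pderiv_C_mul, dd_xx]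
  refine ⟨?_, ?_, ?_⟩ <;> simp <;> ring

lemma ang_xx_two : ang 0 (xx 2) = xx 1 ∧ ang 1 (xx 2) = -xx 0 ∧ ang 2 (xx 2) = 0 := by
  simp only [ang_zero, ang_one, ang_two, dd_xx]
  simp

/-- The function `exp(i m φ)` is an eigenfunction of the rotations about the axis. -/
lemma ang_two_solidH {c : ℂ} (hc : c ^ 2 = -1) (l m : ℕ) :
    ang 2 (solidH c l m) = MvPolynomial.C (m * c) * solidH c l m := by
  have hz : ang 2 (zeta c) = MvPolynomial.C c * zeta c := by
    rw [(ang_zeta c).2.2, zeta]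
    linear_combination -xx 1 * C_mul_self hc
  have hzm : ang 2 (zeta c ^ m) = MvPolynomial.C (m * c) * zeta c ^ m := by
    rw [Derivation.leibniz_pow, hz]
    obtain _ | m := m
    · simp
    · simp only [Nat.add_sub_cancel, nsmul_eq_mul, smul_eq_mul, map_mul, map_natCast]
      ring
  rw [solidH, map_sum, Finset.mul_sum]
  refine Finset.sum_congr rfl fun k _ => ?_
  rw [ang_C_mul, solidTerm]
  simp only [Derivation.leibniz, Derivation.leibniz_pow, ang_radSq, (ang_xx_two).2.2, hzm,
    smul_zero, mul_zero, zero_add, smul_eq_mul]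
  ring

/-- The raising operator differentiates the Legendre factor. -/
lemma raise_solidH {c : ℂ} (hc : c ^ 2 = -1) (l m : ℕ) :
    MvPolynomial.C c * ang 0 (solidH c l m) - ang 1 (solidH c l m) = solidH c l (m + 1) := by
  let W : Derivation ℂ Poly Poly := (MvPolynomial.C c : Poly) • ang 0 - ang 1
  have hW : ∀ Q, W Q = MvPolynomial.C c * ang 0 Q - ang 1 Q := fun Q => rfl
  rw [← hW]
  have h1 : W (zeta c) = 0 := by
    rw [hW, (ang_zeta c).1, (ang_zeta c).2.1]
    linear_combination -xx 2 * C_mul_self hc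
  have h2 : W (xx 2) = zeta c := by
    rw [hW, ang_xx_two.1, ang_xx_two.2.1, zeta]; ring
  have h3 : W radSq = 0 := by rw [hW, ang_radSq, ang_radSq]; ring
  rw [solidH, solidH, map_sum]
  refine Finset.sum_congr rfl fun k _ => ?_
  have h4 : ∀ a : ℂ, W (MvPolynomial.C a) = 0 := fun a => W.map_algebraMap a
  simp only [solidTerm, Derivation.leibniz, Derivation.leibniz_pow, h1, h2, h3, h4,
    smul_eq_mul, nsmul_eq_mul, legCoef_succ_right, Complex.ofReal_mul,
    Complex.ofReal_natCast, map_mul, map_natCast]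
  rw [show 2 * k - l - (m + 1) = 2 * k - l - m - 1 by omega]
  ring

lemma ang_comm (Q : Poly) : ang 0 (ang 1 Q) - ang 1 (ang 0 Q) = -ang 2 Q := by
  simp only [ang_zero, ang_one, ang_two, map_sub, MvPolynomial.pderiv_mul, dd_xx, dd_comm 1 0,
    dd_comm 2 0, dd_comm 2 1]
  simp
  ring

/-- The sphere integral of `solidH c` times `solidH (-c)`; for `c = ±i` the second factor is the
conjugate of the first, and this is the square of the `L²` norm. -/
def solidSq (c : ℂ) (l m : ℕ) : ℂ := sphInt (solidH c l m * solidH (-c) l m)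

/-- The ladder step for the norms. It follows from the antisymmetry of the infinitesimal rotations
and the commutation relation `[ang 0, ang 1] = -ang 2`. -/
lemma solidSq_succ {c : ℂ} (hc : c ^ 2 = -1) (l m : ℕ) :
    solidSq c l (m + 1) = (l * (l + 1) - m * (m + 1)) * solidSq c l m := by
  have hc' : (-c) ^ 2 = -1 := by rw [neg_sq, hc]
  set A := solidH c l m with hA
  set B := solidH (-c) l m with hB
  have sA := isSolid_solidH hc l m
  have sB := isSolid_solidH hc' l m
  have e : solidH c l (m + 1) * solidH (-c) l (m + 1) =
      ∑ a, ang a A * ang a B - ang 2 A * ang 2 B +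
        MvPolynomial.C c * (ang 1 A * ang 0 B - ang 0 A * ang 1 B) := by
    rw [← raise_solidH hc, ← raise_solidH hc', ← hA, ← hB, Fin.sum_univ_three, map_neg]
    linear_combination -(ang 0 A * ang 0 B) * C_mul_self hc
  have h2 : ang 2 A * ang 2 B = MvPolynomial.C ((m : ℂ) ^ 2) * (A * B) := by
    rw [hA, hB, ang_two_solidH hc, ang_two_solidH hc']
    have : MvPolynomial.C ((m : ℂ) ^ 2) =
      (MvPolynomial.C (m * c) * MvPolynomial.C (m * -c) : Poly) := by
      rw [← map_mul]
      congr 1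
      linear_combination ((m : ℂ) ^ 2) * hc
    rw [this]
    ring
  have h3 : sphInt (ang 1 A * ang 0 B) - sphInt (ang 0 A * ang 1 B) =
      m * c * sphInt (A * B) := by
    rw [sphInt_ang_mul sA.hom (isSolid_ang sB 0).hom, sphInt_ang_mul sA.hom (isSolid_ang sB 1).hom,
      sub_neg_eq_add, neg_add_eq_sub, ← sphInt_sub, ← mul_sub, ang_comm, hB, ang_two_solidH hc',
      mul_neg, sphInt_neg, mul_left_comm, sphInt_C_mul]
    ring
  rw [solidSq, e, sphInt_add, sphInt_sub, sphInt_sum_ang sA.hom sB, h2, sphInt_C_mul,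
    sphInt_C_mul, sphInt_sub, h3, solidSq, ← hA, ← hB]
  linear_combination m * sphInt (A * B) * hc

lemma sphInt_axial (l : ℕ) :
    sphInt ((xx 0 ^ 2 + xx 1 ^ 2) ^ l) =
      4 * Real.pi * (4 ^ l * (l.factorial : ℂ) ^ 2 / ((2 * l + 1).factorial : ℂ)) := by
  induction l with
  | zero => simp [sphInt_one]
  | succ l ih =>
    set P : Poly := xx 0 ^ 2 + xx 1 ^ 2 with hP
    have hhom : P.IsHomogeneous 2 := (MvPolynomial.isHomogeneous_X_pow _ _).add
      (MvPolynomial.isHomogeneous_X_pow _ _)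
    have hi : ∀ i, (xx i * P ^ l).IsHomogeneous (1 + 2 * l) := fun i =>
      (MvPolynomial.isHomogeneous_X _ _).mul (hhom.pow l)
    have h0 := sphInt_dd (hi 0) 0
    have h1 := sphInt_dd (hi 1) 1
    have e1 : dd 0 (xx 0 * P ^ l) + dd 1 (xx 1 * P ^ l) = ((2 * l + 2 : ℕ) : Poly) * P ^ l := by
      have d0 : dd 0 P = 2 * xx 0 := by simp [hP]
      have d1 : dd 1 P = 2 * xx 1 := by simp [hP]
      simp only [MvPolynomial.pderiv_mul, MvPolynomial.pderiv_pow, d0, d1,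
        MvPolynomial.pderiv_X_self]
      obtain _ | l := l
      · simp; norm_num
      · simp only [Nat.add_sub_cancel, hP]
        push_cast
        ring
    have e2 : xx 0 * (xx 0 * P ^ l) + xx 1 * (xx 1 * P ^ l) = P ^ (l + 1) := by
      rw [pow_succ, hP]; ring
    have h2 : ((2 * l + 2 : ℕ) : ℂ) * sphInt (P ^ l) = (2 * l + 3) * sphInt (P ^ (l + 1)) := by
      rw [← sphInt_natCast_mul, ← e1, ← e2, sphInt_add, sphInt_add, h0, h1]
      push_cast
      ring
    have h3 : (2 * l + 3 : ℂ) ≠ 0 := by exact_mod_cast Nat.succ_ne_zero (2 * l + 2)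
    apply mul_left_cancel₀ h3
    rw [← h2, ih, show 2 * (l + 1) + 1 = 2 * l + 1 + 1 + 1 by ring,
      Nat.factorial_succ (2 * l + 1 + 1),
      Nat.factorial_succ (2 * l + 1), Nat.factorial_succ l]
    have h4 : ((2 * l + 1).factorial : ℂ) ≠ 0 := by exact_mod_cast Nat.factorial_ne_zero _
    have h5 : (2 * l + 1 + 1 : ℂ) ≠ 0 := by exact_mod_cast Nat.succ_ne_zero (2 * l + 1)
    have h6 : (2 * l + 1 + 1 + 1 : ℂ) ≠ 0 := by exact_mod_cast Nat.succ_ne_zero (2 * l + 2)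
    push_cast
    field_simp
    ring

/-- The sectoral case `m = ℓ`, from which the ladder descends. -/
lemma solidSq_self {c : ℂ} (hc : c ^ 2 = -1) (l : ℕ) :
    solidSq c l l = 4 * Real.pi / (2 * l + 1) * (2 * l).factorial := by
  have h1 : ∀ c, solidH c l l = MvPolynomial.C (legCoef l l l : ℂ) * zeta c ^ l := by
    intro c
    rw [solidH, Finset.sum_range_succ, Finset.sum_eq_zero, zero_add, solidTerm]
    · rw [show 2 * l - l - l = 0 by omega, Nat.sub_self]; simp
    · intro k hk
      rw [legCoef_eq_zero (by have := Finset.mem_range.1 hk; omega)]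
      simp
  have h2 : zeta c * zeta (-c) = xx 0 ^ 2 + xx 1 ^ 2 := by
    rw [zeta, zeta, map_neg]
    linear_combination (-xx 1 ^ 2) * C_mul_self hc
  have h3 : solidH c l l * solidH (-c) l l =
      MvPolynomial.C ((legCoef l l l : ℂ) ^ 2) * (xx 0 ^ 2 + xx 1 ^ 2) ^ l := by
    rw [h1, h1, ← h2, mul_pow, map_pow]; ring
  have h4 : legCoef l l l = (2 * l).factorial / (2 ^ l * l.factorial) := by
    simp [legCoef, ← two_mul, Nat.descFactorial_self]
  rw [solidSq, h3, sphInt_C_mul, sphInt_axial, h4, Nat.factorial_succ]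
  have h5 : ((2 * l).factorial : ℂ) ≠ 0 := by exact_mod_cast Nat.factorial_ne_zero _
  have h6 : (l.factorial : ℂ) ≠ 0 := by exact_mod_cast Nat.factorial_ne_zero _
  have h7 : (2 * l + 1 : ℂ) ≠ 0 := by exact_mod_cast Nat.succ_ne_zero (2 * l)
  push_cast
  rw [show (4 : ℂ) = 2 ^ 2 by norm_num, ← pow_mul, mul_comm 2 l, pow_mul]
  field_simp

lemma solidSq_eq {c : ℂ} (hc : c ^ 2 = -1) {l m : ℕ} (hm : m ≤ l) :
    solidSq c l m =
      4 * Real.pi / (2 * l + 1) * ((l + m).factorial / (l - m).factorial) := by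
  obtain ⟨d, hd⟩ := Nat.exists_eq_add_of_le hm
  clear hm
  induction d generalizing m with
  | zero =>
    obtain rfl : l = m := by simpa using hd
    rw [solidSq_self hc, ← two_mul]; simp
  | succ d ih =>
    have h1 := ih (m := m + 1) (by omega)
    rw [solidSq_succ hc, show l - (m + 1) = d by omega, show l + (m + 1) = l + m + 1 by ring,
      Nat.factorial_succ] at h1
    rw [show l - m = d + 1 by omega, Nat.factorial_succ]
    have hl : (l : ℂ) = m + (d + 1) := by rw [hd]; push_cast; ring
    have h2 : (d : ℂ) + 1 ≠ 0 := by exact_mod_cast Nat.succ_ne_zero d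
    have h3 : (l : ℂ) + m + 1 ≠ 0 := by exact_mod_cast Nat.succ_ne_zero (l + m)
    have h4 : (d.factorial : ℂ) ≠ 0 := by exact_mod_cast Nat.factorial_ne_zero _
    have h5 : (2 * l + 1 : ℂ) ≠ 0 := by exact_mod_cast Nat.succ_ne_zero (2 * l)
    have h6 : (l * (l + 1) - m * (m + 1) : ℂ) = (d + 1) * (l + m + 1) := by rw [hl]; ring
    rw [h6] at h1
    apply mul_left_cancel₀ (mul_ne_zero h2 h3)
    rw [h1]
    push_cast
    field_simp

/-! ### Spherical harmonics and their orthonormality -/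

/-- The imaginary unit `± i` such that `exp (i m φ) = exp (± i |m| φ)`. -/
def sgnI (m : ℤ) : ℂ := if 0 ≤ m then Complex.I else -Complex.I

lemma sgnI_sq (m : ℤ) : sgnI m ^ 2 = -1 := by
  unfold sgnI; split_ifs <;> simp

lemma natAbs_mul_sgnI (m : ℤ) : (m.natAbs : ℂ) * sgnI m = m * Complex.I := by
  unfold sgnI
  split_ifs with h
  · lift m to ℕ using h
    simp
  · obtain ⟨n, rfl⟩ := Int.exists_eq_neg_ofNat (le_of_not_ge h)
    simp

/-- The solid harmonic `r ^ ℓ Y_ℓ^m`. -/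
def harmP (l : ℕ) (m : ℤ) : Poly :=
  MvPolynomial.C (((-1) ^ m.natAbs / Real.sqrt (normConst l m) : ℝ) : ℂ) *
    solidH (sgnI m) l m.natAbs

lemma isSolid_harmP (l : ℕ) (m : ℤ) : IsSolid l (harmP l m) := by
  have h := isSolid_solidH (sgnI_sq m) l m.natAbs
  exact h.C_mul _

lemma ang_two_harmP (l : ℕ) (m : ℤ) :
    ang 2 (harmP l m) = MvPolynomial.C (m * Complex.I) * harmP l m := by
  rw [harmP, ang_C_mul, ang_two_solidH (sgnI_sq m), natAbs_mul_sgnI]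
  ring

lemma conjP_mul (P Q : Poly) : conjP (P * Q) = conjP P * conjP Q := by simp [conjP]

lemma conjP_C (c : ℂ) : conjP (MvPolynomial.C c) = MvPolynomial.C (starRingEnd ℂ c) := by
  simp [conjP]

lemma conjP_solidH {c : ℂ} (hc : starRingEnd ℂ c = -c) (l m : ℕ) :
    conjP (solidH c l m) = solidH (-c) l m := by
  simp [conjP, solidH, solidTerm, zeta, radSq, hc]

lemma star_sgnI (m : ℤ) : starRingEnd ℂ (sgnI m) = -sgnI m := by
  unfold sgnI; split_ifs <;> simp

lemma normConst_pos (l : ℕ) (m : ℤ) : 0 < normConst l m := by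
  have h1 : (0 : ℝ) < (l + m.natAbs).factorial := by exact_mod_cast Nat.factorial_pos _
  have h2 : (0 : ℝ) < (l - m.natAbs).factorial := by exact_mod_cast Nat.factorial_pos _
  have := Real.pi_pos
  unfold normConst
  positivity

/-- Spherical harmonics are normalized in `L²` of the sphere. -/
lemma sphInt_harmP_self {l : ℕ} {m : ℤ} (hm : m ∈ Set.Icc (-(l : ℤ)) l) :
    sphInt (harmP l m * conjP (harmP l m)) = 1 := by
  have hm' : m.natAbs ≤ l := by
    obtain ⟨h1, h2⟩ := hm
    omega
  have e : harmP l m * conjP (harmP l m) =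
      MvPolynomial.C ((1 / normConst l m : ℝ) : ℂ) *
        (solidH (sgnI m) l m.natAbs * solidH (-sgnI m) l m.natAbs) := by
    have h1 : ((-1) ^ m.natAbs / Real.sqrt (normConst l m)) *
        ((-1) ^ m.natAbs / Real.sqrt (normConst l m)) = 1 / normConst l m := by
      rw [div_mul_div_comm, Real.mul_self_sqrt (normConst_pos l m).le, ← mul_pow]
      simp
    rw [harmP, conjP_mul, conjP_C, conjP_solidH (star_sgnI m), Complex.conj_ofReal,
      mul_mul_mul_comm, ← map_mul, ← Complex.ofReal_mul, h1]
  rw [e, sphInt_C_mul]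
  have h2 : solidSq (sgnI m) l m.natAbs = ((normConst l m : ℝ) : ℂ) := by
    rw [solidSq_eq (sgnI_sq m) hm', normConst]
    push_cast
    ring
  have h3 : ((normConst l m : ℝ) : ℂ) ≠ 0 := by exact_mod_cast (normConst_pos l m).ne'
  rw [← solidSq, h2]
  push_cast
  field_simp

/-- Spherical harmonics with different indices are orthogonal on the sphere. -/
lemma sphInt_harmP_of_ne {l l' : ℕ} {m m' : ℤ} (h : (l, m) ≠ (l', m')) :
    sphInt (harmP l m * conjP (harmP l' m')) = 0 := by
  by_cases hl : l = l'
  · have hm : m ≠ m' := fun e => h (by rw [hl, e])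
    have h1 := sphInt_ang_mul (isSolid_harmP l m).hom (isSolid_harmP l' m').conj.hom 2
    rw [ang_conjP, ang_two_harmP, ang_two_harmP, conjP_mul, conjP_C, mul_assoc, sphInt_C_mul,
      mul_left_comm, sphInt_C_mul] at h1
    simp only [map_mul, Complex.conj_I, map_intCast] at h1
    have h2 : ((m : ℂ) - m') * Complex.I * sphInt (harmP l m * conjP (harmP l' m')) = 0 := by
      linear_combination h1
    have h3 : (m : ℂ) - m' ≠ 0 := sub_ne_zero.2 (by exact_mod_cast hm)
    simpa [h3] using h2
  · exact sphInt_mul_eq_zero (isSolid_harmP l m) (isSolid_harmP l' m').conj hl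

/-! ### The power series of the spherical Bessel functions -/

/-- The coefficients of the power series of the spherical Bessel functions. -/
def bcoef (l k : ℕ) : ℝ :=
  ((Nat.factorial k : ℝ) * (Nat.doubleFactorial (2 * l + 2 * k + 1) : ℝ))⁻¹

lemma one_le_doubleFactorial (n : ℕ) : (1 : ℝ) ≤ (Nat.doubleFactorial n : ℝ) := by
  exact_mod_cast Nat.doubleFactorial_pos n

lemma bcoef_nonneg (l k : ℕ) : 0 ≤ bcoef l k := by unfold bcoef; positivity

lemma bcoef_le (l k : ℕ) : bcoef l k ≤ (Nat.factorial k : ℝ)⁻¹ := by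
  have h1 : (0 : ℝ) < Nat.factorial k := by exact_mod_cast Nat.factorial_pos k
  unfold bcoef
  gcongr
  exact le_mul_of_one_le_right h1.le (one_le_doubleFactorial _)

lemma succ_mul_bcoef (l k : ℕ) : ((k : ℝ) + 1) * bcoef l (k + 1) = bcoef (l + 1) k := by
  rw [bcoef, bcoef, show 2 * l + 2 * (k + 1) + 1 = 2 * (l + 1) + 2 * k + 1 by ring,
    Nat.factorial_succ, Nat.cast_mul, mul_assoc, mul_inv]
  push_cast
  rw [mul_inv_cancel_left₀ (by positivity)]

lemma bcoef_eq (l k : ℕ) : bcoef l k = (2 * l + 3 + 2 * k) * bcoef (l + 1) k := by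
  have h3 : (2 * (l : ℝ) + 3 + 2 * k) ≠ 0 := by positivity
  rw [bcoef, bcoef, show 2 * (l + 1) + 2 * k + 1 = (2 * l + 2 * k + 1) + 2 by ring,
    Nat.doubleFactorial_add_two, Nat.cast_mul, mul_left_comm,
    mul_inv (((2 * l + 2 * k + 1 + 2 : ℕ) : ℝ))]
  push_cast
  rw [show (2 * (l : ℝ) + 2 * k + 1 + 2) = 2 * l + 3 + 2 * k by ring, mul_inv_cancel_left₀ h3]

/-- The entire function `φ_ℓ` such that `j_ℓ(z) = z ^ ℓ φ_ℓ(z²)`. -/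
def bphi (l : ℕ) (s : ℝ) : ℝ := ∑' k : ℕ, bcoef l k * (-s / 2) ^ k

lemma sphBessel_eq (l : ℕ) (z : ℝ) : sphBessel l z = z ^ l * bphi l (z ^ 2) := by
  rw [sphBessel, bphi]
  congr 1
  refine tsum_congr fun k => ?_
  rw [bcoef, div_eq_inv_mul]

lemma summable_bphi (l : ℕ) (s : ℝ) : Summable fun k : ℕ => bcoef l k * (-s / 2) ^ k := by
  refine Summable.of_norm_bounded (Real.summable_pow_div_factorial (|s / 2|)) fun k => ?_
  rw [norm_mul, norm_pow, Real.norm_eq_abs (-s / 2), neg_div, abs_neg,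
    Real.norm_of_nonneg (bcoef_nonneg l k), div_eq_inv_mul _ (Nat.factorial k : ℝ)]
  exact mul_le_mul_of_nonneg_right (bcoef_le l k) (by positivity)

lemma hasDerivAt_bphi (l : ℕ) (s : ℝ) : HasDerivAt (bphi l) (-(1 / 2) * bphi (l + 1) s) s := by
  set R : ℝ := |s| + 2 with hR
  have hR2 : 2 ≤ R := by have := abs_nonneg s; linarith
  have hmem : s ∈ Metric.ball (0 : ℝ) R := by simp [hR]
  have key : HasDerivAt (fun y => ∑' k, bcoef l k * (-y / 2) ^ k)
      (∑' k, bcoef l k * ((k : ℝ) * (-s / 2) ^ (k - 1) * (-1 / 2))) s := by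
    refine hasDerivAt_tsum_of_isPreconnected (u := fun k => R ^ k / (Nat.factorial k : ℝ))
      (g := fun k y => bcoef l k * (-y / 2) ^ k)
      (g' := fun k y => bcoef l k * ((k : ℝ) * (-y / 2) ^ (k - 1) * (-1 / 2)))
      (Real.summable_pow_div_factorial R) Metric.isOpen_ball
      (convex_ball (0 : ℝ) R).isPreconnected (fun k y _ => ?_) (fun k y hy => ?_)
      hmem (summable_bphi l s) hmem
    · have h1 : HasDerivAt (fun y : ℝ => -y / 2) (-1 / 2) y := (hasDerivAt_id y).neg.div_const 2
      exact (h1.pow k).const_mul _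
    · have hy' : |y| ≤ R := by
        have := Metric.mem_ball.1 hy
        rw [dist_zero_right, Real.norm_eq_abs] at this
        exact this.le
      have h3 : ‖(k : ℝ) * (-y / 2) ^ (k - 1) * (-1 / 2)‖ ≤ R ^ k := by
        obtain _ | k := k
        · simp
        · rw [norm_mul, norm_mul, norm_pow, Nat.add_sub_cancel]
          simp only [Real.norm_eq_abs, abs_div, abs_neg, Nat.abs_cast, abs_one, abs_two]
          have h4 : ((k + 1 : ℕ) : ℝ) ≤ 2 ^ (k + 1) := by exact_mod_cast Nat.lt_two_pow_self.le
          calc ((k + 1 : ℕ) : ℝ) * (|y| / 2) ^ k * (1 / 2)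
              ≤ 2 ^ (k + 1) * (R / 2) ^ k * (1 / 2) := by gcongr
            _ = R ^ k := by rw [div_pow, pow_succ]; field_simp
            _ ≤ R ^ (k + 1) := by
              apply pow_le_pow_right₀ _ (Nat.le_succ k); linarith
      rw [norm_mul, Real.norm_of_nonneg (bcoef_nonneg l k), div_eq_inv_mul _ (Nat.factorial k : ℝ)]
      exact mul_le_mul (bcoef_le l k) h3 (norm_nonneg _) (by positivity)
  refine key.congr_deriv ?_
  have e : ∀ k : ℕ, bcoef l (k + 1) * (((k + 1 : ℕ) : ℝ) * (-s / 2) ^ (k + 1 - 1) * (-1 / 2)) =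
      -(1 / 2) * (bcoef (l + 1) k * (-s / 2) ^ k) := by
    intro k
    rw [← succ_mul_bcoef, Nat.add_sub_cancel]
    push_cast
    ring
  have hs : Summable fun k : ℕ =>
      bcoef l (k + 1) * (((k + 1 : ℕ) : ℝ) * (-s / 2) ^ (k + 1 - 1) * (-1 / 2)) := by
    simp only [e]
    exact (summable_bphi (l + 1) s).mul_left _
  rw [((summable_nat_add_iff
    (f := fun k : ℕ => bcoef l k * ((k : ℝ) * (-s / 2) ^ (k - 1) * (-1 / 2))) 1).1
      hs).tsum_eq_zero_add, bphi, ← tsum_mul_left, tsum_congr e]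
  simp

/-- The three-term recurrence of the spherical Bessel functions. -/
lemma bphi_rec (l : ℕ) (s : ℝ) :
    bphi l s = (2 * l + 3) * bphi (l + 1) s - s * bphi (l + 2) s := by
  let f : ℕ → ℝ := fun k => 2 * k * (bcoef (l + 1) k * (-s / 2) ^ k)
  have hf : ∀ k, f (k + 1) = -s * (bcoef (l + 2) k * (-s / 2) ^ k) := by
    intro k
    simp only [f, ← succ_mul_bcoef (l + 1) k]
    push_cast
    ring
  have hs1 : Summable fun k => f (k + 1) := by
    simp only [hf]
    exact (summable_bphi (l + 2) s).mul_left _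
  have hs : Summable f := (summable_nat_add_iff 1).1 hs1
  have h1 : ∑' k, f k = -s * bphi (l + 2) s := by
    have h0 : f 0 = 0 := by simp [f]
    rw [hs.tsum_eq_zero_add, h0, zero_add, tsum_congr hf, tsum_mul_left, bphi]
  have h2 : bphi l s =
      ∑' k, ((2 * l + 3) * (bcoef (l + 1) k * (-s / 2) ^ k) + f k) := by
    refine tsum_congr fun k => ?_
    rw [bcoef_eq]
    simp only [f]
    ring
  rw [h2, ((summable_bphi (l + 1) s).mul_left _).tsum_add hs, h1, tsum_mul_left, ← bphi]
  ring

/-- The radial factor `j_ℓ(kr) / r ^ ℓ`, as a smooth function of `r²` without a singularity at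
`0`. -/
def bes (l : ℕ) (k : ℝ) (r : ℝ) : ℝ := k ^ l * bphi l (k ^ 2 * r ^ 2)

lemma bes_mul_pow (l : ℕ) (k r : ℝ) : bes l k r * r ^ l = sphBessel l (k * r) := by
  rw [bes, sphBessel_eq, mul_pow, mul_pow]; ring

/-! ### The scalar eigenfunctions as radial factors times solid harmonics -/

lemma eval_iterate_derivative_legendrePoly (l m : ℕ) (t : ℝ) :
    (Polynomial.derivative^[m] (legendrePoly l)).eval t =
      ∑ k ∈ Finset.range (l + 1), legCoef l m k * t ^ (2 * k - l - m) := by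
  have h1 : ((Polynomial.X : Polynomial ℝ) ^ 2 - 1) ^ l = ∑ k ∈ Finset.range (l + 1),
      Polynomial.C ((-1) ^ (l - k) * (l.choose k : ℝ)) * Polynomial.X ^ (2 * k) := by
    rw [sub_eq_add_neg, add_pow]
    refine Finset.sum_congr rfl fun k _ => ?_
    simp only [map_mul, map_pow, map_neg, map_one, map_natCast, pow_mul]
    ring
  rw [legendrePoly, Polynomial.iterate_derivative_C_mul, ← Function.iterate_add_apply, h1,
    Polynomial.iterate_derivative_sum, Polynomial.eval_mul, Polynomial.eval_C,
    Polynomial.eval_finsetSum, Finset.mul_sum]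
  refine Finset.sum_congr rfl fun k _ => ?_
  rw [Polynomial.iterate_derivative_C_mul, Polynomial.iterate_derivative_X_pow_eq_natCast_mul]
  simp only [Polynomial.eval_mul, Polynomial.eval_C, Polynomial.eval_natCast, Polynomial.eval_pow,
    Polynomial.eval_X, legCoef, add_comm m l, Nat.sub_sub]
  ring

lemma ev_solidH (c : ℂ) {l m : ℕ} (hm : m ≤ l) {x : E3} (hx : x ≠ 0) :
    ev (solidH c l m) x = ev (zeta c) x ^ m * (‖x‖ : ℂ) ^ (l - m) *
      (((Polynomial.derivative^[m] (legendrePoly l)).eval (x 2 / ‖x‖) : ℝ) : ℂ) := by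
  have hr : (‖x‖ : ℂ) ≠ 0 := by exact_mod_cast norm_ne_zero_iff.2 hx
  rw [eval_iterate_derivative_legendrePoly, solidH, ev_sum, Complex.ofReal_sum, Finset.mul_sum]
  refine Finset.sum_congr rfl fun k hk => ?_
  have hk' := Finset.mem_range.1 hk
  by_cases h : 2 * k < l + m
  · simp [legCoef_eq_zero h]
  · obtain ⟨e, he⟩ : ∃ e, l - m = (2 * k - l - m) + e := ⟨2 * (l - k), by omega⟩
    have he2 : 2 * (l - k) = e := by omega
    simp only [solidTerm, ev_mul, ev_C, ev_pow, ev_X, ev_radSq, ← pow_mul, he2, he]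
    push_cast
    rw [div_pow, pow_add]
    field_simp

lemma abs_div_norm_le (x : E3) : |x 2 / ‖x‖| ≤ 1 := by
  rw [abs_div, abs_norm]
  exact div_le_one_of_le₀ (PiLp.norm_apply_le x 2) (norm_nonneg x)

lemma cos_polar (x : E3) : Real.cos (polar x) = x 2 / ‖x‖ := by
  have := abs_le.1 (abs_div_norm_le x)
  exact Real.cos_arccos this.1 this.2

lemma norm_sq_E3 (x : E3) : ‖x‖ ^ 2 = x 0 ^ 2 + x 1 ^ 2 + x 2 ^ 2 := by
  rw [EuclideanSpace.norm_sq_eq, Fin.sum_univ_three]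
  simp

lemma norm_mul_sin_polar {x : E3} (hx : x ≠ 0) :
    ‖x‖ * Real.sin (polar x) = ‖(x 0 : ℂ) + (x 1 : ℂ) * Complex.I‖ := by
  have hr : 0 < ‖x‖ := norm_pos_iff.2 hx
  rw [polar, Real.sin_arccos, Complex.norm_add_mul_I]
  nth_rewrite 1 [← Real.sqrt_sq hr.le]
  rw [← Real.sqrt_mul (by positivity)]
  congr 1
  field_simp
  rw [norm_sq_E3]
  ring

lemma zeta_polar {x : E3} (hx : x ≠ 0) (m : ℤ) :
    ev (zeta (sgnI m)) x ^ m.natAbs = (‖x‖ : ℂ) ^ m.natAbs *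
      (Real.sqrt (1 - Real.cos (polar x) ^ 2) : ℂ) ^ m.natAbs *
        Complex.exp (Complex.I * (m : ℂ) * (azimuth x : ℂ)) := by
  have h1 : Real.sqrt (1 - Real.cos (polar x) ^ 2) = Real.sin (polar x) := by
    rw [cos_polar, polar, Real.sin_arccos]
  have h2 : (x 0 : ℂ) + (x 1 : ℂ) * Complex.I =
      ((‖x‖ * Real.sin (polar x) : ℝ) : ℂ) * Complex.exp (azimuth x * Complex.I) := by
    rw [norm_mul_sin_polar hx, azimuth, Complex.norm_mul_exp_arg_mul_I]
  have h3 : (x 0 : ℂ) - (x 1 : ℂ) * Complex.I =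
      ((‖x‖ * Real.sin (polar x) : ℝ) : ℂ) * Complex.exp (-azimuth x * Complex.I) := by
    have := congrArg (starRingEnd ℂ) h2
    rw [map_mul, Complex.conj_ofReal, ← Complex.exp_conj] at this
    simpa [sub_eq_add_neg] using this
  rw [h1, ← mul_pow, ← Complex.ofReal_mul]
  unfold sgnI
  split_ifs with h
  · lift m to ℕ using h
    have : ev (zeta Complex.I) x = (x 0 : ℂ) + (x 1 : ℂ) * Complex.I := by
      simp [zeta, mul_comm]
    rw [this, h2, Int.natAbs_natCast, mul_pow, ← Complex.exp_nat_mul]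
    congr 2
    push_cast
    ring
  · obtain ⟨n, rfl⟩ := Int.exists_eq_neg_ofNat (le_of_not_ge h)
    have : ev (zeta (-Complex.I)) x = (x 0 : ℂ) - (x 1 : ℂ) * Complex.I := by
      simp [zeta, mul_comm]; ring
    rw [this, h3, Int.natAbs_neg, Int.natAbs_natCast, mul_pow, ← Complex.exp_nat_mul]
    congr 2
    push_cast
    ring

/-- The scalar eigenfunctions are radial factors times solid harmonics. -/
lemma waveF_eq (k : ℝ) {l : ℕ} {m : ℤ} (hm : m ∈ Set.Icc (-(l : ℤ)) l) (x : E3) :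
    waveF k l m x = (bes l k ‖x‖ : ℂ) * ev (harmP l m) x := by
  have hm' : m.natAbs ≤ l := by
    obtain ⟨h1, h2⟩ := hm
    omega
  by_cases hx : x = 0
  · subst hx
    obtain _ | l := l
    · obtain rfl : m = 0 := by simpa using hm'
      simp [waveF, bes, sphBessel_eq, harmP, sphHarmonic, assocLegendre, legendrePoly, solidH,
        solidTerm, legCoef]
    · have h1 : ev (harmP (l + 1) m) (0 : E3) = 0 := by
        have := ev_real_smul (isSolid_harmP (l + 1) m).hom 0 0
        simpa using this
      rw [h1, waveF, sphBessel_eq]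
      simp
  · have h1 : l = m.natAbs + (l - m.natAbs) := by omega
    rw [waveF, ← bes_mul_pow, harmP, ev_mul, ev_C, ev_solidH _ hm' hx, zeta_polar hx, sphHarmonic,
      assocLegendre, cos_polar]
    push_cast
    nth_rewrite 2 [h1]
    rw [pow_add]
    ring

/-! ### The Hansen vectors as combinations of vector solid harmonics -/

lemma bes_rec (l : ℕ) (k r : ℝ) :
    k * bes l k r = (2 * l + 3) * bes (l + 1) k r - k * r ^ 2 * bes (l + 2) k r := by
  rw [bes, bphi_rec, bes, bes]; ring

lemma hasFDerivAt_bes (l : ℕ) (k : ℝ) (x : E3) :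
    HasFDerivAt (fun y : E3 => (bes l k ‖y‖ : ℂ))
      (Complex.ofRealCLM.comp ((-(k * bes (l + 1) k ‖x‖)) • innerSL ℝ x)) x := by
  have h1 := ((hasStrictFDerivAt_norm_sq x).hasFDerivAt.const_mul (k ^ 2))
  have h2 := ((hasDerivAt_bphi l (k ^ 2 * ‖x‖ ^ 2)).comp_hasFDerivAt x h1).const_mul (k ^ l)
  refine (Complex.ofRealCLM.hasFDerivAt.comp x h2).congr_fderiv ?_
  ext v
  simp [bes]
  ring

/-- The vector field with radial factor `j_ℓ(k|x|) / |x| ^ ℓ` and polynomial components `A`. -/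
def besField (l : ℕ) (k : ℝ) (A : Fin 3 → Poly) : VField := fun x i =>
  (bes l k ‖x‖ : ℂ) * ev (A i) x

lemma differentiable_bes_mul (l : ℕ) (k : ℝ) (P : Poly) :
    Differentiable ℝ (fun y : E3 => (bes l k ‖y‖ : ℂ) * ev P y) := fun x =>
  (hasFDerivAt_bes l k x).differentiableAt.fun_mul (differentiable_ev P x)

lemma pderiv_bes_mul (l : ℕ) (k : ℝ) (P : Poly) (i : Fin 3) (x : E3) :
    pderiv i (fun y : E3 => (bes l k ‖y‖ : ℂ) * ev P y) x =
      (bes l k ‖x‖ : ℂ) * ev (dd i P) x - k * bes (l + 1) k ‖x‖ * (x i * ev P x) := by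
  rw [pderiv, ((hasFDerivAt_bes l k x).fun_mul (differentiable_ev P x).hasFDerivAt).fderiv]
  simp only [add_apply, smul_apply, fderiv_ev_single]
  simp [EuclideanSpace.inner_single_right]
  ring

/-- The gradient of a scalar eigenfunction, split into vector solid harmonics. -/
lemma grad_bes_mul {l : ℕ} {H : Poly} (h : IsSolid l H) (k : ℝ) :
    grad (fun x => (bes l k ‖x‖ : ℂ) * ev H x) =
      besField (l - 1) k (fun i => MvPolynomial.C (k / (2 * l + 1) : ℂ) * gradP H i) +
      besField (l + 1) k (fun i => MvPolynomial.C (-k : ℂ) * posP l H i) := by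
  funext x i
  rw [grad, pderiv_bes_mul, Pi.add_apply, Pi.add_apply]
  have h2 : (2 * (l : ℂ) + 1) ≠ 0 := by exact_mod_cast Nat.succ_ne_zero (2 * l)
  simp only [besField, posP, gradP, ev_mul, ev_C, ev_sub, ev_X, ev_radSq]
  obtain _ | l := l
  · rw [dd_eq_zero_of_hom h.hom]
    simp
    ring
  · have h3 := congrArg (fun t : ℝ => (t : ℂ)) (bes_rec l k ‖x‖)
    push_cast at h2 h3 ⊢
    field_simp
    linear_combination -ev (dd i H) x * h3

lemma curl_posMul (l : ℕ) (k : ℝ) (H : Poly) :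
    curl (posMul fun x => (bes l k ‖x‖ : ℂ) * ev H x) = besField l k (torP H) := by
  have h : ∀ j, (fun y : E3 => posMul (fun x => (bes l k ‖x‖ : ℂ) * ev H x) y j) =
      fun y : E3 => (bes l k ‖y‖ : ℂ) * ev (xx j * H) y := by
    intro j
    funext y
    simp only [posMul, ev_mul, ev_X]
    ring
  funext x i
  simp only [curl, h, pderiv_bes_mul, MvPolynomial.pderiv_mul, dd_xx]
  fin_cases i <;> simp [besField, torP, ang_zero, ang_one, ang_two] <;> ring

/-- The curl of a toroidal field, split into vector solid harmonics. -/
lemma curl_torP {l : ℕ} {H : Poly} (h : IsSolid l H) (k : ℝ) :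
    curl (besField l k (torP H)) =
      besField (l - 1) k (fun i => MvPolynomial.C (k * (l + 1) / (2 * l + 1) : ℂ) * gradP H i) +
      besField (l + 1) k (fun i => MvPolynomial.C (k * l : ℂ) * posP l H i) := by
  have e := euler h.hom
  have eG : ∀ i, xx 0 * dd 0 (dd i H) + xx 1 * dd 1 (dd i H) + xx 2 * dd 2 (dd i H) + 2 * dd i H =
      ((l + 1 : ℕ) : Poly) * dd i H := by
    intro i
    rw [euler (isSolid_dd h i).hom]
    obtain _ | l := l
    · rw [dd_eq_zero_of_hom h.hom]; simp
    · push_cast [Nat.add_sub_cancel]; ring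
  have hl := h.harm
  rw [lap] at hl
  -- the components of `curl C = (ℓ + 1) ∇H`, with `C = ∇H × x`
  have c0 : dd 1 (torP H 2) - dd 2 (torP H 1) = ((l + 1 : ℕ) : Poly) * dd 0 H := by
    rw [← eG]
    simp only [torP, ang_one, ang_two, map_neg, map_sub, MvPolynomial.pderiv_mul, dd_xx]
    simp only [Fin.isValue, ↓reduceIte, Fin.reduceEq, zero_mul, one_mul, zero_add]
    linear_combination -xx 0 * hl
  have c1 : dd 2 (torP H 0) - dd 0 (torP H 2) = ((l + 1 : ℕ) : Poly) * dd 1 H := by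
    rw [← eG]
    simp only [torP, ang_zero, ang_two, map_neg, map_sub, MvPolynomial.pderiv_mul, dd_xx]
    simp only [Fin.isValue, ↓reduceIte, Fin.reduceEq, zero_mul, one_mul, zero_add]
    linear_combination -xx 1 * hl
  have c2 : dd 0 (torP H 1) - dd 1 (torP H 0) = ((l + 1 : ℕ) : Poly) * dd 2 H := by
    rw [← eG]
    simp only [torP, ang_zero, ang_one, map_neg, map_sub, MvPolynomial.pderiv_mul, dd_xx]
    simp only [Fin.isValue, ↓reduceIte, Fin.reduceEq, zero_mul, one_mul, zero_add]
    linear_combination -xx 2 * hl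
  -- the components of `x × C = |x|² ∇H - ℓ x H`
  have d0 : xx 1 * torP H 2 - xx 2 * torP H 1 = radSq * dd 0 H - (l : Poly) * (xx 0 * H) := by
    simp only [torP, ang_one, ang_two, radSq]
    linear_combination -xx 0 * e
  have d1 : xx 2 * torP H 0 - xx 0 * torP H 2 = radSq * dd 1 H - (l : Poly) * (xx 1 * H) := by
    simp only [torP, ang_zero, ang_two, radSq]
    linear_combination -xx 1 * e
  have d2 : xx 0 * torP H 1 - xx 1 * torP H 0 = radSq * dd 2 H - (l : Poly) * (xx 2 * H) := by
    simp only [torP, ang_zero, ang_one, radSq]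
    linear_combination -xx 2 * e
  have key : ∀ (x : E3) (i : Fin 3), (bes l k ‖x‖ : ℂ) * ev (((l + 1 : ℕ) : Poly) * dd i H) x -
      k * bes (l + 1) k ‖x‖ * ev (radSq * dd i H - (l : Poly) * (xx i * H)) x =
      (besField (l - 1) k (fun i => MvPolynomial.C (k * (l + 1) / (2 * l + 1) : ℂ) * gradP H i) +
      besField (l + 1) k (fun i => MvPolynomial.C (k * l : ℂ) * posP l H i)) x i := by
    intro x i
    rw [Pi.add_apply, Pi.add_apply]
    have h2 : (2 * (l : ℂ) + 1) ≠ 0 := by exact_mod_cast Nat.succ_ne_zero (2 * l)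
    simp only [besField, posP, gradP, ev_mul, ev_C, ev_sub, ev_X, ev_radSq, ev_natCast]
    obtain _ | l := l
    · rw [dd_eq_zero_of_hom h.hom]
      simp
    · have h3 := congrArg (fun t : ℝ => (t : ℂ)) (bes_rec l k ‖x‖)
      push_cast at h2 h3 ⊢
      have hc := inv_mul_cancel₀ h2
      simp only [div_eq_mul_inv, one_mul]
      linear_combination (-(l + 1 + 1) * (2 * ((l : ℂ) + 1) + 1)⁻¹ * ev (dd i H) x) * h3 -
        ((l + 1 + 1) * ev (dd i H) x * bes (l + 1) k ‖x‖ -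
          k * bes (l + 2) k ‖x‖ * ‖x‖ ^ 2 * ev (dd i H) x) * hc
  funext x i
  rw [← key]
  simp only [curl, besField, pderiv_bes_mul]
  fin_cases i
  · simp only [Fin.zero_eta, ← c0, ← d0, ev_sub, ev_mul, ev_X]
    simp
    ring
  · simp only [Fin.mk_one, ← c1, ← d1, ev_sub, ev_mul, ev_X]
    simp
    ring
  · simp only [Fin.reduceFinMk, ← c2, ← d2, ev_sub, ev_mul, ev_X]
    simp
    ring

section
variable (k : ℝ) {l : ℕ} {m : ℤ} (hm : m ∈ Set.Icc (-(l : ℤ)) l)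
include hm

lemma hansenL_eq : hansenL k l m =
    besField (l - 1) k (fun i => MvPolynomial.C (k / (2 * l + 1) : ℂ) * gradP (harmP l m) i) +
    besField (l + 1) k (fun i => MvPolynomial.C (-k : ℂ) * posP l (harmP l m) i) := by
  rw [← grad_bes_mul (isSolid_harmP l m), hansenL, funext (waveF_eq k hm)]

lemma hansenM_eq : hansenM k l m = besField l k (torP (harmP l m)) := by
  rw [← curl_posMul, hansenM, funext (waveF_eq k hm)]

lemma hansenN_eq : hansenN k l m =
    besField (l - 1) k
      (fun i => MvPolynomial.C (k * (l + 1) / (2 * l + 1) : ℂ) * gradP (harmP l m) i) +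
    besField (l + 1) k (fun i => MvPolynomial.C (k * l : ℂ) * posP l (harmP l m) i) := by
  rw [← curl_torP (isSolid_harmP l m), hansenN, ← hansenM, hansenM_eq k hm]

end

/-! ### The spherical gradient in Cartesian components -/

/-- The completeness relation of the orthonormal spherical frame. -/
lemma frame_completeness (θ φ : ℝ) (i j : Fin 3) :
    rHat θ φ i * rHat θ φ j + thetaHat θ φ i * thetaHat θ φ j + phiHat θ φ i * phiHat θ φ j =
      if i = j then 1 else 0 := by
  have h1 := Real.sin_sq_add_cos_sq θ
  have h2 := Real.sin_sq_add_cos_sq φ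
  fin_cases i <;> fin_cases j <;> simp [rHat, thetaHat, phiHat] <;> grind

lemma frame_sum (θ φ : ℝ) (a b : Fin 3 → ℂ) :
    (∑ i, a i * (rHat θ φ i : ℂ)) * (∑ i, b i * (rHat θ φ i : ℂ)) +
      (∑ i, a i * (thetaHat θ φ i : ℂ)) * (∑ i, b i * (thetaHat θ φ i : ℂ)) +
      (∑ i, a i * (phiHat θ φ i : ℂ)) * (∑ i, b i * (phiHat θ φ i : ℂ)) = ∑ i, a i * b i := by
  have h : ∀ i j : Fin 3, (rHat θ φ i : ℂ) * rHat θ φ j + thetaHat θ φ i * thetaHat θ φ j +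
      phiHat θ φ i * phiHat θ φ j = if i = j then 1 else 0 := by
    intro i j
    have := congrArg (fun t : ℝ => (t : ℂ)) (frame_completeness θ φ i j)
    push_cast at this
    rw [this]
    split_ifs <;> simp
  calc _ = ∑ i, ∑ j, a i * b j * ((rHat θ φ i : ℂ) * rHat θ φ j + thetaHat θ φ i * thetaHat θ φ j +
      phiHat θ φ i * phiHat θ φ j) := by
        simp only [Fin.sum_univ_three]; ring
    _ = _ := by simp [h]

lemma sphPoint_polar {x : E3} (hx : x ≠ 0) : sphPoint ‖x‖ (polar x) (azimuth x) = x := by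
  have hr : ‖x‖ ≠ 0 := norm_ne_zero_iff.2 hx
  have h2 : ((‖x‖ * Real.sin (polar x) : ℝ) : ℂ) * Complex.exp (azimuth x * Complex.I) =
      (x 0 : ℂ) + (x 1 : ℂ) * Complex.I := by
    rw [norm_mul_sin_polar hx, azimuth, Complex.norm_mul_exp_arg_mul_I]
  rw [Complex.exp_mul_I, ← Complex.ofReal_cos, ← Complex.ofReal_sin] at h2
  have hre := congrArg Complex.re h2
  have him := congrArg Complex.im h2
  simp only [Complex.add_re, Complex.add_im, Complex.mul_re, Complex.mul_im, Complex.ofReal_re,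
    Complex.ofReal_im, Complex.I_re, Complex.I_im, mul_zero, mul_one, zero_mul, sub_zero, add_zero,
    zero_add] at hre him
  ext i
  fin_cases i
  · simp [sphPoint, rHat, ← hre]; ring
  · simp [sphPoint, rHat, ← him]; ring
  · simp [sphPoint, rHat, cos_polar]; field_simp

lemma hasDerivAt_comp_curve {f : E3 → ℂ} {γ : ℝ → E3} {γ' : Fin 3 → ℝ} {t : ℝ}
    (hγ : ∀ i, HasDerivAt (fun s => γ s i) (γ' i) t) (hf : DifferentiableAt ℝ f (γ t)) :
    HasDerivAt (fun s => f (γ s)) (∑ j, pderiv j f (γ t) * (γ' j : ℂ)) t := by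
  have h1 : HasDerivAt γ (WithLp.toLp 2 γ') t := by
    have := (EuclideanSpace.equiv (Fin 3) ℝ).symm.hasFDerivAt.comp_hasDerivAt t
      (hasDerivAt_pi.2 hγ : HasDerivAt (fun s i => γ s i) γ' t)
    exact this
  have h2 := hf.hasFDerivAt.comp_hasDerivAt t h1
  refine h2.congr_deriv ?_
  have h3 : (WithLp.toLp 2 γ' : E3) = ∑ j, γ' j • EuclideanSpace.single j (1 : ℝ) := by
    ext i
    fin_cases i <;> simp [Fin.sum_univ_three]
  rw [h3, map_sum]
  refine Finset.sum_congr rfl fun j _ => ?_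
  rw [map_smul, pderiv, Complex.real_smul, mul_comm]

/-- The derivative along the frame vector `e`, scaled by `r`, of the Cartesian components. -/
def frameDeriv (e : Fin 3 → ℝ) (r : ℝ) (u : VField) (x : E3) (i : Fin 3) : ℂ :=
  r * ∑ j, pderiv j (fun y => u y i) x * (e j : ℂ)

section
variable (u : VField) (r θ φ : ℝ)
  (hu : ∀ i, DifferentiableAt ℝ (fun y => u y i) (sphPoint r θ φ))
include hu

lemma hasDerivAt_theta (i : Fin 3) : HasDerivAt (fun t => u (sphPoint r t φ) i)
    (frameDeriv (thetaHat θ φ) r u (sphPoint r θ φ) i) θ := by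
  have h := hasDerivAt_comp_curve (γ := fun t => sphPoint r t φ)
    (γ' := fun j => r * thetaHat θ φ j) (t := θ) (f := fun y => u y i) ?_ (hu i)
  · refine h.congr_deriv ?_
    rw [frameDeriv, Finset.mul_sum]
    refine Finset.sum_congr rfl fun j _ => ?_
    push_cast
    ring
  · intro j
    simp only [sphPoint]
    refine HasDerivAt.const_mul r ?_
    fin_cases j
    · simpa [rHat, thetaHat] using (Real.hasDerivAt_sin θ).mul_const (Real.cos φ)
    · simpa [rHat, thetaHat] using (Real.hasDerivAt_sin θ).mul_const (Real.sin φ)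
    · simpa [rHat, thetaHat] using Real.hasDerivAt_cos θ

lemma hasDerivAt_phi (i : Fin 3) : HasDerivAt (fun p => u (sphPoint r θ p) i)
    (Real.sin θ * frameDeriv (phiHat θ φ) r u (sphPoint r θ φ) i) φ := by
  have h := hasDerivAt_comp_curve (γ := fun p => sphPoint r θ p)
    (γ' := fun j => r * (Real.sin θ * phiHat θ φ j)) (t := φ) (f := fun y => u y i) ?_ (hu i)
  · refine h.congr_deriv ?_
    rw [frameDeriv, Finset.mul_sum, Finset.mul_sum]
    refine Finset.sum_congr rfl fun j _ => ?_
    push_cast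
    ring
  · intro j
    simp only [sphPoint]
    refine HasDerivAt.const_mul r ?_
    fin_cases j
    · simpa [rHat, phiHat] using (Real.hasDerivAt_cos φ).const_mul (Real.sin θ)
    · simpa [rHat, phiHat] using (Real.hasDerivAt_sin φ).const_mul (Real.sin θ)
    · simpa [rHat, phiHat] using hasDerivAt_const φ (Real.cos θ)

lemma deriv_sphComp_theta {e : ℝ → ℝ → Fin 3 → ℝ} {e' : Fin 3 → ℝ}
    (he : ∀ i, HasDerivAt (fun t => e t φ i) (e' i) θ) :
    deriv (fun t => sphComp e u r t φ) θ =
      ∑ i, frameDeriv (thetaHat θ φ) r u (sphPoint r θ φ) i * (e θ φ i : ℂ) +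
        ∑ i, u (sphPoint r θ φ) i * (e' i : ℂ) := by
  rw [← Finset.sum_add_distrib]
  refine HasDerivAt.deriv ?_
  simp only [sphComp]
  exact HasDerivAt.fun_sum fun i _ => (hasDerivAt_theta u r θ φ hu i).fun_mul (he i).ofReal_comp

lemma deriv_sphComp_phi {e : ℝ → ℝ → Fin 3 → ℝ} {e' : Fin 3 → ℝ}
    (he : ∀ i, HasDerivAt (fun p => e θ p i) (e' i) φ) :
    deriv (fun p => sphComp e u r θ p) φ =
      Real.sin θ * ∑ i, frameDeriv (phiHat θ φ) r u (sphPoint r θ φ) i * (e θ φ i : ℂ) +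
        ∑ i, u (sphPoint r θ φ) i * (e' i : ℂ) := by
  rw [Finset.mul_sum, ← Finset.sum_add_distrib]
  refine HasDerivAt.deriv ?_
  simp only [sphComp]
  refine (HasDerivAt.fun_sum fun i _ =>
    (hasDerivAt_phi u r θ φ hu i).fun_mul (he i).ofReal_comp).congr_deriv ?_
  exact Finset.sum_congr rfl fun i _ => by ring

lemma sphGradAt_eq (hs : Real.sin θ ≠ 0) : sphGradAt u r θ φ =
    !![0, 0, 0;
      ∑ i, frameDeriv (thetaHat θ φ) r u (sphPoint r θ φ) i * (rHat θ φ i : ℂ),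
      ∑ i, frameDeriv (thetaHat θ φ) r u (sphPoint r θ φ) i * (thetaHat θ φ i : ℂ),
      ∑ i, frameDeriv (thetaHat θ φ) r u (sphPoint r θ φ) i * (phiHat θ φ i : ℂ);
      ∑ i, frameDeriv (phiHat θ φ) r u (sphPoint r θ φ) i * (rHat θ φ i : ℂ),
      ∑ i, frameDeriv (phiHat θ φ) r u (sphPoint r θ φ) i * (thetaHat θ φ i : ℂ),
      ∑ i, frameDeriv (phiHat θ φ) r u (sphPoint r θ φ) i * (phiHat θ φ i : ℂ)] := by
  have t1 : ∀ i, HasDerivAt (fun t => rHat t φ i) (thetaHat θ φ i) θ := by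
    intro i
    fin_cases i
    · simpa [rHat, thetaHat] using (Real.hasDerivAt_sin θ).mul_const (Real.cos φ)
    · simpa [rHat, thetaHat] using (Real.hasDerivAt_sin θ).mul_const (Real.sin φ)
    · simpa [rHat, thetaHat] using Real.hasDerivAt_cos θ
  have t2 : ∀ i, HasDerivAt (fun t => thetaHat t φ i) (-rHat θ φ i) θ := by
    intro i
    fin_cases i
    · simpa [rHat, thetaHat] using (Real.hasDerivAt_cos θ).mul_const (Real.cos φ)
    · simpa [rHat, thetaHat] using (Real.hasDerivAt_cos θ).mul_const (Real.sin φ)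
    · simpa [rHat, thetaHat] using (Real.hasDerivAt_sin θ).fun_neg
  have t3 : ∀ i, HasDerivAt (fun t => phiHat t φ i) 0 θ := fun i => hasDerivAt_const _ _
  have p1 : ∀ i, HasDerivAt (fun p => rHat θ p i) (Real.sin θ * phiHat θ φ i) φ := by
    intro i
    fin_cases i
    · simpa [rHat, phiHat] using (Real.hasDerivAt_cos φ).const_mul (Real.sin θ)
    · simpa [rHat, phiHat] using (Real.hasDerivAt_sin φ).const_mul (Real.sin θ)
    · simpa [rHat, phiHat] using hasDerivAt_const φ (Real.cos θ)
  have p2 : ∀ i, HasDerivAt (fun p => thetaHat θ p i) (Real.cos θ * phiHat θ φ i) φ := by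
    intro i
    fin_cases i
    · simpa [thetaHat, phiHat] using (Real.hasDerivAt_cos φ).const_mul (Real.cos θ)
    · simpa [thetaHat, phiHat] using (Real.hasDerivAt_sin φ).const_mul (Real.cos θ)
    · simpa [thetaHat, phiHat] using hasDerivAt_const φ (-Real.sin θ)
  have p3 : ∀ i, HasDerivAt (fun p => phiHat θ p i)
      (-(Real.sin θ * rHat θ φ i + Real.cos θ * thetaHat θ φ i)) φ := by
    intro i
    have h1 := Real.sin_sq_add_cos_sq θ
    fin_cases i
    · refine ((Real.hasDerivAt_sin φ).fun_neg).congr_deriv ?_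
      simp [rHat, thetaHat]
      linear_combination Real.cos φ * h1
    · refine (Real.hasDerivAt_cos φ).congr_deriv ?_
      simp [rHat, thetaHat]
      linear_combination Real.sin φ * h1
    · refine (hasDerivAt_const φ (0 : ℝ)).congr_deriv ?_
      simp [rHat, thetaHat]
      ring
  have hs' : (Real.sin θ : ℂ) ≠ 0 := by exact_mod_cast hs
  push_cast at hs'
  simp only [sphGradAt, deriv_sphComp_theta u r θ φ hu t1, deriv_sphComp_theta u r θ φ hu t2,
    deriv_sphComp_theta u r θ φ hu t3, deriv_sphComp_phi u r θ φ hu p1,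
    deriv_sphComp_phi u r θ φ hu p2, deriv_sphComp_phi u r θ φ hu p3]
  simp only [sphComp, Fin.sum_univ_three]
  push_cast
  ext i j
  fin_cases i <;> fin_cases j <;> simp <;> field_simp <;> ring

end

/-- The components of `x × ∇f`. -/
def angF (a : Fin 3) (f : E3 → ℂ) (x : E3) : ℂ :=
  x (a + 1) * pderiv (a + 2) f x - x (a + 2) * pderiv (a + 1) f x

lemma contract_two_rows (a b c d e f a' b' c' d' e' f' : ℂ) :
    ∑ i, ∑ j, (!![0, 0, 0; a, b, c; d, e, f] : Matrix (Fin 3) (Fin 3) ℂ) i j *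
      starRingEnd ℂ ((!![0, 0, 0; a', b', c'; d', e', f'] : Matrix (Fin 3) (Fin 3) ℂ) i j) =
      a * starRingEnd ℂ a' + b * starRingEnd ℂ b' + c * starRingEnd ℂ c' +
        (d * starRingEnd ℂ d' + e * starRingEnd ℂ e' + f * starRingEnd ℂ f') := by
  simp [Fin.sum_univ_three]

/-- The contraction of two spherical gradients in Cartesian components. -/
lemma sphGrad_contract (u v : VField) {x : E3} (hx : x 0 ≠ 0)
    (hu : ∀ i, DifferentiableAt ℝ (fun y => u y i) x)
    (hv : ∀ i, DifferentiableAt ℝ (fun y => v y i) x) :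
    ∑ i, ∑ j, sphGrad u x i j * starRingEnd ℂ (sphGrad v x i j) =
      ∑ i, ∑ a, angF a (fun y => u y i) x * starRingEnd ℂ (angF a (fun y => v y i) x) := by
  have hx0 : x ≠ 0 := fun h => hx (by simp [h])
  have hs : Real.sin (polar x) ≠ 0 := by
    intro h
    have h1 := norm_mul_sin_polar hx0
    rw [h, mul_zero] at h1
    have h2 := norm_eq_zero.1 h1.symm
    have := congrArg Complex.re h2
    simp at this
    exact hx this
  set r := ‖x‖
  set θ := polar x
  set φ := azimuth x
  have hp : sphPoint r θ φ = x := sphPoint_polar hx0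
  have hc : ∀ j, x j = r * rHat θ φ j := fun j => by rw [← hp]; rfl
  rw [sphGrad, sphGrad, sphGradAt_eq u _ _ _ (hp.symm ▸ hu) hs,
    sphGradAt_eq v _ _ _ (hp.symm ▸ hv) hs, hp]
  have hf : ∀ e : Fin 3 → ℝ,
      (∑ i, frameDeriv e r u x i * (rHat θ φ i : ℂ)) *
        (starRingEnd ℂ (∑ i, frameDeriv e r v x i * (rHat θ φ i : ℂ))) +
      (∑ i, frameDeriv e r u x i * (thetaHat θ φ i : ℂ)) *
        (starRingEnd ℂ (∑ i, frameDeriv e r v x i * (thetaHat θ φ i : ℂ))) +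
      (∑ i, frameDeriv e r u x i * (phiHat θ φ i : ℂ)) *
        (starRingEnd ℂ (∑ i, frameDeriv e r v x i * (phiHat θ φ i : ℂ))) =
      ∑ i, frameDeriv e r u x i * starRingEnd ℂ (frameDeriv e r v x i) := by
    intro e
    simp only [map_sum, map_mul, Complex.conj_ofReal]
    exact frame_sum θ φ _ _
  have h1 := hf (thetaHat θ φ)
  have h2 := hf (phiHat θ φ)
  have h3 : ∀ i, frameDeriv (thetaHat θ φ) r u x i *
        starRingEnd ℂ (frameDeriv (thetaHat θ φ) r v x i) +
      frameDeriv (phiHat θ φ) r u x i * starRingEnd ℂ (frameDeriv (phiHat θ φ) r v x i) =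
      ∑ a, angF a (fun y => u y i) x * starRingEnd ℂ (angF a (fun y => v y i) x) := by
    intro i
    have h4 := frame_sum θ φ (fun j => pderiv j (fun y => u y i) x)
      (fun j => starRingEnd ℂ (pderiv j (fun y => v y i) x))
    have hn : (r : ℂ) ^ 2 = (x 0 : ℂ) ^ 2 + (x 1 : ℂ) ^ 2 + (x 2 : ℂ) ^ 2 := by
      exact_mod_cast norm_sq_E3 x
    have hcc : ∀ j, (x j : ℂ) = r * rHat θ φ j := fun j => by rw [hc j]; push_cast; rfl
    have h5 : (∑ j, pderiv j (fun y => u y i) x * (x j : ℂ)) *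
        (∑ j, starRingEnd ℂ (pderiv j (fun y => v y i) x) * (x j : ℂ)) =
        r ^ 2 * ((∑ j, pderiv j (fun y => u y i) x * (rHat θ φ j : ℂ)) *
        (∑ j, starRingEnd ℂ (pderiv j (fun y => v y i) x) * (rHat θ φ j : ℂ))) := by
      simp only [hcc, Fin.sum_univ_three]; ring
    simp only [frameDeriv, map_mul, map_sum, Complex.conj_ofReal, angF, map_sub]
    simp only [Fin.sum_univ_three, Fin.isValue] at h4 h5 ⊢
    simp only [zero_add, Fin.reduceAdd, Fin.isValue]
    linear_combination (r : ℂ) ^ 2 * h4 + h5 + (pderiv 0 (fun y => u y i) x *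
      starRingEnd ℂ (pderiv 0 (fun y => v y i) x) + pderiv 1 (fun y => u y i) x *
      starRingEnd ℂ (pderiv 1 (fun y => v y i) x) + pderiv 2 (fun y => u y i) x *
      starRingEnd ℂ (pderiv 2 (fun y => v y i) x)) * hn
  rw [← Finset.sum_congr rfl fun i _ => h3 i, Finset.sum_add_distrib, ← h1, ← h2]
  exact contract_two_rows _ _ _ _ _ _ _ _ _ _ _ _

lemma ae_coord_ne_zero : ∀ᵐ x : E3, x 0 ≠ 0 := by
  have h := Measure.addHaar_submodule (volume : Measure E3)
    (LinearMap.ker (EuclideanSpace.proj (𝕜 := ℝ) (0 : Fin 3)).toLinearMap) ?_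
  · rw [ae_iff]
    convert h using 2
    ext x
    simp
  · intro h
    have : (EuclideanSpace.single (0 : Fin 3) (1 : ℝ) : E3) ∈ (⊤ : Submodule ℝ E3) := trivial
    rw [← h] at this
    simp at this

/-! ### Recurrences and growth of the spherical Bessel functions -/

lemma continuous_bphi (l : ℕ) : Continuous (bphi l) :=
  continuous_iff_continuousAt.2 fun s => (hasDerivAt_bphi l s).continuousAt

lemma continuous_sphBessel (l : ℕ) : Continuous (sphBessel l) := by
  have : sphBessel l = fun z => z ^ l * bphi l (z ^ 2) := funext fun z => sphBessel_eq l z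
  rw [this]
  exact (continuous_pow l).mul ((continuous_bphi l).comp (continuous_pow 2))

lemma continuous_bes (l : ℕ) (k : ℝ) : Continuous (bes l k) := by
  unfold bes
  exact continuous_const.mul ((continuous_bphi l).comp (continuous_const.mul (continuous_pow 2)))

lemma sphBessel_rec (l : ℕ) (r : ℝ) :
    (2 * l + 3) * sphBessel (l + 1) r = r * (sphBessel l r + sphBessel (l + 2) r) := by
  simp only [sphBessel_eq]
  rw [bphi_rec l]
  ring

lemma hasDerivAt_sphBessel (l : ℕ) {r : ℝ} (hr : r ≠ 0) :
    HasDerivAt (sphBessel l) (l * sphBessel l r / r - sphBessel (l + 1) r) r := by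
  have : sphBessel l = fun z => z ^ l * bphi l (z ^ 2) := funext fun z => sphBessel_eq l z
  have h := (hasDerivAt_pow l r).fun_mul ((hasDerivAt_bphi l (r ^ 2)).comp r (hasDerivAt_pow 2 r))
  rw [this]
  refine h.congr_deriv ?_
  simp only [sphBessel_eq, Function.comp]
  obtain _ | l := l
  · simp; ring
  · rw [Nat.add_sub_cancel]
    field_simp
    push_cast
    ring

lemma hasDerivAt_sphBessel_succ (l : ℕ) {r : ℝ} (hr : r ≠ 0) :
    HasDerivAt (sphBessel (l + 1)) (sphBessel l r - (l + 2) * sphBessel (l + 1) r / r) r := by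
  refine (hasDerivAt_sphBessel (l + 1) hr).congr_deriv ?_
  have := sphBessel_rec l r
  field_simp
  push_cast
  linear_combination this

lemma mul_sphBessel_zero (r : ℝ) : r * sphBessel 0 r = Real.sin r := by
  have h := Real.hasSum_sin r
  rw [← h.tsum_eq, sphBessel_eq, bphi, pow_zero, one_mul, ← tsum_mul_left]
  refine tsum_congr fun n => ?_
  have h1 : ((2 * n + 1).factorial : ℝ) =
      (2 * n + 1).doubleFactorial * (2 ^ n * n.factorial) := by
    rw [Nat.factorial_eq_mul_doubleFactorial, Nat.doubleFactorial_two_mul]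
    push_cast
    ring
  have h2 : (0 : ℝ) < (2 * n + 1).doubleFactorial :=
    lt_of_lt_of_le one_pos (one_le_doubleFactorial _)
  have h3 : (n.factorial : ℝ) ≠ 0 := by exact_mod_cast n.factorial_ne_zero
  rw [h1, bcoef, Nat.mul_zero, zero_add, div_pow, neg_pow, ← pow_mul]
  field_simp
  ring

lemma mul_sphBessel_one {r : ℝ} (hr : r ≠ 0) :
    r * sphBessel 1 r = sphBessel 0 r - Real.cos r := by
  have h1 : HasDerivAt (fun r => r * sphBessel 0 r) (Real.cos r) r := by
    rw [funext mul_sphBessel_zero]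
    exact Real.hasDerivAt_sin r
  have h2 := (hasDerivAt_id r).fun_mul (hasDerivAt_sphBessel 0 hr)
  have := h1.unique h2
  simp at this
  linear_combination this

/-- The function `r j_ℓ(r)` is bounded on the half-line: by compactness for `r ≤ 1`, and by the
recurrence for `r ≥ 1`. -/
lemma abs_mul_sphBessel_le (l : ℕ) : ∃ C, ∀ r, 0 ≤ r → |r * sphBessel l r| ≤ C := by
  have hc : ∀ l, ∃ C, ∀ r, 0 ≤ r → r ≤ 1 → |r * sphBessel l r| ≤ C := by
    intro l
    obtain ⟨C, hC⟩ := (isCompact_Icc (a := (0 : ℝ)) (b := 1)).exists_bound_of_continuousOn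
      (f := fun r => r * sphBessel l r) (continuous_id.mul (continuous_sphBessel l)).continuousOn
    exact ⟨C, fun r h0 h1 => hC r ⟨h0, h1⟩⟩
  suffices h : ∀ l, (∃ C, ∀ r, 0 ≤ r → |r * sphBessel l r| ≤ C) ∧
      ∃ C, ∀ r, 0 ≤ r → |r * sphBessel (l + 1) r| ≤ C from (h l).1
  intro l
  induction l with
  | zero =>
    have h0 : ∀ r, 0 ≤ r → |r * sphBessel 0 r| ≤ 1 := fun r _ => by
      rw [mul_sphBessel_zero]; exact Real.abs_sin_le_one r
    refine ⟨⟨1, h0⟩, ?_⟩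
    obtain ⟨C, hC⟩ := hc 1
    refine ⟨max C 2, fun r hr => ?_⟩
    by_cases h1 : r ≤ 1
    · exact (hC r hr h1).trans (le_max_left _ _)
    · push Not at h1
      rw [zero_add, mul_sphBessel_one (by positivity)]
      refine le_trans ?_ (le_max_right _ _)
      have h2 : |sphBessel 0 r| ≤ 1 := by
        have := h0 r hr
        rw [abs_mul, abs_of_nonneg hr] at this
        nlinarith [abs_nonneg (sphBessel 0 r)]
      have h3 := Real.abs_cos_le_one r
      exact (abs_sub _ _).trans (by linarith)
  | succ l ih =>
    refine ⟨ih.2, ?_⟩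
    obtain ⟨⟨A, hA⟩, ⟨B, hB⟩⟩ := ih
    obtain ⟨C, hC⟩ := hc (l + 2)
    refine ⟨max C ((2 * l + 3) * B + A), fun r hr => ?_⟩
    by_cases h1 : r ≤ 1
    · exact (hC r hr h1).trans (le_max_left _ _)
    · push Not at h1
      refine le_trans ?_ (le_max_right _ _)
      have e : r * sphBessel (l + 2) r = (2 * l + 3) * sphBessel (l + 1) r - r * sphBessel l r := by
        linear_combination -sphBessel_rec l r
      have h2 : |sphBessel (l + 1) r| ≤ B := by
        have := hB r hr
        rw [abs_mul, abs_of_nonneg hr] at this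
        nlinarith [abs_nonneg (sphBessel (l + 1) r)]
      rw [show l + 1 + 1 = l + 2 from rfl, e]
      refine (abs_sub _ _).trans (add_le_add ?_ (hA r hr))
      rw [abs_mul, abs_of_nonneg (by positivity)]
      gcongr

lemma tendsto_sphBessel (l : ℕ) : Tendsto (sphBessel l) atTop (𝓝 0) := by
  obtain ⟨C, hC⟩ := abs_mul_sphBessel_le l
  refine squeeze_zero_norm' (a := fun r => C * r⁻¹) ?_ ?_
  · filter_upwards [eventually_gt_atTop 0] with r hr
    have := hC r hr.le
    rw [abs_mul, abs_of_pos hr] at this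
    rw [Real.norm_eq_abs, ← div_eq_mul_inv, le_div_iff₀ hr]
    linarith
  · simpa using tendsto_inv_atTop_zero.const_mul C

/-- The amplitude of the oscillation is `1 / r` for every order; the recurrence carries the
statement from one order to the next. -/
lemma tendsto_sphBessel_sq (l : ℕ) :
    Tendsto (fun r => (r * sphBessel l r) ^ 2 + (r * sphBessel (l + 1) r) ^ 2) atTop (𝓝 1) := by
  have hb : ∀ (l : ℕ) (f : ℝ → ℝ), Tendsto f atTop (𝓝 0) →
      Tendsto (fun r => f r * (r * sphBessel l r)) atTop (𝓝 0) := by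
    intro l f hf
    obtain ⟨C, hC⟩ := abs_mul_sphBessel_le l
    refine squeeze_zero_norm' (a := fun r => |f r| * C) ?_ ?_
    · filter_upwards [eventually_ge_atTop 0] with r hr
      rw [norm_mul, Real.norm_eq_abs, Real.norm_eq_abs]
      exact mul_le_mul_of_nonneg_left (hC r hr) (abs_nonneg _)
    · simpa using hf.abs.mul_const C
  induction l with
  | zero =>
    have h1 : Tendsto (fun r => 1 + (sphBessel 0 r * sphBessel 0 r -
        2 * sphBessel 0 r * Real.cos r)) atTop (𝓝 1) := by
      have h2 : Tendsto (fun r => 2 * sphBessel 0 r * Real.cos r) atTop (𝓝 0) := by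
        refine squeeze_zero_norm (a := fun r => 2 * |sphBessel 0 r|) (fun r => ?_) ?_
        · rw [norm_mul, norm_mul, Real.norm_eq_abs, Real.norm_eq_abs, Real.norm_eq_abs, abs_two]
          have := Real.abs_cos_le_one r
          nlinarith [abs_nonneg (sphBessel 0 r)]
        · simpa using (tendsto_sphBessel 0).abs.const_mul 2
      simpa using (((tendsto_sphBessel 0).mul (tendsto_sphBessel 0)).sub h2).const_add 1
    refine h1.congr' ?_
    filter_upwards [eventually_gt_atTop 0] with r hr
    rw [zero_add, mul_sphBessel_one hr.ne', mul_sphBessel_zero]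
    have := Real.sin_sq_add_cos_sq r
    linear_combination -this
  | succ l ih =>
    have h1 : Tendsto (fun r => ((2 * l + 3) * sphBessel (l + 1) r) * ((2 * l + 3) *
        sphBessel (l + 1) r) - (2 * (2 * l + 3) * sphBessel (l + 1) r) * (r * sphBessel l r))
        atTop (𝓝 0) := by
      have h2 : Tendsto (fun r => (2 * (l : ℝ) + 3) * sphBessel (l + 1) r) atTop (𝓝 0) := by
        simpa using (tendsto_sphBessel (l + 1)).const_mul (2 * (l : ℝ) + 3)
      have h3 : Tendsto (fun r => 2 * (2 * (l : ℝ) + 3) * sphBessel (l + 1) r) atTop (𝓝 0) := by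
        simpa using (tendsto_sphBessel (l + 1)).const_mul (2 * (2 * (l : ℝ) + 3))
      simpa using (h2.mul h2).sub (hb l _ h3)
    have h2 := ih.add h1
    rw [add_zero] at h2
    refine h2.congr fun r => ?_
    have e : r * sphBessel (l + 2) r = (2 * l + 3) * sphBessel (l + 1) r - r * sphBessel l r := by
      linear_combination -sphBessel_rec l r
    rw [show l + 1 + 1 = l + 2 from rfl, e]
    ring

/-! ### Integrals of products of spherical Bessel functions -/

lemma sphBessel_mul_eq (p q n : ℕ) (h : n ≤ p + q) (a b : ℝ) {r : ℝ} (hr : r ≠ 0) :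
    sphBessel p (a * r) * sphBessel q (b * r) / r ^ n =
      bes p a r * bes q b r * r ^ (p + q - n) := by
  obtain ⟨d, hd⟩ := Nat.exists_eq_add_of_le h
  rw [← bes_mul_pow, ← bes_mul_pow, hd, Nat.add_sub_cancel_left, div_eq_iff (pow_ne_zero n hr)]
  have : r ^ p * r ^ q = r ^ n * r ^ d := by rw [← pow_add, hd, pow_add]
  linear_combination bes p a r * bes q b r * this

lemma abs_sphBessel_mul_le (p q n : ℕ) {a b : ℝ} (ha : 0 < a) (hb : 0 < b) :
    ∃ C, 0 ≤ C ∧ ∀ r, 1 ≤ r → |sphBessel p (a * r) * sphBessel q (b * r) / r ^ n| ≤ C / r ^ 2 := by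
  obtain ⟨A, hA⟩ := abs_mul_sphBessel_le p
  obtain ⟨B, hB⟩ := abs_mul_sphBessel_le q
  have hA0 : 0 ≤ A := (abs_nonneg _).trans (hA 0 le_rfl)
  have hB0 : 0 ≤ B := (abs_nonneg _).trans (hB 0 le_rfl)
  refine ⟨A * B / (a * b), by positivity, fun r hr => ?_⟩
  have hr0 : 0 < r := by linarith
  have h1 := hA (a * r) (by positivity)
  have h2 := hB (b * r) (by positivity)
  rw [abs_mul, abs_of_pos (by positivity)] at h1 h2
  rw [abs_div, abs_mul, abs_of_pos (by positivity : 0 < r ^ n), div_div,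
    div_le_div_iff₀ (by positivity) (by positivity)]
  have h3 := mul_le_mul h1 h2 (by positivity) hA0
  have h4 : 1 ≤ r ^ n := one_le_pow₀ hr
  calc |sphBessel p (a * r)| * |sphBessel q (b * r)| * (a * b * r ^ 2)
      = (a * r * |sphBessel p (a * r)|) * (b * r * |sphBessel q (b * r)|) := by ring
    _ ≤ A * B := h3
    _ ≤ A * B * r ^ n := le_mul_of_one_le_right (by positivity) h4

lemma integrableOn_sphBessel_mul (p q n : ℕ) (h : n ≤ p + q) {a b : ℝ} (ha : 0 < a) (hb : 0 < b) :
    IntegrableOn (fun r => sphBessel p (a * r) * sphBessel q (b * r) / r ^ n) (Set.Ioi 0) := by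
  have hcont : Continuous fun r => bes p a r * bes q b r * r ^ (p + q - n) :=
    ((continuous_bes p a).mul (continuous_bes q b)).mul (continuous_pow _)
  have heq : ∀ r ∈ Set.Ioi (0 : ℝ), bes p a r * bes q b r * r ^ (p + q - n) =
      sphBessel p (a * r) * sphBessel q (b * r) / r ^ n := fun r hr =>
    (sphBessel_mul_eq p q n h a b (ne_of_gt hr)).symm
  refine IntegrableOn.congr_fun ?_ heq measurableSet_Ioi
  rw [← Set.Ioc_union_Ioi_eq_Ioi zero_le_one]
  refine IntegrableOn.union (hcont.integrableOn_Ioc) ?_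
  obtain ⟨C, hC0, hC⟩ := abs_sphBessel_mul_le p q n ha hb
  have hi : IntegrableOn (fun r : ℝ => C * r ^ (-2 : ℝ)) (Set.Ioi 1) :=
    (integrableOn_Ioi_rpow_of_lt (by norm_num) one_pos).const_mul C
  refine Integrable.mono' hi hcont.aestronglyMeasurable ?_
  refine (ae_restrict_iff' measurableSet_Ioi).2 (Eventually.of_forall fun r hr => ?_)
  have hr1 : (1 : ℝ) < r := hr
  have hr0 : 0 < r := by linarith
  rw [heq r hr0, Real.norm_eq_abs]
  refine (hC r hr1.le).trans (le_of_eq ?_)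
  rw [Real.rpow_neg hr0.le, div_eq_mul_inv]
  norm_cast

/-- The boundary terms of the integrations by parts vanish. -/
lemma integral_deriv_sphBessel_mul_eq_zero {F F' : ℝ → ℝ} {p q n : ℕ} (h : n < p + q) {a b : ℝ}
    (ha : 0 < a) (hb : 0 < b)
    (hF : ∀ r, 0 < r → F r = sphBessel p (a * r) * sphBessel q (b * r) / r ^ n)
    (hF' : ∀ r, 0 < r → HasDerivAt F (F' r) r) (hi : IntegrableOn F' (Set.Ioi 0)) :
    ∫ r in Set.Ioi (0 : ℝ), F' r = 0 := by
  set Φ : ℝ → ℝ := fun r => bes p a r * bes q b r * r ^ (p + q - n) with hΦ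
  have hcont : Continuous Φ :=
    ((continuous_bes p a).mul (continuous_bes q b)).mul (continuous_pow _)
  have heq : ∀ r, 0 < r → Φ r = F r := fun r hr => by
    rw [hF r hr, sphBessel_mul_eq p q n h.le a b hr.ne']
  have h0 : Φ 0 = 0 := by
    have : p + q - n ≠ 0 := by omega
    simp [hΦ, this]
  have hlim : Tendsto Φ atTop (𝓝 0) := by
    obtain ⟨C, hC0, hC⟩ := abs_sphBessel_mul_le p q n ha hb
    refine squeeze_zero_norm' (a := fun r => C / r ^ 2) ?_ ?_
    · filter_upwards [eventually_ge_atTop 1] with r hr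
      rw [heq r (by linarith), hF r (by linarith)]
      exact hC r hr
    · simpa using (tendsto_const_nhds (x := C)).div_atTop (tendsto_pow_atTop two_ne_zero)
  have := integral_Ioi_of_hasDerivAt_of_tendsto hcont.continuousWithinAt
    (fun r (hr : 0 < r) => (hF' r hr).congr_of_eventuallyEq ?_) hi hlim
  · rw [this, h0, sub_zero]
  · filter_upwards [lt_mem_nhds hr] with s hs using heq s hs

lemma integral_sphBessel_sq_div {l : ℕ} (hl : 1 ≤ l) :
    ∫ r in Set.Ioi (0 : ℝ), sphBessel l r * sphBessel l r / r = 1 / (2 * l * (l + 1)) := by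
  have hl0 : (l : ℝ) ≠ 0 := by positivity
  -- an energy of the radial equation, whose derivative is a multiple of `j_ℓ² / r`
  set E : ℝ → ℝ := fun r => (r * sphBessel l r) ^ 2 + (r * sphBessel (l + 1) r) ^ 2 +
    ((l + 1) * sphBessel l r ^ 2 - 2 * (l + 1) * (sphBessel l r * (r * sphBessel (l + 1) r)))
    with hE
  have hc := continuous_sphBessel l
  have hc1 := continuous_sphBessel (l + 1)
  have hcont : Continuous E := by fun_prop
  have hderiv : ∀ r ∈ Set.Ioi (0 : ℝ),
      HasDerivAt E (2 * l * (l + 1) * (sphBessel l r * sphBessel l r / r)) r := by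
    intro r hr
    have hr0 : r ≠ 0 := ne_of_gt hr
    have h1 := hasDerivAt_sphBessel l hr0
    have h2 := hasDerivAt_sphBessel_succ l hr0
    have hid := hasDerivAt_id r
    have h3 := (((hid.fun_mul h1).fun_pow 2).fun_add ((hid.fun_mul h2).fun_pow 2)).fun_add
      (((h1.fun_pow 2).const_mul ((l : ℝ) + 1)).fun_sub
        ((h1.fun_mul (hid.fun_mul h2)).const_mul (2 * ((l : ℝ) + 1))))
    refine h3.congr_deriv ?_
    simp only [id]
    field_simp
    ring
  have h0 : E 0 = 0 := by
    have : sphBessel l 0 = 0 := by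
      rw [sphBessel_eq, zero_pow (by omega), zero_mul]
    simp [hE, this]
  have hlim : Tendsto E atTop (𝓝 1) := by
    have h1 : Tendsto (fun r => (l + 1) * sphBessel l r ^ 2 -
        2 * (l + 1) * (sphBessel l r * (r * sphBessel (l + 1) r))) atTop (𝓝 0) := by
      have h2 : Tendsto (fun r => sphBessel l r * (r * sphBessel (l + 1) r)) atTop (𝓝 0) := by
        obtain ⟨C, hC⟩ := abs_mul_sphBessel_le (l + 1)
        refine squeeze_zero_norm' (a := fun r => |sphBessel l r| * C) ?_ ?_
        · filter_upwards [eventually_ge_atTop 0] with r hr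
          rw [norm_mul, Real.norm_eq_abs, Real.norm_eq_abs]
          exact mul_le_mul_of_nonneg_left (hC r hr) (abs_nonneg _)
        · simpa using (tendsto_sphBessel l).abs.mul_const C
      simpa using (((tendsto_sphBessel l).pow 2).const_mul ((l : ℝ) + 1)).sub
        (h2.const_mul (2 * ((l : ℝ) + 1)))
    simpa using (tendsto_sphBessel_sq l).add h1
  have hint : IntegrableOn (fun r => sphBessel l r * sphBessel l r / r) (Set.Ioi 0) := by
    simpa using integrableOn_sphBessel_mul l l 1 (by omega) one_pos one_pos
  have key := integral_Ioi_of_hasDerivAt_of_tendsto hcont.continuousWithinAt hderiv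
    (hint.const_mul (2 * l * (l + 1))) hlim
  rw [integral_const_mul, h0, sub_zero] at key
  rw [eq_div_iff (by positivity)]
  linear_combination key

/-! ### Moments of products of spherical Bessel functions -/

/-- The radial integral `∫₀^∞ j_p(ar) j_q(br) r⁻ⁿ dr`. -/
def besInt (a b : ℝ) (p q n : ℕ) : ℝ :=
  ∫ r in Set.Ioi (0 : ℝ), sphBessel p (a * r) * sphBessel q (b * r) / r ^ n

lemma hasDerivAt_sphBessel_comp (l : ℕ) {a r : ℝ} (ha : a ≠ 0) (hr : r ≠ 0) :
    HasDerivAt (fun r => sphBessel l (a * r))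
      (l * sphBessel l (a * r) / r - a * sphBessel (l + 1) (a * r)) r := by
  have h := (hasDerivAt_sphBessel l (mul_ne_zero ha hr)).comp r (hasDerivAt_const_mul a)
  refine h.congr_deriv ?_
  field_simp

lemma hasDerivAt_sphBessel_succ_comp (l : ℕ) {a r : ℝ} (ha : a ≠ 0) (hr : r ≠ 0) :
    HasDerivAt (fun r => sphBessel (l + 1) (a * r))
      (a * sphBessel l (a * r) - (l + 2) * sphBessel (l + 1) (a * r) / r) r := by
  have h := (hasDerivAt_sphBessel_succ l (mul_ne_zero ha hr)).comp r (hasDerivAt_const_mul a)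
  refine h.congr_deriv ?_
  field_simp

lemma besInt_self_one {a : ℝ} (ha : 0 < a) {l : ℕ} (hl : 1 ≤ l) :
    besInt a a l l 1 = 1 / (2 * l * (l + 1)) := by
  have h := integral_comp_mul_left_Ioi (fun r => sphBessel l r * sphBessel l r / r) 0 ha
  rw [mul_zero, integral_sphBessel_sq_div hl, smul_eq_mul] at h
  rw [besInt, ← mul_right_inj' (inv_ne_zero ha.ne'), ← h, ← integral_const_mul]
  refine setIntegral_congr_fun measurableSet_Ioi fun r (hr : 0 < r) => ?_
  field_simp

section
variable {a b : ℝ} (ha : 0 < a) (hb : 0 < b)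
include ha hb

/-- A formula for the derivative of `j_p(ar) j_q(br) r⁻ⁿ` gives a linear relation between radial
integrals. -/
lemma besInt_relation {p q n p₁ q₁ n₁ p₂ q₂ n₂ p₃ q₃ n₃ : ℕ} (c₁ c₂ c₃ : ℝ) (h : n < p + q)
    (h₁ : n₁ ≤ p₁ + q₁) (h₂ : n₂ ≤ p₂ + q₂) (h₃ : n₃ ≤ p₃ + q₃)
    (hd : ∀ r, 0 < r → HasDerivAt (fun r => sphBessel p (a * r) * sphBessel q (b * r) / r ^ n)
      (c₁ * (sphBessel p₁ (a * r) * sphBessel q₁ (b * r) / r ^ n₁) +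
        c₂ * (sphBessel p₂ (a * r) * sphBessel q₂ (b * r) / r ^ n₂) +
        c₃ * (sphBessel p₃ (a * r) * sphBessel q₃ (b * r) / r ^ n₃)) r) :
    c₁ * besInt a b p₁ q₁ n₁ + c₂ * besInt a b p₂ q₂ n₂ + c₃ * besInt a b p₃ q₃ n₃ = 0 := by
  have i1 := (integrableOn_sphBessel_mul p₁ q₁ n₁ h₁ ha hb).const_mul c₁
  have i2 := (integrableOn_sphBessel_mul p₂ q₂ n₂ h₂ ha hb).const_mul c₂
  have i3 := (integrableOn_sphBessel_mul p₃ q₃ n₃ h₃ ha hb).const_mul c₃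
  have key := integral_deriv_sphBessel_mul_eq_zero h ha hb (fun _ _ => rfl) hd
    (by exact (i1.add i2).add i3)
  rwa [integral_add (by exact i1.add i2) i3, integral_add i1 i2, integral_const_mul,
    integral_const_mul, integral_const_mul] at key

lemma besInt_diag_three {l : ℕ} (hl : 2 ≤ l) : (2 * l - 2) * besInt a b l l 3 =
    b * besInt a b l (l + 1) 2 + a * besInt a b (l + 1) l 2 := by
  have h := besInt_relation (p := l) (q := l) (n := 2) (p₁ := l) (q₁ := l) (n₁ := 3)
    (p₂ := l) (q₂ := l + 1) (n₂ := 2) (p₃ := l + 1) (q₃ := l) (n₃ := 2) ha hb (2 * l - 2) (-b) (-a)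
    (by omega) (by omega) (by omega) (by omega) fun r hr => ?_
  · linear_combination h
  · refine (((hasDerivAt_sphBessel_comp l ha.ne' hr.ne').fun_mul
      (hasDerivAt_sphBessel_comp l hb.ne' hr.ne')).fun_div (hasDerivAt_pow 2 r)
      (by positivity)).congr_deriv ?_
    field_simp
    push_cast
    ring

lemma besInt_diag_succ_three {l : ℕ} (hl : 1 ≤ l) : (2 * l + 6) * besInt a b (l + 1) (l + 1) 3 =
    a * besInt a b l (l + 1) 2 + b * besInt a b (l + 1) l 2 := by
  have h := besInt_relation (p := l + 1) (q := l + 1) (n := 2) (p₁ := l + 1) (q₁ := l + 1) (n₁ := 3)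
    (p₂ := l) (q₂ := l + 1) (n₂ := 2) (p₃ := l + 1) (q₃ := l) (n₃ := 2) ha hb (-(2 * l + 6)) a b
    (by omega) (by omega) (by omega) (by omega) fun r hr => ?_
  · linear_combination -h
  · refine (((hasDerivAt_sphBessel_succ_comp l ha.ne' hr.ne').fun_mul
      (hasDerivAt_sphBessel_succ_comp l hb.ne' hr.ne')).fun_div (hasDerivAt_pow 2 r)
      (by positivity)).congr_deriv ?_
    field_simp
    push_cast
    ring

/-- The combination `b j_ℓ(ar) j_{ℓ+1}(br) - a j_{ℓ+1}(ar) j_ℓ(br)` is the Wronskian of the two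
radial functions; its derivative involves only itself and their product. -/
lemma besInt_wronskian {l n : ℕ} (hn : n < 2 * l) :
    (n + 2) * (b * besInt a b l (l + 1) (n + 1) - a * besInt a b (l + 1) l (n + 1)) =
      (b ^ 2 - a ^ 2) * besInt a b l l n := by
  have h1 := besInt_relation (p := l) (q := l + 1) (n := n) (p₁ := l) (q₁ := l) (n₁ := n)
    (p₂ := l + 1) (q₂ := l + 1) (n₂ := n) (p₃ := l) (q₃ := l + 1) (n₃ := n + 1) ha hb
    b (-a) (-(n + 2)) (by omega) (by omega) (by omega) (by omega) fun r hr => ?_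
  · have h2 := besInt_relation (p := l + 1) (q := l) (n := n) (p₁ := l) (q₁ := l) (n₁ := n)
      (p₂ := l + 1) (q₂ := l + 1) (n₂ := n) (p₃ := l + 1) (q₃ := l) (n₃ := n + 1) ha hb
      a (-b) (-(n + 2)) (by omega) (by omega) (by omega) (by omega) fun r hr => ?_
    · linear_combination a * h2 - b * h1
    · refine (((hasDerivAt_sphBessel_succ_comp l ha.ne' hr.ne').fun_mul
        (hasDerivAt_sphBessel_comp l hb.ne' hr.ne')).fun_div (hasDerivAt_pow n r)
        (by positivity)).congr_deriv ?_
      obtain _ | n := n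
      · field_simp
        simp
        ring
      · rw [Nat.add_sub_cancel]
        field_simp
        push_cast
        ring
  · refine (((hasDerivAt_sphBessel_comp l ha.ne' hr.ne').fun_mul
      (hasDerivAt_sphBessel_succ_comp l hb.ne' hr.ne')).fun_div (hasDerivAt_pow n r)
      (by positivity)).congr_deriv ?_
    obtain _ | n := n
    · field_simp
      simp
      ring
    · rw [Nat.add_sub_cancel]
      field_simp
      push_cast
      ring

end

lemma besInt_self_nonneg (a : ℝ) (p n : ℕ) : 0 ≤ besInt a a p p n :=
  setIntegral_nonneg measurableSet_Ioi fun r (hr : 0 < r) => by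
    have := mul_self_nonneg (sphBessel p (a * r))
    positivity

/-- The recurrence `(2ℓ + 3) j_{ℓ+1}(z) = z (j_ℓ(z) + j_{ℓ+2}(z))` trades two powers of `r` for
two powers of `ℓ`. -/
lemma besInt_self_succ_le {a : ℝ} (ha : 0 < a) {l n : ℕ} (hn : n ≤ 2 * l) :
    besInt a a (l + 1) (l + 1) (n + 2) ≤
      2 * a ^ 2 / (2 * l + 3) ^ 2 * (besInt a a l l n + besInt a a (l + 2) (l + 2) n) := by
  have i1 := integrableOn_sphBessel_mul l l n (by omega) ha ha
  have i2 := integrableOn_sphBessel_mul (l + 2) (l + 2) n (by omega) ha ha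
  rw [besInt, besInt, besInt, ← integral_add i1 i2, ← integral_const_mul]
  refine setIntegral_mono_on (integrableOn_sphBessel_mul _ _ _ (by omega) ha ha)
    ((i1.add i2).const_mul _) measurableSet_Ioi fun r (hr : 0 < r) => ?_
  have h := sphBessel_rec l (a * r)
  have h1 : sphBessel (l + 1) (a * r) =
      a * r * (sphBessel l (a * r) + sphBessel (l + 2) (a * r)) / (2 * l + 3) := by
    rw [← h]; field_simp
  have h2 : sphBessel (l + 1) (a * r) * sphBessel (l + 1) (a * r) / r ^ (n + 2) =
      a ^ 2 / ((2 * l + 3) ^ 2 * r ^ n) *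
        (sphBessel l (a * r) + sphBessel (l + 2) (a * r)) ^ 2 := by
    rw [h1, pow_add]; field_simp
  have h3 : 2 * a ^ 2 / (2 * l + 3) ^ 2 * (sphBessel l (a * r) * sphBessel l (a * r) / r ^ n +
      sphBessel (l + 2) (a * r) * sphBessel (l + 2) (a * r) / r ^ n) =
      a ^ 2 / ((2 * l + 3) ^ 2 * r ^ n) *
        (2 * (sphBessel l (a * r) ^ 2 + sphBessel (l + 2) (a * r) ^ 2)) := by
    field_simp
  rw [h2, h3]
  refine mul_le_mul_of_nonneg_left ?_ (by positivity)
  nlinarith [sq_nonneg (sphBessel l (a * r) - sphBessel (l + 2) (a * r))]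

/-- The odd moments of `j_ℓ(ar)²` decay like the corresponding powers of `ℓ`. -/
lemma besInt_self_odd_le {a : ℝ} (ha : 0 < a) (n : ℕ) :
    ∃ C, 0 ≤ C ∧ ∀ l : ℕ, n + 1 ≤ l → besInt a a l l (2 * n + 1) ≤ C / (l : ℝ) ^ (2 * n + 2) := by
  induction n with
  | zero =>
    refine ⟨1, zero_le_one, fun l hl => ?_⟩
    have hl0 : (0 : ℝ) < l := by exact_mod_cast hl
    rw [mul_zero, zero_add, besInt_self_one ha hl]
    refine one_div_le_one_div_of_le (by positivity) ?_
    rw [zero_add]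
    nlinarith
  | succ n ih =>
    obtain ⟨C, hC, h⟩ := ih
    refine ⟨a ^ 2 * 4 ^ (n + 1) * C, by positivity, fun l hl => ?_⟩
    obtain ⟨l, rfl⟩ : ∃ l', l = l' + 1 := ⟨l - 1, by omega⟩
    have hl0 : (1 : ℝ) ≤ l := by exact_mod_cast (by omega : 1 ≤ l)
    have h1 := h l (by omega)
    have h2 := h (l + 2) (by omega)
    have h3 := besInt_self_succ_le ha (l := l) (n := 2 * n + 1) (by omega)
    have h4 : C / ((l + 2 : ℕ) : ℝ) ^ (2 * n + 2) ≤ C / (l : ℝ) ^ (2 * n + 2) := by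
      gcongr; omega
    have h5 : C / (l : ℝ) ^ (2 * n + 2) ≤
        4 ^ (n + 1) * C / ((l + 1 : ℕ) : ℝ) ^ (2 * n + 2) := by
      rw [div_le_div_iff₀ (by positivity) (by positivity)]
      have : ((l + 1 : ℕ) : ℝ) ^ (2 * n + 2) ≤ (2 * l) ^ (2 * n + 2) := by
        gcongr; push_cast; linarith
      calc C * ((l + 1 : ℕ) : ℝ) ^ (2 * n + 2) ≤ C * (2 * l) ^ (2 * n + 2) := by gcongr
        _ = 4 ^ (n + 1) * C * l ^ (2 * n + 2) := by
          rw [mul_pow, show (4 : ℝ) = 2 ^ 2 by norm_num, ← pow_mul]; ring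
    have h6 : besInt a a l l (2 * n + 1) + besInt a a (l + 2) (l + 2) (2 * n + 1) ≤
        2 * (4 ^ (n + 1) * C / ((l + 1 : ℕ) : ℝ) ^ (2 * n + 2)) := by linarith
    have h7 : 2 * a ^ 2 / (2 * (l : ℝ) + 3) ^ 2 ≤ 2 * a ^ 2 / (4 * ((l + 1 : ℕ) : ℝ) ^ 2) := by
      refine div_le_div_of_nonneg_left (by positivity) (by positivity) ?_
      push_cast
      nlinarith
    calc besInt a a (l + 1) (l + 1) (2 * (n + 1) + 1) ≤ _ := h3
      _ ≤ 2 * a ^ 2 / (4 * ((l + 1 : ℕ) : ℝ) ^ 2) *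
          (2 * (4 ^ (n + 1) * C / ((l + 1 : ℕ) : ℝ) ^ (2 * n + 2))) :=
        mul_le_mul h7 h6 (add_nonneg (besInt_self_nonneg _ _ _) (besInt_self_nonneg _ _ _))
          (by positivity)
      _ = _ := by
        rw [show 2 * (n + 1) + 2 = 2 + (2 * n + 2) by ring, pow_add _ 2 (2 * n + 2)]
        field_simp
        norm_num

/-- The fourth moment, by interpolation between the third and the fifth. -/
lemma besInt_self_four_le {a : ℝ} (ha : 0 < a) :
    ∃ C, 0 ≤ C ∧ ∀ l : ℕ, 3 ≤ l → besInt a a l l 4 ≤ C / (l : ℝ) ^ 5 := by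
  obtain ⟨A, hA, h3⟩ := besInt_self_odd_le ha 1
  obtain ⟨B, hB, h5⟩ := besInt_self_odd_le ha 2
  refine ⟨A + B, by positivity, fun l hl => ?_⟩
  have hl0 : (0 : ℝ) < l := by exact_mod_cast (by omega : 0 < l)
  have i3 := (integrableOn_sphBessel_mul l l 3 (by omega) ha ha).const_mul ((l : ℝ)⁻¹)
  have i5 := (integrableOn_sphBessel_mul l l 5 (by omega) ha ha).const_mul (l : ℝ)
  have h : besInt a a l l 4 ≤ (l : ℝ)⁻¹ * besInt a a l l 3 + l * besInt a a l l 5 := by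
    rw [besInt, besInt, besInt, ← integral_const_mul, ← integral_const_mul, ← integral_add i3 i5]
    refine setIntegral_mono_on (integrableOn_sphBessel_mul _ _ _ (by omega) ha ha) (i3.add i5)
      measurableSet_Ioi fun r (hr : 0 < r) => ?_
    have e : (l : ℝ)⁻¹ * (sphBessel l (a * r) * sphBessel l (a * r) / r ^ 3) +
        l * (sphBessel l (a * r) * sphBessel l (a * r) / r ^ 5) -
        sphBessel l (a * r) * sphBessel l (a * r) / r ^ 4 =
        (sphBessel l (a * r) ^ 2 / (l * r ^ 5)) * (r ^ 2 + l ^ 2 - l * r) := by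
      field_simp
    have : 0 ≤ (sphBessel l (a * r) ^ 2 / (l * r ^ 5)) * (r ^ 2 + l ^ 2 - l * r) :=
      mul_nonneg (by positivity) (by nlinarith [sq_nonneg ((l : ℝ) - r)])
    linarith
  have h3 := h3 l (by omega)
  have h5 := h5 l (by omega)
  calc _ ≤ _ := h
    _ ≤ (l : ℝ)⁻¹ * (A / (l : ℝ) ^ 4) + l * (B / (l : ℝ) ^ 6) := by gcongr
    _ = _ := by field_simp

lemma abs_besInt_le {a b : ℝ} (ha : 0 < a) (hb : 0 < b) {p q n : ℕ} (hp : n ≤ 2 * p)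
    (hq : n ≤ 2 * q) : |besInt a b p q n| ≤ besInt a a p p n + besInt b b q q n := by
  have i1 := integrableOn_sphBessel_mul p p n (by omega) ha ha
  have i2 := integrableOn_sphBessel_mul q q n (by omega) hb hb
  rw [besInt, besInt, besInt, ← integral_add i1 i2, ← Real.norm_eq_abs]
  refine norm_integral_le_of_norm_le (i1.add i2)
    ((ae_restrict_iff' measurableSet_Ioi).2 (Eventually.of_forall fun r (hr : 0 < r) => ?_))
  rw [Real.norm_eq_abs, abs_div, abs_of_pos (by positivity : 0 < r ^ n), ← add_div]
  gcongr
  rw [abs_le]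
  constructor <;> nlinarith [sq_nonneg (sphBessel p (a * r) + sphBessel q (b * r)),
    sq_nonneg (sphBessel p (a * r) - sphBessel q (b * r))]

/-- For different wave numbers the radial integrals gain decay, through the Wronskian. -/
lemma besInt_three_le {a b : ℝ} (ha : 0 < a) (hb : 0 < b) (hab : a ≠ b) :
    ∃ C, 0 ≤ C ∧ ∀ l : ℕ, 3 ≤ l → |besInt a b l l 3| ≤ C / (l : ℝ) ^ 5 := by
  obtain ⟨A, hA, h1⟩ := besInt_self_four_le ha
  obtain ⟨B, hB, h2⟩ := besInt_self_four_le hb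
  have hd : 0 < |b ^ 2 - a ^ 2| := by
    rw [abs_pos, sub_ne_zero, Ne, sq_eq_sq₀ hb.le ha.le]
    exact hab.symm
  refine ⟨5 * (b * (A + B) + a * (A + B)) / |b ^ 2 - a ^ 2|, by positivity, fun l hl => ?_⟩
  have hl0 : (0 : ℝ) < l := by exact_mod_cast (by omega : 0 < l)
  have hw := besInt_wronskian ha hb (l := l) (n := 3) (by omega)
  have hA' := h1 (l + 1) (by omega)
  have hB' := h2 (l + 1) (by omega)
  have hA'' : A / ((l + 1 : ℕ) : ℝ) ^ 5 ≤ A / (l : ℝ) ^ 5 := by gcongr; omega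
  have hB'' : B / ((l + 1 : ℕ) : ℝ) ^ 5 ≤ B / (l : ℝ) ^ 5 := by gcongr; omega
  have u1 : |besInt a b l (l + 1) 4| ≤ (A + B) / (l : ℝ) ^ 5 := by
    have := abs_besInt_le ha hb (p := l) (q := l + 1) (n := 4) (by omega) (by omega)
    have := h1 l hl
    rw [add_div]; linarith
  have u2 : |besInt a b (l + 1) l 4| ≤ (A + B) / (l : ℝ) ^ 5 := by
    have := abs_besInt_le ha hb (p := l + 1) (q := l) (n := 4) (by omega) (by omega)
    have := h2 l hl
    rw [add_div]; linarith
  rw [div_right_comm, le_div_iff₀ hd, ← abs_mul, mul_comm, ← hw, abs_mul]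
  calc |((3 : ℕ) : ℝ) + 2| * |b * besInt a b l (l + 1) (3 + 1) - a * besInt a b (l + 1) l (3 + 1)|
      ≤ 5 * (b * ((A + B) / (l : ℝ) ^ 5) + a * ((A + B) / (l : ℝ) ^ 5)) := by
        rw [show |((3 : ℕ) : ℝ) + 2| = 5 by norm_num]
        gcongr
        refine (abs_sub _ _).trans ?_
        rw [abs_mul, abs_mul, abs_of_pos ha, abs_of_pos hb]
        gcongr
    _ = _ := by ring

/-- The Wronskian relation is used twice: it expresses the integral through Wronskian integrals,
and these through integrals with two more powers of `1 / r`. -/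
lemma besInt_one_le {a b : ℝ} (ha : 0 < a) (hb : 0 < b) (hab : a ≠ b) :
    ∃ C, 0 ≤ C ∧ ∀ l : ℕ, 3 ≤ l → |besInt a b l l 1| ≤ C / (l : ℝ) ^ 4 := by
  obtain ⟨A, hA, h⟩ := besInt_three_le ha hb hab
  have hd : b ^ 2 - a ^ 2 ≠ 0 := by
    rw [sub_ne_zero, Ne, sq_eq_sq₀ hb.le ha.le]
    exact hab.symm
  refine ⟨3 * ((a ^ 2 + b ^ 2) * 2 * A + 2 * a * b * 4 * A) / (b ^ 2 - a ^ 2) ^ 2, by positivity,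
    fun l hl => ?_⟩
  have hl3 : (3 : ℝ) ≤ l := by exact_mod_cast hl
  have hl0 : (0 : ℝ) < l := by linarith
  have e1 := besInt_diag_three ha hb (l := l) (by omega)
  have e2 := besInt_diag_succ_three ha hb (l := l) (by omega)
  have e3 := besInt_wronskian ha hb (l := l) (n := 1) (by omega)
  have e : besInt a b l l 1 * (b ^ 2 - a ^ 2) ^ 2 =
      3 * ((a ^ 2 + b ^ 2) * ((2 * l - 2) * besInt a b l l 3) -
        2 * a * b * ((2 * l + 6) * besInt a b (l + 1) (l + 1) 3)) := by
    rw [e1, e2]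
    push_cast at e3
    linear_combination -(b ^ 2 - a ^ 2) * e3
  have u1 := h l hl
  have u2 : |besInt a b (l + 1) (l + 1) 3| ≤ A / (l : ℝ) ^ 5 :=
    (h (l + 1) (by omega)).trans (by gcongr; omega)
  have v1 : |(2 * l - 2) * besInt a b l l 3| ≤ 2 * A / (l : ℝ) ^ 4 := by
    rw [abs_mul, abs_of_nonneg (by linarith)]
    calc _ ≤ (2 * (l : ℝ)) * (A / (l : ℝ) ^ 5) := by gcongr; linarith
      _ = _ := by field_simp
  have v2 : |(2 * l + 6) * besInt a b (l + 1) (l + 1) 3| ≤ 4 * A / (l : ℝ) ^ 4 := by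
    rw [abs_mul, abs_of_nonneg (by linarith)]
    calc _ ≤ (4 * (l : ℝ)) * (A / (l : ℝ) ^ 5) := by gcongr; linarith
      _ = _ := by field_simp
  rw [div_right_comm, le_div_iff₀ (by positivity), ← abs_of_pos (by positivity :
    0 < (b ^ 2 - a ^ 2) ^ 2), ← abs_mul, e, abs_mul]
  calc _ ≤ 3 * ((a ^ 2 + b ^ 2) * (2 * A / (l : ℝ) ^ 4) + 2 * a * b * (4 * A / (l : ℝ) ^ 4)) := by
        rw [abs_of_pos three_pos]
        gcongr
        refine (abs_sub _ _).trans ?_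
        rw [abs_mul (a ^ 2 + b ^ 2), abs_mul (2 * a * b),
          abs_of_pos (by positivity : 0 < a ^ 2 + b ^ 2),
          abs_of_pos (by positivity : 0 < 2 * a * b)]
        gcongr
    _ = _ := by ring

/-! ### The weighted radial integrals -/

/-- The radial integral with the weight of the inner product. -/
def weightInt (a b : ℝ) (p : ℕ) : ℝ :=
  ∫ r in Set.Ioi (0 : ℝ), sphBessel p (a * r) * sphBessel p (b * r) *
    (r ^ 2 / Real.sqrt (1 + r ^ 2) ^ 3)

lemma sqrt_one_add_sq_pos (r : ℝ) : 0 < Real.sqrt (1 + r ^ 2) := Real.sqrt_pos.2 (by positivity)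

lemma le_sqrt_one_add_sq (r : ℝ) : r ≤ Real.sqrt (1 + r ^ 2) :=
  Real.le_sqrt_of_sq_le (by linarith)

lemma weight_le_inv {r : ℝ} (hr : 0 < r) : r ^ 2 / Real.sqrt (1 + r ^ 2) ^ 3 ≤ 1 / r := by
  rw [div_le_div_iff₀ (pow_pos (sqrt_one_add_sq_pos r) 3) hr]
  calc r ^ 2 * r = r ^ 3 := by ring
    _ ≤ 1 * Real.sqrt (1 + r ^ 2) ^ 3 := by
      rw [one_mul]; exact pow_le_pow_left₀ hr.le (le_sqrt_one_add_sq r) 3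

lemma weight_le_one (r : ℝ) : r ^ 2 / Real.sqrt (1 + r ^ 2) ^ 3 ≤ 1 := by
  have h := sqrt_one_add_sq_pos r
  rw [div_le_one (pow_pos h 3)]
  have h1 : Real.sqrt (1 + r ^ 2) ^ 2 = 1 + r ^ 2 := Real.sq_sqrt (by positivity)
  have h2 : 1 ≤ Real.sqrt (1 + r ^ 2) := Real.le_sqrt_of_sq_le (by nlinarith [sq_nonneg r])
  nlinarith [sq_nonneg r]

lemma inv_sub_weight_le {r : ℝ} (hr : 0 < r) :
    1 / r - r ^ 2 / Real.sqrt (1 + r ^ 2) ^ 3 ≤ 2 / r ^ 3 := by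
  have h := sqrt_one_add_sq_pos r
  have h1 : Real.sqrt (1 + r ^ 2) ^ 2 = 1 + r ^ 2 := Real.sq_sqrt (by positivity)
  have h2 := le_sqrt_one_add_sq r
  set s := Real.sqrt (1 + r ^ 2)
  have e : 1 / r - r ^ 2 / s ^ 3 = (s ^ 3 - r ^ 3) / (r * s ^ 3) := by field_simp
  rw [e, div_le_div_iff₀ (by positivity) (by positivity)]
  have h3 : s ^ 3 - r ^ 3 ≤ 2 * s := by
    have : s ^ 3 - r ^ 3 = s + r ^ 2 * (s - r) := by linear_combination s * h1
    have h4 : r * (s - r) ≤ 1 := by nlinarith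
    nlinarith
  calc (s ^ 3 - r ^ 3) * r ^ 3 ≤ 2 * s * r ^ 3 := by gcongr
    _ = 2 * (r * (s * r ^ 2)) := by ring
    _ ≤ 2 * (r * (s * s ^ 2)) := by gcongr
    _ = _ := by ring

lemma integrableOn_weight (p q : ℕ) {a b : ℝ} (ha : 0 < a) (hb : 0 < b) :
    IntegrableOn (fun r => sphBessel p (a * r) * sphBessel q (b * r) *
      (r ^ 2 / Real.sqrt (1 + r ^ 2) ^ 3)) (Set.Ioi 0) := by
  have h := integrableOn_sphBessel_mul p q 0 (Nat.zero_le _) ha hb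
  simp only [pow_zero, div_one] at h
  refine Integrable.mul_bdd (c := 1) h ?_ (Eventually.of_forall fun r => ?_)
  · refine Continuous.aestronglyMeasurable (Continuous.div (by fun_prop) (by fun_prop) fun r => ?_)
    exact (pow_pos (sqrt_one_add_sq_pos r) 3).ne'
  · rw [Real.norm_of_nonneg (by positivity)]
    exact weight_le_one r

lemma weightInt_self_nonneg (a : ℝ) (p : ℕ) : 0 ≤ weightInt a a p :=
  setIntegral_nonneg measurableSet_Ioi fun r _ => mul_nonneg (mul_self_nonneg _) (by positivity)

lemma weightInt_self_le {a : ℝ} (ha : 0 < a) {p : ℕ} (hp : 1 ≤ p) :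
    weightInt a a p ≤ 1 / (2 * p * (p + 1)) := by
  rw [← besInt_self_one ha hp]
  refine setIntegral_mono_on (integrableOn_weight _ _ ha ha)
    (integrableOn_sphBessel_mul _ _ _ (by omega) ha ha) measurableSet_Ioi fun r (hr : 0 < r) => ?_
  rw [pow_one, div_eq_mul_one_div (_ * _) r]
  exact mul_le_mul_of_nonneg_left (weight_le_inv hr) (mul_self_nonneg _)

lemma abs_weightInt_sub_le {a b : ℝ} (ha : 0 < a) (hb : 0 < b) {p : ℕ} (hp : 2 ≤ p) :
    |weightInt a b p - besInt a b p p 1| ≤ 2 * (besInt a a p p 3 + besInt b b p p 3) := by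
  have i0 := integrableOn_weight p p ha hb
  have i1 := integrableOn_sphBessel_mul p p 1 (by omega) ha hb
  have i3 := integrableOn_sphBessel_mul p p 3 (by omega) ha ha
  have i4 := integrableOn_sphBessel_mul p p 3 (by omega) hb hb
  rw [weightInt, besInt, besInt, besInt, ← integral_sub i0 i1, ← integral_add i3 i4,
    ← integral_const_mul, ← Real.norm_eq_abs]
  refine norm_integral_le_of_norm_le ((i3.add i4).const_mul 2)
    ((ae_restrict_iff' measurableSet_Ioi).2 (Eventually.of_forall fun r (hr : 0 < r) => ?_))
  have e : sphBessel p (a * r) * sphBessel p (b * r) * (r ^ 2 / Real.sqrt (1 + r ^ 2) ^ 3) -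
      sphBessel p (a * r) * sphBessel p (b * r) / r ^ 1 = -(sphBessel p (a * r) *
        sphBessel p (b * r) * (1 / r - r ^ 2 / Real.sqrt (1 + r ^ 2) ^ 3)) := by
    rw [pow_one]; ring
  rw [e, norm_neg, norm_mul, Real.norm_eq_abs,
    Real.norm_of_nonneg (sub_nonneg.2 (weight_le_inv hr))]
  calc _ ≤ (sphBessel p (a * r) ^ 2 + sphBessel p (b * r) ^ 2) * (2 / r ^ 3) := by
        refine mul_le_mul ?_ (inv_sub_weight_le hr) (sub_nonneg.2 (weight_le_inv hr))
          (by positivity)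
        rw [abs_le]
        constructor <;> nlinarith [sq_nonneg (sphBessel p (a * r) + sphBessel p (b * r)),
          sq_nonneg (sphBessel p (a * r) - sphBessel p (b * r))]
    _ = _ := by ring

/-- The leading behaviour of the weighted radial integrals; `κ` is `1 / 2` for equal wave numbers
and `0` otherwise. -/
lemma weightInt_asymptotics {a b : ℝ} (ha : 0 < a) (hb : 0 < b) :
    ∃ κ C : ℝ, 0 ≤ C ∧ ∀ p : ℕ, 3 ≤ p →
      |weightInt a b p - κ / (p * (p + 1))| ≤ C / (p : ℝ) ^ 4 := by
  obtain ⟨A, hA, h1⟩ := besInt_self_odd_le ha 1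
  obtain ⟨B, hB, h2⟩ := besInt_self_odd_le hb 1
  have hAB : ∀ p : ℕ, 3 ≤ p →
      |weightInt a b p - besInt a b p p 1| ≤ 2 * (A + B) / (p : ℝ) ^ 4 := by
    intro p hp
    have h := abs_weightInt_sub_le ha hb (p := p) (by omega)
    have := h1 p (by omega)
    have := h2 p (by omega)
    rw [mul_div_assoc, add_div]
    linarith
  by_cases hab : a = b
  · subst hab
    refine ⟨1 / 2, 2 * (A + B), by positivity, fun p hp => ?_⟩
    have := hAB p hp
    rw [besInt_self_one ha (by omega)] at this
    convert this using 3
    rw [div_div, mul_assoc]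
  · obtain ⟨D, hD, h⟩ := besInt_one_le ha hb hab
    refine ⟨0, 2 * (A + B) + D, by positivity, fun p hp => ?_⟩
    have h3 := hAB p hp
    have h4 := h p hp
    rw [zero_div, sub_zero, add_div]
    have := abs_sub_abs_le_abs_sub (weightInt a b p) (besInt a b p p 1)
    linarith

/-! ### Additivity of the inner product and its value on vector solid harmonics -/

/-- The field has differentiable Cartesian components. -/
def DiffField (u : VField) : Prop := ∀ i, Differentiable ℝ fun y => u y i

lemma DiffField.add {u v : VField} (hu : DiffField u) (hv : DiffField v) : DiffField (u + v) :=
  fun i => (hu i).add (hv i)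

lemma diffField_besField (p : ℕ) (k : ℝ) (A : Fin 3 → Poly) : DiffField (besField p k A) :=
  fun i => differentiable_bes_mul p k (A i)

/-- The integrand of the inner product in Cartesian terms. -/
def cartDensity (u v : VField) (x : E3) : ℂ :=
  ((∑ i, u x i * starRingEnd ℂ (v x i)) +
      ∑ i, ∑ a, angF a (fun y => u y i) x * starRingEnd ℂ (angF a (fun y => v y i) x)) /
    ((Real.sqrt (1 + ‖x‖ ^ 2) ^ 3 : ℝ) : ℂ)

lemma hDensity_ae_eq {u v : VField} (hu : DiffField u) (hv : DiffField v) :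
    hDensity u v =ᵐ[volume] cartDensity u v := by
  filter_upwards [ae_coord_ne_zero] with x hx
  rw [hDensity, cartDensity, sphGrad_contract u v hx (fun i => hu i x) fun i => hv i x]

lemma angF_add (a : Fin 3) {f g : E3 → ℂ} {x : E3} (hf : DifferentiableAt ℝ f x)
    (hg : DifferentiableAt ℝ g x) :
    angF a (fun y => f y + g y) x = angF a f x + angF a g x := by
  simp only [angF, pderiv, fderiv_fun_add hf hg, add_apply]
  ring

/-- The inner product `⟨u, v⟩` converges absolutely and has the value `c`. -/
def HasHInner (u v : VField) (c : ℂ) : Prop := HIntegrable u v ∧ hInner u v = c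

lemma hasHInner_iff {u v : VField} (hu : DiffField u) (hv : DiffField v) (c : ℂ) :
    HasHInner u v c ↔ Integrable (cartDensity u v) ∧ ∫ x, cartDensity u v x = c := by
  rw [HasHInner, HIntegrable, hInner, integrable_congr (hDensity_ae_eq hu hv),
    integral_congr_ae (hDensity_ae_eq hu hv)]

lemma HasHInner.add_left {u u' v : VField} {c c' : ℂ} (hu : DiffField u) (hu' : DiffField u')
    (hv : DiffField v) (h : HasHInner u v c) (h' : HasHInner u' v c') :
    HasHInner (u + u') v (c + c') := by
  rw [hasHInner_iff hu hv] at h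
  rw [hasHInner_iff hu' hv] at h'
  rw [hasHInner_iff (hu.add hu') hv]
  have e : cartDensity (u + u') v = fun x => cartDensity u v x + cartDensity u' v x := by
    funext x
    simp only [cartDensity, Pi.add_apply, angF_add _ (hu _ x) (hu' _ x), add_mul,
      Finset.sum_add_distrib]
    ring
  rw [e]
  exact ⟨h.1.add h'.1, by rw [integral_add h.1 h'.1, h.2, h'.2]⟩

lemma HasHInner.add_right {u v v' : VField} {c c' : ℂ} (hu : DiffField u) (hv : DiffField v)
    (hv' : DiffField v') (h : HasHInner u v c) (h' : HasHInner u v' c') :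
    HasHInner u (v + v') (c + c') := by
  rw [hasHInner_iff hu hv] at h
  rw [hasHInner_iff hu hv'] at h'
  rw [hasHInner_iff hu (hv.add hv')]
  have e : cartDensity u (v + v') = fun x => cartDensity u v x + cartDensity u v' x := by
    funext x
    simp only [cartDensity, Pi.add_apply, angF_add _ (hv _ x) (hv' _ x), map_add, mul_add,
      Finset.sum_add_distrib]
    ring
  rw [e]
  exact ⟨h.1.add h'.1, by rw [integral_add h.1 h'.1, h.2, h'.2]⟩

lemma angF_bes_mul (l : ℕ) (k : ℝ) (P : Poly) (a : Fin 3) (x : E3) :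
    angF a (fun y : E3 => (bes l k ‖y‖ : ℂ) * ev P y) x = (bes l k ‖x‖ : ℂ) * ev (ang a P) x := by
  have e : ev (ang a P) x = x (a + 1) * ev (dd (a + 2) P) x - x (a + 2) * ev (dd (a + 1) P) x := by
    change ev (xx (a + 1) * dd (a + 2) P - xx (a + 2) * dd (a + 1) P) x = _
    simp only [ev_sub, ev_mul, ev_X]
  rw [angF, pderiv_bes_mul, pderiv_bes_mul, e]
  ring

/-- The polynomial factor of the integrand for two fields with polynomial angular parts. -/
def energyP (A B : Fin 3 → Poly) : Poly :=
  ∑ i, (A i * conjP (B i) + ∑ a, ang a (A i) * ang a (conjP (B i)))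

section pieces
variable {p q : ℕ} {A B : Fin 3 → Poly} (hA : ∀ i, IsSolid p (A i)) (hB : ∀ i, IsSolid q (B i))
include hA hB

lemma isHomogeneous_energyP : (energyP A B).IsHomogeneous (p + q) :=
  MvPolynomial.IsHomogeneous.sum _ _ _ fun i _ => ((hA i).hom.mul (hB i).conj.hom).add
    (MvPolynomial.IsHomogeneous.sum _ _ _ fun a _ =>
      (isHomogeneous_ang (hA i).hom a).mul (isHomogeneous_ang (hB i).conj.hom a))

lemma sphInt_energyP : sphInt (energyP A B) = if p = q then
    (1 + p * (p + 1)) * sphInt (dotP A fun i => conjP (B i)) else 0 := by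
  have h : ∀ i, sphInt (A i * conjP (B i) + ∑ a, ang a (A i) * ang a (conjP (B i))) =
      (1 + q * (q + 1)) * sphInt (A i * conjP (B i)) := fun i => by
    rw [sphInt_add, sphInt_sum_ang (hA i).hom (hB i).conj]
    ring
  rw [energyP, sphInt_sum, Finset.sum_congr rfl fun i _ => h i]
  split_ifs with e
  · rw [← Finset.mul_sum, dotP, sphInt_sum, e]
  · exact Finset.sum_eq_zero fun i _ => by
      rw [sphInt_mul_eq_zero (hA i) (hB i).conj e, mul_zero]

lemma hasHInner_besField {k k' : ℝ} (hk : 0 < k) (hk' : 0 < k') :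
    HasHInner (besField p k A) (besField q k' B) (if p = q then
      (1 + p * (p + 1)) * sphInt (dotP A fun i => conjP (B i)) * weightInt k k' p else 0) := by
  rw [hasHInner_iff (diffField_besField p k A) (diffField_besField q k' B)]
  set ρ : ℝ → ℂ := fun r => ((bes p k r * bes q k' r / Real.sqrt (1 + r ^ 2) ^ 3 : ℝ) : ℂ) with hρ
  have e : cartDensity (besField p k A) (besField q k' B) =
      fun x => ρ ‖x‖ * ev (energyP A B) x := by
    funext x
    simp only [cartDensity, besField, angF_bes_mul, energyP, ev_add, ev_mul, ev_conjP,
      ang_conjP, map_mul, Complex.conj_ofReal, hρ, Fin.sum_univ_three]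
    push_cast
    ring
  have hr : ∀ r : ℝ, ρ r * (r : ℂ) ^ (p + q + 2) = ((sphBessel p (k * r) * sphBessel q (k' * r) *
      (r ^ 2 / Real.sqrt (1 + r ^ 2) ^ 3) : ℝ) : ℂ) := fun r => by
    rw [hρ, ← bes_mul_pow, ← bes_mul_pow]
    push_cast
    ring
  have hh := isHomogeneous_energyP hA hB
  rw [e]
  constructor
  · refine integrable_radial_mul_ev hh ?_
    simp only [hr]
    exact (integrableOn_weight p q hk hk').ofReal
  · rw [integral_radial_mul_ev hh ρ, sphInt_energyP hA hB]
    split_ifs with h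
    · subst h
      simp only [hr]
      rw [integral_complex_ofReal, weightInt]
    · rw [zero_mul]

end pieces

lemma conjP_gradP (H : Poly) (i : Fin 3) : conjP (gradP H i) = gradP (conjP H) i :=
  (dd_conjP i H).symm

lemma conjP_posP (l : ℕ) (H : Poly) (i : Fin 3) : conjP (posP l H i) = posP l (conjP H) i := by
  rw [posP, posP, dd_conjP]
  simp only [conjP, radSq, map_sub, map_mul, map_add, map_pow, MvPolynomial.map_X,
    MvPolynomial.map_C, map_div₀, map_one, map_natCast, map_ofNat]

lemma conjP_torP (H : Poly) (i : Fin 3) : conjP (torP H i) = torP (conjP H) i := by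
  rw [torP, torP, ang_conjP]
  simp [conjP]

lemma dotP_C_mul (c d : ℝ) (A B : Fin 3 → Poly) :
    sphInt (dotP (fun i => MvPolynomial.C (c : ℂ) * A i)
      fun i => conjP (MvPolynomial.C (d : ℂ) * B i)) =
    c * d * sphInt (dotP A fun i => conjP (B i)) := by
  have : dotP (fun i => MvPolynomial.C (c : ℂ) * A i)
      (fun i => conjP (MvPolynomial.C (d : ℂ) * B i)) =
      MvPolynomial.C ((c : ℂ) * d) * dotP A fun i => conjP (B i) := by
    simp only [dotP, conjP_mul, conjP_C, Complex.conj_ofReal, Finset.mul_sum, map_mul]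
    exact Finset.sum_congr rfl fun i _ => by ring
  rw [this, sphInt_C_mul]

/-- The field with components of degrees `ℓ - 1` and `ℓ + 1` (the spheroidal fields `L` and `N`). -/
def spheroidal (l : ℕ) (k α β : ℝ) (H : Poly) : VField :=
  besField (l - 1) k (fun i => MvPolynomial.C (α : ℂ) * gradP H i) +
    besField (l + 1) k (fun i => MvPolynomial.C (β : ℂ) * posP l H i)

/-- The product of the radial integral of order `p` with the energy `1 + p (p + 1)` of the unit
sphere. -/
def energyInt (a b : ℝ) (p : ℕ) : ℝ := (1 + p * (p + 1)) * weightInt a b p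

section inner
variable {l l' : ℕ} {H H' : Poly} (h : IsSolid l H) (h' : IsSolid l' H') {k k' : ℝ} (hk : 0 < k)
  (hk' : 0 < k')
include h h' hk hk'

lemma hasHInner_spheroidal (α β α' β' : ℝ) :
    HasHInner (spheroidal l k α β H) (spheroidal l' k' α' β' H')
      (sphInt (H * conjP H') * ((α * α' * (l * (2 * l + 1)) * energyInt k k' (l - 1) +
        β * β' * ((l + 1) / (2 * l + 1)) * energyInt k k' (l + 1) : ℝ) : ℂ)) := by
  have d := diffField_besField
  have s1 := fun i => (isSolid_dd h i).C_mul α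
  have s2 := fun i => (isSolid_posP h i).C_mul β
  have t1 := fun i => (isSolid_dd h' i).C_mul α'
  have t2 := fun i => (isSolid_posP h' i).C_mul β'
  have key := ((hasHInner_besField s1 t1 hk hk').add_right (d _ _ _) (d _ _ _) (d _ _ _)
      (hasHInner_besField s1 t2 hk hk')).add_left (d _ _ _) (d _ _ _) ((d _ _ _).add (d _ _ _))
    ((hasHInner_besField s2 t1 hk hk').add_right (d _ _ _) (d _ _ _) (d _ _ _)
      (hasHInner_besField s2 t2 hk hk'))
  have g1 := sphInt_grad_grad h h'.conj
  have g2 := sphInt_grad_pos h h'.conj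
  have g3 := sphInt_grad_pos h'.conj h
  have g4 := sphInt_pos_pos h h'.conj
  rw [dotP_comm] at g3
  refine cast (congrArg _ ?_) key
  change (if _ then (_ : ℂ) * sphInt (dotP (fun i => MvPolynomial.C (α : ℂ) * gradP H i) fun i =>
      conjP (MvPolynomial.C (α' : ℂ) * gradP H' i)) * _ else 0) +
    (if _ then (_ : ℂ) * sphInt (dotP (fun i => MvPolynomial.C (α : ℂ) * gradP H i) fun i =>
      conjP (MvPolynomial.C (β' : ℂ) * posP l' H' i)) * _ else 0) +
    ((if _ then (_ : ℂ) * sphInt (dotP (fun i => MvPolynomial.C (β : ℂ) * posP l H i) fun i =>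
      conjP (MvPolynomial.C (α' : ℂ) * gradP H' i)) * _ else 0) +
    (if _ then (_ : ℂ) * sphInt (dotP (fun i => MvPolynomial.C (β : ℂ) * posP l H i) fun i =>
      conjP (MvPolynomial.C (β' : ℂ) * posP l' H' i)) * _ else 0)) = _
  simp only [dotP_C_mul, conjP_gradP, conjP_posP]
  change (if _ then _ * (_ * sphInt (dotP (gradP H) (gradP (conjP H')))) * _ else 0) +
    (if _ then _ * (_ * sphInt (dotP (gradP H) (posP l' (conjP H')))) * _ else 0) +
    ((if _ then _ * (_ * sphInt (dotP (posP l H) (gradP (conjP H')))) * _ else 0) +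
    (if _ then _ * (_ * sphInt (dotP (posP l H) (posP l' (conjP H')))) * _ else 0)) = _
  rw [g1, g2, g3, g4]
  by_cases e : l = l'
  · subst e
    simp only [if_true, mul_zero, zero_mul, ite_self, energyInt]
    push_cast
    ring
  · rw [sphInt_mul_eq_zero h h'.conj e]
    simp

lemma hasHInner_tor_tor : HasHInner (besField l k (torP H)) (besField l' k' (torP H'))
    (sphInt (H * conjP H') * ((l * (l + 1) * energyInt k k' l : ℝ) : ℂ)) := by
  have key := hasHInner_besField (isSolid_torP h) (isSolid_torP h') hk hk'
  have g := sphInt_tor_tor h h'.conj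
  refine cast (congrArg _ ?_) key
  simp only [conjP_torP]
  change (if _ then _ * sphInt (dotP (torP H) (torP (conjP H'))) * _ else 0) = _
  rw [g]
  by_cases e : l = l'
  · subst e
    simp only [if_true, energyInt]
    push_cast
    ring
  · rw [sphInt_mul_eq_zero h h'.conj e]
    simp

lemma hasHInner_spheroidal_tor (α β : ℝ) :
    HasHInner (spheroidal l k α β H) (besField l' k' (torP H')) 0 := by
  have d := diffField_besField
  have s1 := fun i => (isSolid_dd h i).C_mul α
  have s2 := fun i => (isSolid_posP h i).C_mul β
  have key := (hasHInner_besField s1 (isSolid_torP h') hk hk').add_left (d _ _ _) (d _ _ _)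
    (d _ _ _) (hasHInner_besField s2 (isSolid_torP h') hk hk')
  have g1 := sphInt_grad_tor h h'.conj
  have g2 := sphInt_pos_tor h h'.conj
  refine cast (congrArg _ ?_) key
  have e : ∀ (c : ℝ) (A : Fin 3 → Poly), sphInt (dotP A (torP (conjP H'))) = 0 →
      sphInt (dotP (fun i => MvPolynomial.C (c : ℂ) * A i) fun i => conjP (torP H' i)) = 0 := by
    intro c A hz
    have := dotP_C_mul c 1 A (torP H')
    simp only [Complex.ofReal_one, map_one, one_mul, conjP_torP] at this ⊢
    rw [this]
    exact mul_eq_zero_of_right _ hz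
  have e1 := e α _ g1
  have e2 := e β _ g2
  simp only [gradP] at e1
  rw [e1, e2]
  simp

lemma hasHInner_tor_spheroidal (α β : ℝ) :
    HasHInner (besField l k (torP H)) (spheroidal l' k' α β H') 0 := by
  have key := hasHInner_spheroidal_tor h' h hk' hk α β
  have d1 : DiffField (spheroidal l' k' α β H') :=
    (diffField_besField _ _ _).add (diffField_besField _ _ _)
  have d2 := diffField_besField l k (torP H)
  rw [hasHInner_iff d1 d2] at key
  rw [hasHInner_iff d2 d1]
  have e : cartDensity (besField l k (torP H)) (spheroidal l' k' α β H') = fun x =>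
      starRingEnd ℂ (cartDensity (spheroidal l' k' α β H') (besField l k (torP H)) x) := by
    funext x
    simp only [cartDensity, map_div₀, map_add, map_sum, map_mul, Complex.conj_conj,
      Complex.conj_ofReal, mul_comm]
  rw [e]
  exact ⟨(Complex.conjLIE.integrable_comp_iff).2 key.1, by rw [integral_conj, key.2, map_zero]⟩

end inner

section
variable {l : ℕ} {m : ℤ} (hm : m ∈ Set.Icc (-(l : ℤ)) l) (k : ℝ)
include hm

lemma hansenL_eq_spheroidal : hansenL k l m =
    spheroidal l k (k / (2 * l + 1)) (-k) (harmP l m) := by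
  rw [hansenL_eq k hm, spheroidal]
  push_cast
  rfl

lemma hansenN_eq_spheroidal : hansenN k l m =
    spheroidal l k (k * (l + 1) / (2 * l + 1)) (k * l) (harmP l m) := by
  rw [hansenN_eq k hm, spheroidal]
  push_cast
  rfl

end

/-! ### Bounds for the weighted radial integrals -/

lemma energyInt_self_nonneg (a : ℝ) (p : ℕ) : 0 ≤ energyInt a a p :=
  mul_nonneg (by positivity) (weightInt_self_nonneg a p)

lemma energyInt_self_le_one {a : ℝ} (ha : 0 < a) {p : ℕ} (hp : 1 ≤ p) : energyInt a a p ≤ 1 := by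
  have hp1 : (1 : ℝ) ≤ p := by exact_mod_cast hp
  have h := weightInt_self_le ha hp
  calc energyInt a a p ≤ (1 + p * (p + 1)) * (1 / (2 * p * (p + 1))) := by
        rw [energyInt]; gcongr
    _ ≤ 1 := by
        rw [mul_one_div, div_le_one (by positivity)]
        nlinarith

lemma energyInt_sub_le {a b : ℝ} (ha : 0 < a) (hb : 0 < b) :
    ∃ κ D : ℝ, 0 ≤ D ∧ ∀ p : ℕ, 3 ≤ p → |energyInt a b p - κ| ≤ D / (p : ℝ) ^ 2 := by
  obtain ⟨κ, C, hC, h⟩ := weightInt_asymptotics ha hb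
  refine ⟨κ, |κ| + 3 * C, by positivity, fun p hp => ?_⟩
  have hp3 : (3 : ℝ) ≤ p := by exact_mod_cast hp
  have hp0 : (0 : ℝ) < p := by linarith
  have e : energyInt a b p - κ = κ / (p * (p + 1)) +
      (1 + p * (p + 1)) * (weightInt a b p - κ / (p * (p + 1))) := by
    rw [energyInt]
    field_simp
    ring
  rw [e, add_div]
  refine (abs_add_le _ _).trans (add_le_add ?_ ?_)
  · rw [abs_div, abs_of_pos (by positivity : (0 : ℝ) < p * (p + 1))]
    gcongr
    nlinarith
  · rw [abs_mul, abs_of_pos (by positivity : (0 : ℝ) < 1 + p * (p + 1))]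
    calc _ ≤ (3 * (p : ℝ) ^ 2) * (C / (p : ℝ) ^ 4) := by
          gcongr
          · nlinarith
          · exact h p hp
      _ = _ := by field_simp

/-- The leading terms of the two orders cancel. -/
lemma abs_energyInt_sub_le {a b : ℝ} (ha : 0 < a) (hb : 0 < b) :
    ∃ D : ℝ, 0 ≤ D ∧ ∀ l : ℕ, 4 ≤ l →
      |energyInt a b (l - 1) - energyInt a b (l + 1)| ≤ D / (l : ℝ) ^ 2 := by
  obtain ⟨κ, D, hD, h⟩ := energyInt_sub_le ha hb
  refine ⟨5 * D, by positivity, fun l hl => ?_⟩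
  obtain ⟨p, rfl⟩ : ∃ p, l = p + 1 := ⟨l - 1, by omega⟩
  have hp : (3 : ℝ) ≤ p := by exact_mod_cast (by omega : 3 ≤ p)
  have h1 := h p (by omega)
  have h2 := h (p + 2) (by omega)
  have h3 : D / (p : ℝ) ^ 2 ≤ 4 * D / ((p + 1 : ℕ) : ℝ) ^ 2 := by
    rw [div_le_div_iff₀ (by positivity) (by positivity)]
    push_cast
    have : ((p : ℝ) + 1) ^ 2 ≤ 4 * p ^ 2 := by nlinarith
    nlinarith
  have h4 : D / ((p + 2 : ℕ) : ℝ) ^ 2 ≤ D / ((p + 1 : ℕ) : ℝ) ^ 2 := by gcongr; omega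
  rw [Nat.add_sub_cancel, show p + 1 + 1 = p + 2 from rfl]
  have e : energyInt a b p - energyInt a b (p + 2) =
      (energyInt a b p - κ) - (energyInt a b (p + 2) - κ) := by ring
  rw [e, show 5 * D / ((p + 1 : ℕ) : ℝ) ^ 2 =
    4 * D / ((p + 1 : ℕ) : ℝ) ^ 2 + D / ((p + 1 : ℕ) : ℝ) ^ 2 by ring]
  exact (abs_sub _ _).trans (by linarith)

end

end NavierHansen

theorem proposition2p1 (kp ks : ℝ) (hkp : 0 < kp) (hks : 0 < ks) :
    -- all the inner products are absolutely convergent integrals,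
    -- and the orthogonality relations hold
    (∀ (ℓ ℓ' : ℕ) (m m' : ℤ), m ∈ Set.Icc (-(ℓ : ℤ)) ℓ → m' ∈ Set.Icc (-(ℓ' : ℤ)) ℓ' →
      HIntegrable (hansenL kp ℓ m) (hansenL kp ℓ' m') ∧
      HIntegrable (hansenM ks ℓ m) (hansenM ks ℓ' m') ∧
      HIntegrable (hansenN ks ℓ m) (hansenN ks ℓ' m') ∧
      HIntegrable (hansenL kp ℓ m) (hansenM ks ℓ' m') ∧
      HIntegrable (hansenM ks ℓ m) (hansenN ks ℓ' m') ∧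
      HIntegrable (hansenL kp ℓ m) (hansenN ks ℓ' m') ∧
      ((ℓ, m) ≠ (ℓ', m') →
        hInner (hansenL kp ℓ m) (hansenL kp ℓ' m') = 0 ∧
        hInner (hansenM ks ℓ m) (hansenM ks ℓ' m') = 0 ∧
        hInner (hansenN ks ℓ m) (hansenN ks ℓ' m') = 0 ∧
        hInner (hansenL kp ℓ m) (hansenN ks ℓ' m') = 0) ∧
      hInner (hansenL kp ℓ m) (hansenM ks ℓ' m') = 0 ∧
      hInner (hansenM ks ℓ m) (hansenN ks ℓ' m') = 0) ∧
    -- the asymptotics as `ℓ → ∞`, uniformly in `m`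
    (∃ C : ℝ, ∀ᶠ ℓ : ℕ in atTop, ∀ m ∈ Set.Icc (-(ℓ : ℤ)) ℓ,
      ‖hInner (hansenL kp ℓ m) (hansenL kp ℓ m)‖ ≤ C) ∧
    (∃ C : ℝ, ∀ᶠ ℓ : ℕ in atTop, ∀ m ∈ Set.Icc (-(ℓ : ℤ)) ℓ,
      ‖hInner (hansenM ks ℓ m) (hansenM ks ℓ m)‖ ≤ C * (ℓ : ℝ) ^ 2) ∧
    (∃ C : ℝ, ∀ᶠ ℓ : ℕ in atTop, ∀ m ∈ Set.Icc (-(ℓ : ℤ)) ℓ,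
      ‖hInner (hansenN ks ℓ m) (hansenN ks ℓ m)‖ ≤ C * (ℓ : ℝ) ^ 2) ∧
    (∀ ε : ℝ, 0 < ε → ∀ᶠ ℓ : ℕ in atTop, ∀ m ∈ Set.Icc (-(ℓ : ℤ)) ℓ,
      ‖hInner (hansenL kp ℓ m) (hansenN ks ℓ m)‖ ≤ ε) := by
  refine ⟨fun ℓ ℓ' m m' hm hm' => ?_, ⟨kp ^ 2, ?_⟩, ⟨2, ?_⟩, ⟨2 * ks ^ 2, ?_⟩, fun ε hε => ?_⟩
  · have s := isSolid_harmP ℓ m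
    have s' := isSolid_harmP ℓ' m'
    rw [hansenL_eq_spheroidal hm, hansenL_eq_spheroidal hm', hansenM_eq ks hm, hansenM_eq ks hm',
      hansenN_eq_spheroidal hm, hansenN_eq_spheroidal hm']
    have hLL := hasHInner_spheroidal s s' hkp hkp (kp / (2 * ℓ + 1)) (-kp)
      (kp / (2 * ℓ' + 1)) (-kp)
    have hMM := hasHInner_tor_tor s s' hks hks
    have hNN := hasHInner_spheroidal s s' hks hks (ks * (ℓ + 1) / (2 * ℓ + 1)) (ks * ℓ)
      (ks * (ℓ' + 1) / (2 * ℓ' + 1)) (ks * ℓ')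
    have hLM := hasHInner_spheroidal_tor s s' hkp hks (kp / (2 * ℓ + 1)) (-kp)
    have hMN := hasHInner_tor_spheroidal s s' hks hks (ks * (ℓ' + 1) / (2 * ℓ' + 1)) (ks * ℓ')
    have hLN := hasHInner_spheroidal s s' hkp hks (kp / (2 * ℓ + 1)) (-kp)
      (ks * (ℓ' + 1) / (2 * ℓ' + 1)) (ks * ℓ')
    refine ⟨hLL.1, hMM.1, hNN.1, hLM.1, hMN.1, hLN.1, fun hne => ?_, hLM.2, hMN.2⟩
    rw [hLL.2, hMM.2, hNN.2, hLN.2, sphInt_harmP_of_ne hne]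
    simp
  · filter_upwards [eventually_ge_atTop 2] with ℓ hℓ m hm
    have s := isSolid_harmP ℓ m
    rw [hansenL_eq_spheroidal hm, (hasHInner_spheroidal s s hkp hkp _ _ _ _).2,
      sphInt_harmP_self hm, one_mul, Complex.norm_real]
    have e1 := energyInt_self_le_one hkp (p := ℓ - 1) (by omega)
    have e2 := energyInt_self_le_one hkp (p := ℓ + 1) (by omega)
    have n1 := energyInt_self_nonneg kp (ℓ - 1)
    have n2 := energyInt_self_nonneg kp (ℓ + 1)
    have e : kp / (2 * ℓ + 1) * (kp / (2 * ℓ + 1)) * (ℓ * (2 * ℓ + 1)) * energyInt kp kp (ℓ - 1) +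
        -kp * -kp * ((ℓ + 1) / (2 * ℓ + 1)) * energyInt kp kp (ℓ + 1) =
        kp ^ 2 / (2 * ℓ + 1) * (ℓ * energyInt kp kp (ℓ - 1) +
          (ℓ + 1) * energyInt kp kp (ℓ + 1)) := by
      field_simp
    rw [e, Real.norm_of_nonneg (by positivity)]
    calc _ ≤ kp ^ 2 / (2 * ℓ + 1) * (ℓ * 1 + (ℓ + 1) * 1) := by gcongr
      _ = _ := by field_simp; ring
  · filter_upwards [eventually_ge_atTop 1] with ℓ hℓ m hm
    have s := isSolid_harmP ℓ m
    have hℓ1 : (1 : ℝ) ≤ ℓ := by exact_mod_cast hℓ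
    rw [hansenM_eq ks hm, (hasHInner_tor_tor s s hks hks).2, sphInt_harmP_self hm, one_mul,
      Complex.norm_real]
    have e1 := energyInt_self_le_one hks hℓ
    have n1 := energyInt_self_nonneg ks ℓ
    rw [Real.norm_of_nonneg (by positivity)]
    calc _ ≤ (ℓ : ℝ) * (ℓ + 1) * 1 := by gcongr
      _ ≤ _ := by nlinarith
  · filter_upwards [eventually_ge_atTop 2] with ℓ hℓ m hm
    have s := isSolid_harmP ℓ m
    have hℓ1 : (2 : ℝ) ≤ ℓ := by exact_mod_cast hℓ
    rw [hansenN_eq_spheroidal hm, (hasHInner_spheroidal s s hks hks _ _ _ _).2,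
      sphInt_harmP_self hm, one_mul, Complex.norm_real]
    have e1 := energyInt_self_le_one hks (p := ℓ - 1) (by omega)
    have e2 := energyInt_self_le_one hks (p := ℓ + 1) (by omega)
    have n1 := energyInt_self_nonneg ks (ℓ - 1)
    have n2 := energyInt_self_nonneg ks (ℓ + 1)
    have e : ks * (ℓ + 1) / (2 * ℓ + 1) * (ks * (ℓ + 1) / (2 * ℓ + 1)) * (ℓ * (2 * ℓ + 1)) *
          energyInt ks ks (ℓ - 1) +
        ks * ℓ * (ks * ℓ) * ((ℓ + 1) / (2 * ℓ + 1)) * energyInt ks ks (ℓ + 1) =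
        ks ^ 2 * (ℓ * (ℓ + 1)) / (2 * ℓ + 1) * ((ℓ + 1) * energyInt ks ks (ℓ - 1) +
          ℓ * energyInt ks ks (ℓ + 1)) := by
      field_simp
    rw [e, Real.norm_of_nonneg (by positivity)]
    calc _ ≤ ks ^ 2 * (ℓ * (ℓ + 1)) / (2 * ℓ + 1) * ((ℓ + 1) * 1 + ℓ * 1) := by gcongr
      _ = ks ^ 2 * (ℓ * (ℓ + 1)) := by field_simp; ring
      _ ≤ ks ^ 2 * (ℓ * (2 * ℓ)) := by gcongr; linarith
      _ = _ := by ring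
  · obtain ⟨D, hD, h⟩ := abs_energyInt_sub_le hkp hks
    filter_upwards [eventually_ge_atTop 4, eventually_ge_atTop ⌈kp * ks * D / ε⌉₊]
      with ℓ hℓ hℓε m hm
    have s := isSolid_harmP ℓ m
    have hℓ1 : (4 : ℝ) ≤ ℓ := by exact_mod_cast hℓ
    have hℓ0 : (0 : ℝ) < ℓ := by linarith
    rw [hansenL_eq_spheroidal hm, hansenN_eq_spheroidal hm,
      (hasHInner_spheroidal s s hkp hks _ _ _ _).2, sphInt_harmP_self hm, one_mul,
      Complex.norm_real]
    have e : kp / (2 * ℓ + 1) * (ks * (ℓ + 1) / (2 * ℓ + 1)) * (ℓ * (2 * ℓ + 1)) *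
          energyInt kp ks (ℓ - 1) +
        -kp * (ks * ℓ) * ((ℓ + 1) / (2 * ℓ + 1)) * energyInt kp ks (ℓ + 1) =
        kp * ks * (ℓ * ((ℓ + 1) / (2 * ℓ + 1))) *
          (energyInt kp ks (ℓ - 1) - energyInt kp ks (ℓ + 1)) := by
      field_simp
      ring
    have h1 : ((ℓ : ℝ) + 1) / (2 * ℓ + 1) ≤ 1 := by
      rw [div_le_one (by positivity)]; linarith
    rw [e, norm_mul, Real.norm_of_nonneg (by positivity), Real.norm_eq_abs]
    calc _ ≤ kp * ks * (ℓ * 1) * (D / (ℓ : ℝ) ^ 2) := by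
          gcongr
          exact h ℓ hℓ
      _ = kp * ks * D / ℓ := by field_simp
      _ ≤ ε := by
          rw [div_le_iff₀ hℓ0, ← div_le_iff₀' hε]
          exact Nat.ceil_le.1 hℓε
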